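/- Let $N\ge 4$, let $f:\mathbb D\to\mathbb C$ and $g:\mathbb D\to\mathbb R$ be smooth on the open unit disk, and consider on $\mathbb T^N=(\mathbb R/2\pi\mathbb Z)^N$ the system $$\dot\phi_j=f(Z)e^{i\phi_j}+g(Z)+\overline{f(Z)}\,e^{-i\phi_j}+\epsilon h(\phi_j),\qquad Z=\frac1N\sum_{j=1}^N e^{i\phi_j},$$ where $h(x)=\sum_{n\ge2}(a_n\sin nx+b_n\cos nx)$ is smooth and real with $\|h\|_{L^2}:=\big(\sum_{n\ge2}|a_n|^2+|b_n|^2\big)^{1/2}=1$. Let $\mathbb T^N_{\rm ord}=\{\theta_1<\dots<\theta_N<\theta_1+2\pi\}$, $$\Lambda_{p,q,r,s}(\theta)=\frac{(e^{i\theta_p}-e^{i\theta_s})(e^{i\theta_q}-e^{i\theta_r})}{(e^{i\theta_q}-e^{i\theta_s})(e^{i\theta_p}-e^{i\theta_r})},\qquad \Lambda=(\Lambda_{1,2,3,k+3})_{k=1}^{N-3},$$ $V=\{\lambda\in\mathbb R^{N-3}:1>\lambda_1>\dots>\lambda_{N-3}>0\}$, $\mathcal L_\lambda=\{\theta\in\mathbb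 T^N_{\rm ord}:\Lambda(\theta)=\lambda\}$, and $\lambda^*=\Lambda(\theta^*)$ with $\theta^*_j=-\pi+2\pi(j-1)/N$. A periodic orbit is understood to be non-constant. A stable orbit in $\mathcal L_\lambda$ is a periodic orbit of the unperturbed system ($\epsilon=0$) that is contained in $\mathcal L_\lambda$ and is exponentially stable for the flow on $\mathcal L_\lambda$. A continuum is a family $(\mathcal C_\lambda)_{\lambda\in W}$, with $W\subset V$ open, such that $\mathcal C_\lambda$ is a stable orbit in $\mathcal L_\lambda$ for every $\lambda\in W$; such that $W$ contains a closed ball of positive radius about $\lambda^*$, for every $\lambda$ in which $\mathcal C_\lambda$ is the only stable orbit in $\mathcal L_\lambda$; and such that $\mathcal M=\bigcup_{\lambda\in W}\mathcal C_\lambda$ is an $(N-2)$-dimensional normally attracting invariant manifold (NAIM) of class $C^{r}$, for a fixed integer $r\ge1$. The last condition means that $\mathcal M$ is a $C^r$ submanifold, invariant under the unperturbed flow $\Phi^t$, with a continuous splitting $T\mathbb T^N|_{\mathcal M}=T\mathcal M\oplus\mathcal N$ invariant under $D\Phi^t$, such that for each compact $K\subset\mathcal M$ there are $a<rb\le0$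 and $A>0$ with $\|D\Phi^t(x)\nu\|\le Ae^{bt}\|\nu\|$ for $t\le0$, $x\in K$, $\nu\in T_x\mathcal M$, and $\|D\Phi^t(x)\nu\|\le Ae^{at}\|\nu\|$ for $t\ge0$, $x\in K$, $\nu\in\mathcal N_x$. A continuum is the largest if every continuum $(\mathcal C'_\lambda)_{\lambda\in W'}$ satisfies $W'\subset W$ and $\mathcal C'_\lambda=\mathcal C_\lambda$ for $\lambda\in W'$. It is the largest connected one if $W$ is connected and this holds for every continuum with $W'$ connected. For a continuum, $\lambda\in W$ and $\theta\in\mathcal C_\lambda$, let $\phi_\lambda$ be the solution of the unperturbed system with $\phi_\lambda(0)=\theta$, let $T(\lambda)$ be its period, and put $$F_h(\lambda)=\frac1{T(\lambda)}\int_0^{T(\lambda)}\Big(\sum_{j=1}^N h(\theta_j)\,\partial_{\theta_j}\Lambda\Big)\big(\phi_\lambda(t)\big)\,dt\in\mathbb R^{N-3}.$$ Then the following statements hold. 1. For every continuum, $F_h$ is well defined on $W$ (each $\theta\in\mathcal C_\lambda$ determines a unique global solution, this solution has a period, and the integrand exists and is integrable), independent of the choice of $\theta\in\mathcal C_\lambda$,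 and continuously differentiable on $W$. 2. If $N=4$ and the continuum is the largest one or the largest connected one, then for every $\lambda\in W$ also $1-\lambda\in W$, and $F_h(\lambda)=-F_h(1-\lambda)$. In particular $F_h(\lambda^*)=0$ with $\lambda^*=1/2$. 3. For every $N\ge4$ and every continuum, $F_h(\lambda^*)=0$. Moreover, the average of the corresponding drift over $\mathcal C_{\lambda^*}$ also vanishes if $\Lambda$ is replaced by the cross-ratio coordinates $(\Lambda_{k,k+1,k+2,k+3})_{k=1}^{N-3}$. -/

import Mathlib

open scoped ContDiff

noncomputable section

namespace WS

/-- Points of the torus `𝕋ᴺ = (ℝ/2πℤ)ᴺ`. -/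
abbrev Torus (N : ℕ) := Fin N → Real.Angle

/-- Lifts of phases to the universal cover `ℝᴺ` of the torus; also the tangent spaces of the torus.
All norms on `ℝᴺ` are equivalent and none of the notions below depends on the choice. -/
abbrev Lift (N : ℕ) := Fin N → ℝ

/-- The cross-ratio parameters `(λ₁, …, λ_{N-3})`. -/
abbrev Param (N : ℕ) := Fin (N - 3) → ℝ

/-- The covering map `ℝᴺ → 𝕋ᴺ`. -/
def toTorus {N : ℕ} (θ : Lift N) : Torus N := fun j => (θ j : Real.Angle)

/-- Lifts with `θ₁ < … < θ_N < θ₁ + 2π`. -/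
def orderedLift (N : ℕ) [NeZero N] : Set (Lift N) :=
  {θ | StrictMono θ ∧ ∀ j, θ j < θ 0 + 2 * Real.pi}

/-- `e^{ix}`. -/
def cis (x : ℝ) : ℂ := Complex.exp (Complex.I * x)

/-- The Kuramoto order parameter `Z = (1/N) ∑ⱼ e^{iφⱼ}`. -/
def orderParameter {N : ℕ} (θ : Lift N) : ℂ := (1 / (N : ℂ)) * ∑ j, cis (θ j)

/-- The unperturbed vector field, with components `f(Z) e^{iφⱼ} + g(Z) + conj(f(Z)) e^{-iφⱼ}`.
This complex number is real, and `.re` only changes its type. -/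
def field {N : ℕ} (f : ℂ → ℂ) (g : ℂ → ℝ) (θ : Lift N) : Lift N := fun j =>
  (f (orderParameter θ) * cis (θ j) + (g (orderParameter θ) : ℂ)
    + (starRingEnd ℂ) (f (orderParameter θ)) * cis (-(θ j))).re

/-- `φ` is the lift of a trajectory of the vector field `X`, defined for all times. -/
def IsSolution {N : ℕ} (X : Lift N → Lift N) (φ : ℝ → Lift N) : Prop :=
  ∀ t, HasDerivAt φ (X (φ t)) t

/-- `T` is the (minimal, positive) period of the curve `t ↦ φ(t)` on the torus. An equilibrium has
none. -/
def IsPeriodOf {N : ℕ} (φ : ℝ → Lift N) (T : ℝ) : Prop :=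
  IsLeast {S : ℝ | 0 < S ∧ Function.Periodic (fun t => toTorus (φ t)) S} T

/-- `C` is a periodic orbit of `X` on the torus. -/
def IsPeriodicOrbit {N : ℕ} (X : Lift N → Lift N) (C : Set (Torus N)) : Prop :=
  ∃ φ T, IsSolution X φ ∧ IsPeriodOf φ T ∧ C = Set.range (fun t => toTorus (φ t))

/-! ### Cross-ratios -/

/-- The cross-ratio `Λ_{p,q,r,s}`. On distinct phases the quotient is a real number. -/
def crossRatio {N : ℕ} (p q r s : Fin N) (θ : Lift N) : ℝ :=
  (((cis (θ p) - cis (θ s)) * (cis (θ q) - cis (θ r))) /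
    ((cis (θ q) - cis (θ s)) * (cis (θ p) - cis (θ r)))).re

/-- The cross-ratio function `Λ = (Λ_{1,2,3,4}, Λ_{1,2,3,5}, …, Λ_{1,2,3,N})`
(phases are numbered from `0` here). -/
def crossRatios {N : ℕ} [NeZero N] (θ : Lift N) : Param N := fun k =>
  crossRatio 0 1 2 (Fin.ofNat N (k + 3)) θ

/-- The alternative coordinates `Λ_{k,k+1,k+2,k+3}` given by four consecutive phases. -/
def consecutiveCrossRatios {N : ℕ} [NeZero N] (θ : Lift N) : Param N := fun k =>
  crossRatio (Fin.ofNat N k) (Fin.ofNat N (k + 1)) (Fin.ofNat N (k + 2)) (Fin.ofNat N (k + 3)) θ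

/-- `V = {1 > λ₁ > … > λ_{N-3} > 0}`. -/
def paramDomain (N : ℕ) : Set (Param N) :=
  {l | (∀ k, l k ∈ Set.Ioo (0 : ℝ) 1) ∧ StrictAnti l}

/-- The level set of the cross-ratio function in the space of cyclically ordered phases. -/
def levelSet {N : ℕ} [NeZero N] (l : Param N) : Set (Torus N) :=
  toTorus '' {θ | θ ∈ orderedLift N ∧ crossRatios θ = l}

/-- The uniformly distributed phases `θ*ⱼ = -π + 2π(j-1)/N`, `j = 1, …, N`. -/
def uniformPhases (N : ℕ) : Lift N := fun j => -Real.pi + 2 * Real.pi / N * (j : ℕ)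

/-- The cross-ratio `λ*` of the uniform (splay) configuration. -/
def splayParam (N : ℕ) [NeZero N] : Param N := crossRatios (uniformPhases N)

/-! ### Stability and normally attracting invariant manifolds -/

/-- The set `C` is exponentially (orbitally) stable for the flow of `X` restricted to the invariant
set `L`: trajectories in `L` starting close to `C` exist for all positive times and approach `C`
exponentially. -/
def IsExpStableIn {N : ℕ} (X : Lift N → Lift N) (L C : Set (Torus N)) : Prop :=
  ∃ η K γ : ℝ, 0 < η ∧ 0 < K ∧ 0 < γ ∧
    ∀ θ : Lift N, toTorus θ ∈ L → Metric.infDist (toTorus θ) C < η →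
      ∃ φ : ℝ → Lift N, φ 0 = θ ∧
        (∀ t, 0 ≤ t → HasDerivWithinAt φ (X (φ t)) (Set.Ici 0) t) ∧
        ∀ t, 0 ≤ t → Metric.infDist (toTorus (φ t)) C
          ≤ K * Real.exp (-γ * t) * Metric.infDist (toTorus θ) C

/-- `C` is a periodic orbit in the level set of `l` that is exponentially stable in that level
set. -/
def IsStableOrbit {N : ℕ} [NeZero N] (X : Lift N → Lift N) (l : Param N) (C : Set (Torus N)) :
    Prop :=
  IsPeriodicOrbit X C ∧ C ⊆ levelSet l ∧ IsExpStableIn X (levelSet l) C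

/-- Embedded `Cʳ` submanifolds of `ℝᴺ` of codimension `c`, through local equations. -/
def IsSubmanifold {N : ℕ} (r c : ℕ) (S : Set (Lift N)) : Prop :=
  ∀ p ∈ S, ∃ U : Set (Lift N), IsOpen U ∧ p ∈ U ∧ ∃ G : Lift N → (Fin c → ℝ),
    ContDiffOn ℝ r G U ∧ (∀ x ∈ U, Function.Surjective (fderiv ℝ G x)) ∧
      S ∩ U = {x | x ∈ U ∧ G x = 0}

/-- The tangent space at `p` of a submanifold `S` (there the tangent cone is a subspace). -/
def tangentAt {N : ℕ} (S : Set (Lift N)) (p : Lift N) : Submodule ℝ (Lift N) :=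
  Submodule.span ℝ (tangentConeAt ℝ S p)

/-- `v` solves the variational equation of `X` along `φ`; for a solution `φ` this says that
`v(t) = DΦᵗ(φ(0)) v(0)`, where `Φ` is the flow. -/
def IsVariation {N : ℕ} (X : Lift N → Lift N) (φ v : ℝ → Lift N) : Prop :=
  ∀ t, HasDerivAt v (fderiv ℝ X (φ t) (v t)) t

/-- Normally attracting invariant manifolds of class `Cʳ` and codimension `2` on the torus.
The invariant splitting `TM ⊕ 𝒩` is encoded by the projection `P` onto `TM` along `𝒩`. For a compact
`M` the growth rates are uniform on `M`; for a non-compact `M` they are uniform on compact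
subsets. -/
structure IsNAIM {N : ℕ} (r : ℕ) (X : Lift N → Lift N) (M : Set (Torus N)) : Prop where
  submanifold : IsSubmanifold r 2 (toTorus ⁻¹' M)
  invariant : ∀ θ, toTorus θ ∈ M →
    ∃ φ, IsSolution X φ ∧ φ 0 = θ ∧ ∀ t, toTorus (φ t) ∈ M
  splitting : ∃ P : Torus N → Lift N →L[ℝ] Lift N,
    ContinuousOn P M ∧
    (∀ θ, toTorus θ ∈ M → (∀ v, P (toTorus θ) (P (toTorus θ) v) = P (toTorus θ) v) ∧
      Set.range (P (toTorus θ)) = tangentAt (toTorus ⁻¹' M) θ) ∧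
    (∀ φ v, IsSolution X φ → toTorus (φ 0) ∈ M → IsVariation X φ v →
      (P (toTorus (φ 0)) (v 0) = v 0 → ∀ t, P (toTorus (φ t)) (v t) = v t) ∧
      (P (toTorus (φ 0)) (v 0) = 0 → ∀ t, P (toTorus (φ t)) (v t) = 0)) ∧
    (∀ K : Set (Torus N), K ⊆ M → IsCompact K → ∃ a b A : ℝ, a < r * b ∧ b ≤ 0 ∧ 0 < A ∧
      ∀ φ v, IsSolution X φ → toTorus (φ 0) ∈ K → IsVariation X φ v →
        (P (toTorus (φ 0)) (v 0) = v 0 → ∀ t ≤ 0, ‖v t‖ ≤ A * Real.exp (b * t) * ‖v 0‖) ∧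
        (P (toTorus (φ 0)) (v 0) = 0 → ∀ t ≥ 0, ‖v t‖ ≤ A * Real.exp (a * t) * ‖v 0‖))

/-- `M = ⋃_{λ ∈ W} C_λ` extends the continuum of periodic orbits around the splay state: `W` is an
open set of parameters, each `C_λ` is a periodic orbit in the level set of `λ`, exponentially stable
in it, `M` is a NAIM (of dimension `N - 2`), and for all `λ` in a closed ball around `λ*` the orbit
`C_λ` is the only periodic orbit that is exponentially stable in the level set of `λ`. -/
structure IsContinuum {N : ℕ} [NeZero N] (r : ℕ) (X : Lift N → Lift N) (W : Set (Param N))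
    (C : Param N → Set (Torus N)) : Prop where
  isOpen : IsOpen W
  subset : W ⊆ paramDomain N
  orbit : ∀ l ∈ W, IsStableOrbit X l (C l)
  naim : IsNAIM r X (⋃ l ∈ W, C l)
  base : ∃ δ : ℝ, 0 < δ ∧ Metric.closedBall (splayParam N) δ ⊆ W ∧
    ∀ l ∈ Metric.closedBall (splayParam N) δ, ∀ C', IsStableOrbit X l C' → C' = C l

/-- The largest continuum. -/
def IsLargestContinuum {N : ℕ} [NeZero N] (r : ℕ) (X : Lift N → Lift N) (W : Set (Param N))
    (C : Param N → Set (Torus N)) : Prop :=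
  IsContinuum r X W C ∧
    ∀ W' C', IsContinuum r X W' C' → W' ⊆ W ∧ ∀ l ∈ W', C' l = C l

/-- The largest continuum over a connected set of parameters. -/
def IsLargestConnectedContinuum {N : ℕ} [NeZero N] (r : ℕ) (X : Lift N → Lift N)
    (W : Set (Param N)) (C : Param N → Set (Torus N)) : Prop :=
  IsContinuum r X W C ∧ IsConnected W ∧
    ∀ W' C', IsContinuum r X W' C' → IsConnected W' → W' ⊆ W ∧ ∀ l ∈ W', C' l = C l

/-! ### The perturbation and the averaged drift -/

/-- `h` is smooth, `h(x) = ∑_{n ≥ 2} (aₙ sin nx + bₙ cos nx)` for some real coefficients, and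
`√(∑_{n ≥ 2} (|aₙ|² + |bₙ|²)) = 1`. -/
def IsNormalizedPerturbation (h : ℝ → ℝ) : Prop :=
  ContDiff ℝ ∞ h ∧ ∃ a b : ℕ → ℝ,
    (∀ x, HasSum (fun n : ℕ => a (n + 2) * Real.sin (((n + 2 : ℕ) : ℝ) * x)
      + b (n + 2) * Real.cos (((n + 2 : ℕ) : ℝ) * x)) (h x)) ∧
    Summable (fun n : ℕ => |a (n + 2)| ^ 2 + |b (n + 2)| ^ 2) ∧
    Real.sqrt (∑' n : ℕ, (|a (n + 2)| ^ 2 + |b (n + 2)| ^ 2)) = 1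

/-- `(DΛ · h)(θ) = ∑ⱼ h(θⱼ) ∂Λ/∂θⱼ(θ)`, for coordinates `Λ`. -/
def drift {N : ℕ} (Λ : Lift N → Param N) (h : ℝ → ℝ) (θ : Lift N) : Param N :=
  fderiv ℝ Λ θ (fun j => h (θ j))

/-- The average `(1/T) ∫₀ᵀ (DΛ · h)(φ(t)) dt`. -/
def averagedDrift {N : ℕ} (Λ : Lift N → Param N) (h : ℝ → ℝ) (φ : ℝ → Lift N) (T : ℝ) : Param N :=
  (1 / T) • ∫ t in (0 : ℝ)..T, drift Λ h (φ t)

end WS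

end

open WS

open Filter Set Topology

/-! For a frozen value of `Z` the field is `α cos θ + β sin θ + γ`, with coefficients common to all
phases: an infinitesimal Möbius transformation of the circle. Cross-ratios are Möbius invariants, so
they are first integrals of the full system. Distinct phases force `‖Z‖ < 1`, so the field is smooth
near every orbit in a level set, solutions there are unique, and any two solutions in the same orbit
agree on the torus up to a time shift. Hence orbit averages depend neither on the base point nor on
the positive period used.

Differentiability rests on a transversality argument
(`IsNAIM.exists_tangent_fderiv_crossRatios_eq`). Since `Λ` is a first integral, `DΛ(φ) v` is
constant along every variation `v`. A variation in the normal bundle decays exponentially while `DΛ`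
stays bounded on a periodic orbit, so `DΛ` annihilates the normal bundle. As `DΛ` is onto, it is
already onto on the tangent space of the manifold. Therefore two local equations `G` of the
manifold, the `N - 3` cross-ratios and one phase along which the field does not vanish are local
coordinates of `ℝᴺ`. An orbit segment with prescribed initial coordinates, ending on a fixed
hyperplane, is found by the inverse function theorem in a space of continuous curves
(`exists_strict_continuation`); the linearization is invertible because Volterra operators are. With
initial coordinates `(0, λ, const)` the segment lies on `C_λ`, its endpoint has the same coordinates
as its starting point, and it closes up. Its time-rescaled integral is the orbit average and is
strictly differentiable in `λ` at each point of `W`, which gives `C¹`.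

The symmetries come from cyclic relabelling of the phases. The field is permutation equivariant and
the relabelling acts on the parameters by a map `S` (`shiftParam`) that fixes `λ*`. Uniqueness of
the stable orbit makes `C_{λ*}` invariant, so its averaged drift `d` satisfies `DS(λ*) d = d`. Lift
`d` to a vector `v` at the uniform phases: every cyclic shift of `v` is again mapped to `d`, while
the sum of all shifts is a constant vector, that is, an infinitesimal rotation, which `DΛ`
annihilates. Thus `N d = 0`. Each consecutive cross-ratio is the first cross-ratio of a shifted
configuration, so its averaged drift vanishes too. For `N = 4`, `S(λ) = 1 - λ`; the shifted
continuum is again a continuum, and maximality identifies it with the given one. -/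

namespace WS

/-! ### Differential calculus on spaces of curves and linear Volterra equations -/

section Analysis

variable {E F : Type*} [NormedAddCommGroup E] [NormedSpace ℝ E] [NormedAddCommGroup F]
  [NormedSpace ℝ F]

/-- A smooth map on an open set can be modified away from a compact subset so that it becomes
globally smooth and compactly supported. -/
theorem exists_contDiff_hasCompactSupport_eq [FiniteDimensional ℝ E] {n : ℕ∞} {X : E → F}
    {Ω K : Set E} (hΩ : IsOpen Ω) (hX : ContDiffOn ℝ n X Ω) (hK : IsCompact K) (hKΩ : K ⊆ Ω) :
    ∃ Y : E → F, ContDiff ℝ n Y ∧ HasCompactSupport Y ∧ ∀ᶠ x in 𝓝ˢ K, Y x = X x := by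
  obtain ⟨L, hL, hKL, hLΩ⟩ := exists_compact_between hK hΩ hKΩ
  obtain ⟨χ, h1, h0, -⟩ := exists_contMDiffMap_one_nhds_of_subset_interior
    (n := n) (modelWithCornersSelf ℝ E) hK.isClosed hKL
  have hχ : ContDiff ℝ n χ := χ.contMDiff.contDiff
  refine ⟨fun x => χ x • X x, ?_, ?_, ?_⟩
  · rw [contDiff_iff_contDiffAt]
    intro x
    by_cases hx : x ∈ Ω
    · exact hχ.contDiffAt.smul (hX.contDiffAt (hΩ.mem_nhds hx))
    · have : (fun x => χ x • X x) =ᶠ[𝓝 x] fun _ => 0 := by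
        filter_upwards [hL.isClosed.isOpen_compl.mem_nhds fun h => hx (hLΩ h)] with y hy
        rw [h0 y hy, zero_smul]
      exact contDiffAt_const.congr_of_eventuallyEq this
  · refine HasCompactSupport.intro hL fun x hx => ?_
    rw [h0 x hx, zero_smul]
  · filter_upwards [h1] with x hx
    rw [hx, one_smul]

/-- Strict differentiability at `x` makes `f - f'(x)` Lipschitz near `x` with an arbitrarily small
constant, and this constant bounds `‖f'(y) - f'(x)‖` for `y` near `x`. So pointwise strict
derivatives on an open set vary continuously. -/
theorem contDiffOn_one_of_hasStrictFDerivAt {f : E → F} {U : Set E} (hU : IsOpen U)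
    (h : ∀ x ∈ U, ∃ f' : E →L[ℝ] F, HasStrictFDerivAt f f' x) : ContDiffOn ℝ 1 f U := by
  have hd : ∀ x ∈ U, HasStrictFDerivAt f (fderiv ℝ f x) x := by
    intro x hx
    obtain ⟨f', hf'⟩ := h x hx
    rwa [hf'.hasFDerivAt.fderiv]
  rw [show (1 : ℕ∞ω) = 0 + 1 from rfl, contDiffOn_succ_iff_fderiv_of_isOpen hU]
  refine ⟨fun x hx => (hd x hx).hasFDerivAt.differentiableAt.differentiableWithinAt, by simp, ?_⟩
  rw [contDiffOn_zero]
  intro x hx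
  refine ContinuousAt.continuousWithinAt ?_
  rw [Metric.continuousAt_iff']
  intro ε hε
  obtain ⟨s, hs, hfs⟩ := (hd x hx).approximates_deriv_on_nhds
    (c := (ε / 2).toNNReal) (Or.inr (by simpa using hε))
  filter_upwards [hU.mem_nhds hx, eventually_mem_nhds_iff.2 hs] with y hyU hys
  rw [dist_eq_norm]
  have := ((hd y hyU).hasFDerivAt.sub (fderiv ℝ f x).hasFDerivAt).le_of_lipschitzOn hys
    hfs.lipschitzOnWith
  rw [Real.coe_toNNReal _ (by positivity)] at this
  exact lt_of_le_of_lt this (by linarith)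

variable {K : Type*} [TopologicalSpace K] [CompactSpace K]

/-- Pointwise application of a continuous family of linear maps. -/
noncomputable def pointwiseApply (A : C(K, E →L[ℝ] F)) : C(K, E) →L[ℝ] C(K, F) :=
  LinearMap.mkContinuous
    { toFun := fun y => ⟨fun s => A s (y s), A.continuous.clm_apply y.continuous⟩
      map_add' := fun y z => by ext s; simp
      map_smul' := fun c y => by ext s; simp } ‖A‖ (fun y => by
        rw [ContinuousMap.norm_le _ (by positivity)]
        exact fun s => ((A s).le_opNorm _).trans
          (mul_le_mul (A.norm_coe_le_norm s) (y.norm_coe_le_norm s) (norm_nonneg _)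
            (norm_nonneg A)))

@[simp]
theorem pointwiseApply_apply (A : C(K, E →L[ℝ] F)) (y : C(K, E)) (s : K) :
    pointwiseApply A y s = A s (y s) := rfl

/-- Composition with a `C¹` map is strictly differentiable on spaces of continuous maps. -/
theorem hasStrictFDerivAt_comp_continuousMap {X : E → F} (hX : ContDiff ℝ 1 X) (y₀ : C(K, E)) :
    HasStrictFDerivAt (fun y : C(K, E) => (⟨X, hX.continuous⟩ : C(E, F)).comp y)
      (pointwiseApply ⟨fun s => fderiv ℝ X (y₀ s),
        (hX.continuous_fderiv one_ne_zero).comp y₀.continuous⟩) y₀ := by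
  refine HasStrictFDerivAt.of_isLittleO (Asymptotics.IsLittleO.of_bound fun ε hε => ?_)
  have hc : IsCompact (range y₀) := isCompact_range y₀.continuous
  have := hc.uniformContinuousAt_of_continuousAt (fderiv ℝ X)
    (fun a _ => (hX.continuous_fderiv one_ne_zero).continuousAt) (Metric.dist_mem_uniformity hε)
  obtain ⟨δ, hδ, H⟩ := Metric.mem_uniformity_dist.1 this
  have hb : Metric.ball y₀ δ ×ˢ Metric.ball y₀ δ ∈ 𝓝 (y₀, y₀) :=
    prod_mem_nhds (Metric.ball_mem_nhds _ hδ) (Metric.ball_mem_nhds _ hδ)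
  filter_upwards [hb] with ⟨y, z⟩ ⟨hy, hz⟩
  simp only [Metric.mem_ball] at hy hz
  rw [ContinuousMap.norm_le _ (by positivity)]
  intro s
  have hconv := (convex_ball (y₀ s) δ).norm_image_sub_le_of_norm_hasFDerivWithin_le' (f := X)
    (f' := fderiv ℝ X) (φ := fderiv ℝ X (y₀ s)) (C := ε) (x := z s) (y := y s)
    (fun x _ => ((hX.differentiable one_ne_zero) x).hasFDerivAt.hasFDerivWithinAt)
    (fun x hx => by
      have := H (a := y₀ s) (b := x) (by rw [dist_comm]; exact hx) (mem_range_self s)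
      rw [← dist_eq_norm, dist_comm]
      exact le_of_lt this)
    ((ContinuousMap.dist_apply_le_dist s).trans_lt hz)
    ((ContinuousMap.dist_apply_le_dist s).trans_lt hy)
  refine le_trans ?_ (hconv.trans (mul_le_mul_of_nonneg_left ?_ hε.le))
  · simp
  · exact (y - z).norm_coe_le_norm s

/-- Linear Volterra equations with bounded coefficients have global solutions. -/
theorem exists_volterra_solution [CompleteSpace E] {A : ℝ → E →L[ℝ] E} (hA : Continuous A)
    {M : ℝ} (hM : ∀ t, ‖A t‖ ≤ M) {η : ℝ → E} (hη : Continuous η) {B : ℝ} (hB : ∀ t, ‖η t‖ ≤ B) :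
    ∃ y : ℝ → E, Continuous y ∧ ∀ t, y t = η t + ∫ s in (0 : ℝ)..t, A s (y s) := by
  have hM0 : 0 ≤ M := (norm_nonneg _).trans (hM 0)
  have hB0 : 0 ≤ B := (norm_nonneg _).trans (hB 0)
  -- Bielecki's weight: in the unknown `u = y / cosh (κ t)` the integral operator has norm at most
  -- `M / κ ≤ 1/2`, on both time directions at once. The summand `1` keeps `κ` positive when `M =
  -- 0`.
  set κ : ℝ := 2 * M + 1 with hκ
  have hκ0 : 0 < κ := by positivity
  have hch : Continuous fun t : ℝ => Real.cosh (κ * t) := by fun_prop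
  have hpos : ∀ t : ℝ, 0 < Real.cosh (κ * t) := fun t => Real.cosh_pos _
  have hint : ∀ t : ℝ, |∫ s in (0 : ℝ)..t, Real.cosh (κ * s)| ≤ Real.cosh (κ * t) / κ := by
    intro t
    have h1 : ∫ s in (0 : ℝ)..t, Real.cosh (κ * s) = Real.sinh (κ * t) / κ := by
      rw [intervalIntegral.integral_eq_sub_of_hasDerivAt
        (f := fun s => Real.sinh (κ * s) / κ)]
      · simp
      · intro s _
        have := ((Real.hasDerivAt_sinh (κ * s)).comp s ((hasDerivAt_id s).const_mul κ)).div_const κ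
        simpa [Function.comp_def, mul_div_assoc, hκ0.ne'] using this
      · exact hch.intervalIntegrable _ _
    rw [h1, abs_div, abs_of_pos hκ0]
    gcongr
    have := Real.cosh_sq (κ * t)
    exact abs_le_of_sq_le_sq (by linarith) (hpos t).le
  have hw : ∀ (u : BoundedContinuousFunction ℝ E),
      Continuous fun s => Real.cosh (κ * s) • A s (u s) :=
    fun u => hch.smul (hA.clm_apply u.continuous)
  have hest : ∀ (u : BoundedContinuousFunction ℝ E) (t : ℝ),
      ‖∫ s in (0 : ℝ)..t, Real.cosh (κ * s) • A s (u s)‖ ≤ M * ‖u‖ * (Real.cosh (κ * t) / κ) := by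
    intro u t
    have h1 := intervalIntegral.norm_integral_le_abs_of_norm_le (μ := MeasureTheory.volume)
      (a := 0) (b := t) (f := fun s => Real.cosh (κ * s) • A s (u s))
      (g := fun s => M * ‖u‖ * Real.cosh (κ * s))
      (Eventually.of_forall fun s => by
        rw [norm_smul, Real.norm_of_nonneg (hpos s).le, mul_comm]
        refine mul_le_mul_of_nonneg_right ?_ (hpos s).le
        exact ((A s).le_opNorm _).trans
          (mul_le_mul (hM s) (u.norm_coe_le_norm s) (norm_nonneg _) hM0))
      ((continuous_const.mul hch).intervalIntegrable _ _)
    refine h1.trans ?_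
    rw [intervalIntegral.integral_const_mul, abs_mul, abs_of_nonneg (by positivity)]
    exact mul_le_mul_of_nonneg_left (hint t) (by positivity)
  let Φ : BoundedContinuousFunction ℝ E → BoundedContinuousFunction ℝ E := fun u =>
    BoundedContinuousFunction.ofNormedAddCommGroup
      (fun t => (Real.cosh (κ * t))⁻¹ • (η t + ∫ s in (0 : ℝ)..t, Real.cosh (κ * s) • A s (u s)))
      ((hch.inv₀ fun t => (hpos t).ne').smul
        (hη.add (intervalIntegral.continuous_primitive
          (fun a b => (hw u).intervalIntegrable a b) 0)))
      (B + M * ‖u‖ / κ) (fun t => by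
        rw [norm_smul, norm_inv, Real.norm_of_nonneg (hpos t).le, inv_mul_le_iff₀ (hpos t)]
        refine (norm_add_le _ _).trans ?_
        rw [mul_add]
        refine add_le_add ?_ ((hest u t).trans (le_of_eq (by ring)))
        exact (hB t).trans (le_mul_of_one_le_left hB0 (Real.one_le_cosh _)))
  have hΦ : ∀ u t, Φ u t = (Real.cosh (κ * t))⁻¹ • (η t + ∫ s in (0 : ℝ)..t,
    Real.cosh (κ * s) • A s (u s)) := fun u t => rfl
  have hcontr : ContractingWith (1 / 2) Φ := by
    refine ⟨by rw [← NNReal.coe_lt_coe]; norm_num, LipschitzWith.of_dist_le_mul fun u v => ?_⟩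
    rw [BoundedContinuousFunction.dist_le (by positivity)]
    intro t
    have h1 : Φ u t - Φ v t = (Real.cosh (κ * t))⁻¹ •
        ∫ s in (0 : ℝ)..t, Real.cosh (κ * s) • A s ((u - v) s) := by
      rw [hΦ, hΦ, ← smul_sub, add_sub_add_left_eq_sub,
        ← intervalIntegral.integral_sub ((hw u).intervalIntegrable _ _)
          ((hw v).intervalIntegrable _ _)]
      simp [smul_sub]
    rw [dist_eq_norm, h1, norm_smul, norm_inv, Real.norm_of_nonneg (hpos t).le,
      inv_mul_le_iff₀ (hpos t), dist_eq_norm]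
    refine (hest _ t).trans ?_
    have : M / κ ≤ 1 / 2 := by
      rw [div_le_div_iff₀ hκ0 two_pos]; linarith
    have h2 : M * ‖u - v‖ * (Real.cosh (κ * t) / κ)
      = (M / κ) * (Real.cosh (κ * t) * ‖u - v‖) := by ring
    rw [h2]
    have h3 := mul_le_mul_of_nonneg_right this
      (mul_nonneg (hpos t).le (norm_nonneg (u - v)))
    refine h3.trans (le_of_eq ?_)
    push_cast
    ring
  obtain ⟨u, hu⟩ : ∃ u, Φ u = u := ⟨_, hcontr.fixedPoint_isFixedPt⟩
  refine ⟨fun t => Real.cosh (κ * t) • u t, hch.smul u.continuous, fun t => ?_⟩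
  have h1 : u t = (Real.cosh (κ * t))⁻¹ • (η t + ∫ s in (0 : ℝ)..t,
    Real.cosh (κ * s) • A s (u s)) := by rw [← hΦ, hu]
  simp only [map_smul]
  rw [h1, smul_inv_smul₀ (hpos t).ne']

/-- Linear differential equations with bounded continuous coefficients have global solutions. -/
theorem exists_linear_ode_solution [CompleteSpace E] {A : ℝ → E →L[ℝ] E} (hA : Continuous A)
    {M : ℝ} (hM : ∀ t, ‖A t‖ ≤ M) (v₀ : E) :
    ∃ v : ℝ → E, v 0 = v₀ ∧ ∀ t, HasDerivAt v (A t (v t)) t := by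
  obtain ⟨y, hy, h⟩ := exists_volterra_solution hA hM (η := fun _ => v₀) continuous_const
    (fun _ => le_rfl)
  refine ⟨y, by simpa using h 0, fun t => ?_⟩
  have h1 : y = fun t => v₀ + ∫ s in (0 : ℝ)..t, A s (y s) := funext h
  have h2 := (intervalIntegral.integral_hasDerivAt_right
    ((hA.clm_apply hy).intervalIntegrable 0 t)
    ((hA.clm_apply hy).stronglyMeasurableAtFilter _ _) (hA.clm_apply hy).continuousAt).const_add v₀
  rwa [← h1] at h2

end Analysis

end WS

/-! ### Continuation of orbit segments by the inverse function theorem -/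

namespace WS

theorem continuous_IccExtend_unitInterval {E : Type*} [TopologicalSpace E]
    (u : C(unitInterval, E)) : Continuous (IccExtend zero_le_one u) := u.continuous.Icc_extend'

section Continuation

variable {E F : Type*} [NormedAddCommGroup E] [NormedSpace ℝ E]

/-- The primitive of a continuous function on the unit interval. -/
noncomputable def primitive : C(unitInterval, E) →L[ℝ] C(unitInterval, E) :=
  LinearMap.mkContinuous
    { toFun := fun u => ⟨fun s => ∫ r in (0 : ℝ)..s, IccExtend zero_le_one u r,
        (intervalIntegral.continuous_primitive (fun a b =>
          (continuous_IccExtend_unitInterval u).intervalIntegrable a b) 0).comp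
          continuous_subtype_val⟩
      map_add' := fun u v => by
        ext s
        simp only [ContinuousMap.coe_mk, ContinuousMap.add_apply]
        rw [← intervalIntegral.integral_add
          ((continuous_IccExtend_unitInterval u).intervalIntegrable _ _)
          ((continuous_IccExtend_unitInterval v).intervalIntegrable _ _)]
        rfl
      map_smul' := fun c u => by
        ext s
        simp only [ContinuousMap.coe_mk, ContinuousMap.smul_apply, RingHom.id_apply]
        rw [← intervalIntegral.integral_smul]
        rfl } 1 (fun u => by
      rw [ContinuousMap.norm_le _ (by positivity)]
      intro s
      have := intervalIntegral.norm_integral_le_of_norm_le_const (a := 0) (b := (s : ℝ))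
        (f := IccExtend zero_le_one u) (C := ‖u‖) (fun x _ => u.norm_coe_le_norm _)
      refine this.trans ?_
      rw [sub_zero, abs_of_nonneg s.2.1, mul_comm]
      exact mul_le_mul_of_nonneg_right s.2.2 (norm_nonneg u))

theorem primitive_apply (u : C(unitInterval, E)) (s : unitInterval) :
    primitive u s = ∫ r in (0 : ℝ)..s, IccExtend zero_le_one u r := rfl

theorem hasDerivAt_primitive [CompleteSpace E] (u : C(unitInterval, E)) (t : ℝ) :
    HasDerivAt (fun t => ∫ r in (0 : ℝ)..t, IccExtend zero_le_one u r)
      (IccExtend zero_le_one u t) t :=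
  intervalIntegral.integral_hasDerivAt_right
    ((continuous_IccExtend_unitInterval u).intervalIntegrable _ _)
    ((continuous_IccExtend_unitInterval u).stronglyMeasurableAtFilter _ _)
    (continuous_IccExtend_unitInterval u).continuousAt

/-- The primitive is determined by its derivative and its initial value. -/
theorem primitive_eq_of_hasDerivAt [CompleteSpace E] {u : C(unitInterval, E)} {g : ℝ → E}
    (hg : ∀ s : unitInterval, HasDerivAt g (u s) s) (s : unitInterval) :
    primitive u s = g s - g 0 := by
  rw [primitive_apply]
  refine intervalIntegral.integral_eq_sub_of_hasDerivAt (fun t ht => ?_)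
    ((continuous_IccExtend_unitInterval u).intervalIntegrable _ _)
  rw [uIcc_of_le s.2.1] at ht
  have hI : t ∈ Icc (0 : ℝ) 1 := ⟨ht.1, ht.2.trans s.2.2⟩
  rw [IccExtend_of_mem _ _ hI]
  exact hg ⟨t, hI⟩

/-- A kernel element solves a linear differential equation with zero initial value, so it vanishes;
surjectivity is solvability of the Volterra equation with the data extended constantly beyond the
interval. -/
theorem bijective_volterra [CompleteSpace E] (A : C(unitInterval, E →L[ℝ] E)) :
    Function.Bijective
      (ContinuousLinearMap.id ℝ C(unitInterval, E) - primitive.comp (pointwiseApply A)) := by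
  have hA : Continuous (IccExtend zero_le_one A) := A.continuous.Icc_extend'
  have hAM : ∀ t, ‖IccExtend zero_le_one A t‖ ≤ ‖A‖ := fun t => A.norm_coe_le_norm _
  have hext : ∀ (y : C(unitInterval, E)) (t : ℝ), IccExtend zero_le_one (pointwiseApply A y) t =
    IccExtend zero_le_one A t (IccExtend zero_le_one y t) := fun _ _ => rfl
  constructor
  · rw [injective_iff_map_eq_zero]
    intro y hy
    have hy' : y = primitive (pointwiseApply A y) := by
      simpa [sub_eq_zero] using hy
    -- A priori `y` is only continuous. Its representation as a primitive is differentiable on `ℝ`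
    -- and can enter ODE uniqueness.
    set Y : ℝ → E := fun t => ∫ r in (0 : ℝ)..t, IccExtend zero_le_one (pointwiseApply A y) r
      with hY
    have hYy : ∀ t (ht : t ∈ Icc (0 : ℝ) 1), Y t = y ⟨t, ht⟩ := by
      intro t ht
      conv_rhs => rw [hy']
      rfl
    have hYd := hasDerivAt_primitive (pointwiseApply A y)
    have := ODE_solution_unique (f := Y) (g := fun _ => 0) (a := 0) (b := 1) (K := ‖A‖₊)
      (v := fun t x => IccExtend zero_le_one A t x)
      (fun t => (IccExtend zero_le_one A t).lipschitz.weaken (hAM t))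
      (fun t _ => (hYd t).continuousAt.continuousWithinAt)
      (fun t ht => by
        have h1 := (hYd t).hasDerivWithinAt (s := Ici t)
        rw [hext] at h1
        rw [hYy t ⟨ht.1, ht.2.le⟩]
        rwa [IccExtend_of_mem zero_le_one y ⟨ht.1, ht.2.le⟩] at h1)
      continuousOn_const
      (fun t _ => by simpa using hasDerivWithinAt_const t (Ici t) (0 : E))
      (by simp [hY])
    ext s
    have h2 := this s.2
    rw [hYy s s.2] at h2
    simpa using h2
  · intro η
    obtain ⟨y, hy, h⟩ := exists_volterra_solution hA hAM
      (continuous_IccExtend_unitInterval η) (B := ‖η‖) (fun t => η.norm_coe_le_norm _)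
    refine ⟨⟨fun s => y s, hy.comp continuous_subtype_val⟩, ?_⟩
    ext s
    simp only [sub_apply, ContinuousLinearMap.id_apply,
      ContinuousLinearMap.comp_apply, ContinuousMap.sub_apply, ContinuousMap.coe_mk]
    rw [h s, IccExtend_val, primitive_apply, sub_eq_iff_eq_add]
    congr 1
    refine intervalIntegral.integral_congr fun t ht => ?_
    rw [uIcc_of_le s.2.1] at ht
    have hI : t ∈ Icc (0 : ℝ) 1 := ⟨ht.1, ht.2.trans s.2.2⟩
    rw [hext, IccExtend_of_mem _ (⟨fun s : unitInterval => y s, _⟩ : C(unitInterval, E)) hI]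
    rfl

/-- The embedding of constants into the continuous functions. -/
noncomputable def constFun : E →L[ℝ] C(unitInterval, E) :=
  LinearMap.mkContinuous
    { toFun := fun x => ContinuousMap.const _ x
      map_add' := fun _ _ => rfl
      map_smul' := fun _ _ => rfl } 1 (fun x => by
        rw [ContinuousMap.norm_le _ (by positivity)]
        intro s
        change ‖x‖ ≤ 1 * ‖x‖
        rw [one_mul])

@[simp]
theorem constFun_apply (x : E) (s : unitInterval) : constFun x s = x := rfl

set_option maxHeartbeats 1000000 in
/-- Solutions of `ẏ = T X(y)` on the unit interval with `Ψ (y 0) = w` and `τ (y 1)` prescribed, as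
strictly differentiable functions of `w`. -/
theorem exists_strict_continuation [CompleteSpace E] [NormedAddCommGroup F] [NormedSpace ℝ F]
    [CompleteSpace F] {X : E → E}
    (hX : ContDiff ℝ 1 X) {φ : ℝ → E} (hφc : Continuous φ) (T₀ : ℝ)
    (hφ : ∀ s : unitInterval, HasDerivAt φ (X (φ (T₀ * s))) (T₀ * s))
    {Ψ : E → F} {Ψ' : E ≃L[ℝ] F} (hΨ : HasStrictFDerivAt Ψ (Ψ' : E →L[ℝ] F) (φ 0))
    (τ : E →L[ℝ] ℝ) (hτ : τ (X (φ T₀)) ≠ 0) :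
    ∃ (y : F → C(unitInterval, E)) (x : F → E) (T : F → ℝ),
      (∃ y' : F →L[ℝ] C(unitInterval, E), HasStrictFDerivAt y y' (Ψ (φ 0))) ∧ ContinuousAt x (Ψ (φ 0)) ∧
      ContinuousAt T (Ψ (φ 0)) ∧ (∀ s : unitInterval, y (Ψ (φ 0)) s = φ (T₀ * s)) ∧
      x (Ψ (φ 0)) = φ 0 ∧ T (Ψ (φ 0)) = T₀ ∧
      ∀ᶠ w in 𝓝 (Ψ (φ 0)), Ψ (x w) = w ∧ τ (y w 1) = τ (φ T₀) ∧
        ∀ s : unitInterval, y w s = x w + T w • ∫ r in (0 : ℝ)..s,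
          X (IccExtend zero_le_one (y w) r) := by
  let y₀ : C(unitInterval, E) := ⟨fun s => φ (T₀ * s), by fun_prop⟩
  let N : C(unitInterval, E) → C(unitInterval, E) :=
    fun y => (⟨X, hX.continuous⟩ : C(E, E)).comp y
  let A : C(unitInterval, E →L[ℝ] E) := ⟨fun s => fderiv ℝ X (y₀ s),
    (hX.continuous_fderiv one_ne_zero).comp y₀.continuous⟩
  have hN : HasStrictFDerivAt N (pointwiseApply A) y₀ := hasStrictFDerivAt_comp_continuousMap hX y₀
  -- The unknowns are the curve, its initial point and the travel time. The components are the
  -- integral equation, the coordinates of the initial point and the section through the endpoint.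
  let H : C(unitInterval, E) × E × ℝ → C(unitInterval, E) × F × ℝ := fun p =>
    (p.1 - constFun p.2.1 - p.2.2 • primitive (N p.1), Ψ p.2.1, τ (p.1 1))
  let p₀ : C(unitInterval, E) × E × ℝ := (y₀, φ 0, T₀)
  have hfst : HasStrictFDerivAt (fun p : C(unitInterval, E) × E × ℝ => p.1)
      (ContinuousLinearMap.fst ℝ _ _) p₀ := hasStrictFDerivAt_fst
  have hx : HasStrictFDerivAt (fun p : C(unitInterval, E) × E × ℝ => p.2.1)
      ((ContinuousLinearMap.fst ℝ _ _).comp (ContinuousLinearMap.snd ℝ _ _)) p₀ :=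
    hasStrictFDerivAt_fst.comp p₀ hasStrictFDerivAt_snd
  have hT : HasStrictFDerivAt (fun p : C(unitInterval, E) × E × ℝ => p.2.2)
      ((ContinuousLinearMap.snd ℝ _ _).comp (ContinuousLinearMap.snd ℝ _ _)) p₀ :=
    hasStrictFDerivAt_snd.comp p₀ hasStrictFDerivAt_snd
  have hN' : HasStrictFDerivAt (fun p : C(unitInterval, E) × E × ℝ => primitive (N p.1)) _ p₀ :=
    (primitive.hasStrictFDerivAt).comp p₀
      ((show HasStrictFDerivAt N (pointwiseApply A) p₀.1 from hN).comp p₀ hfst)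
  have hΨ' : HasStrictFDerivAt (fun p : C(unitInterval, E) × E × ℝ => Ψ p.2.1) _ p₀ :=
    (show HasStrictFDerivAt Ψ (Ψ' : E →L[ℝ] F) p₀.2.1 from hΨ).comp p₀ hx
  have hτ' : HasStrictFDerivAt (fun p : C(unitInterval, E) × E × ℝ => τ (p.1 1)) _ p₀ :=
    (τ.comp (ContinuousMap.evalCLM ℝ (1 : unitInterval))).hasStrictFDerivAt.comp p₀ hfst
  have hc : HasStrictFDerivAt (fun p : C(unitInterval, E) × E × ℝ => constFun p.2.1) _ p₀ :=
    (constFun.hasStrictFDerivAt).comp p₀ hx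
  obtain ⟨D, hD, hDapp⟩ : ∃ D : (C(unitInterval, E) × E × ℝ) →L[ℝ] (C(unitInterval, E) × F × ℝ),
      HasStrictFDerivAt H D p₀ ∧ ∀ η x T, D (η, x, T) =
        (η - constFun x - (T₀ • primitive (pointwiseApply A η) + T • primitive (N y₀)),
          Ψ' x, τ (η 1)) := by
    refine ⟨_, ((hfst.sub hc).sub (hT.smul hN')).prodMk (hΨ'.prodMk hτ'), fun η x T => ?_⟩
    rfl
  let Q := ContinuousLinearMap.id ℝ C(unitInterval, E) - primitive.comp (pointwiseApply (T₀ • A))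
  have hQ : Function.Bijective Q := bijective_volterra (T₀ • A)
  have hQapp : ∀ η, Q η = η - T₀ • primitive (pointwiseApply A η) := by
    intro η
    have : pointwiseApply (T₀ • A) η = T₀ • pointwiseApply A η := rfl
    simp [Q, this]
  -- The derivative of `φ (T s)` in `T` at `T₀`. A change of the travel time is thus compensated by
  -- a multiple of `ζ`, which puts `D` in the form `hDQ`; transversality is `τ (ζ 1) ≠ 0`.
  let ζ : C(unitInterval, E) := ⟨fun s => (s : ℝ) • X (φ (T₀ * s)),
    continuous_subtype_val.smul (hX.continuous.comp (by fun_prop))⟩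
  have hζ : Q ζ = primitive (N y₀) := by
    have hd : ∀ s : unitInterval, HasDerivAt (fun s : ℝ => s • X (φ (T₀ * s)))
        ((N y₀ + T₀ • pointwiseApply A ζ : C(unitInterval, E)) s) s := by
      intro s
      have h1 : HasDerivAt (fun s : ℝ => φ (T₀ * s)) (T₀ • X (φ (T₀ * s))) s := by
        have := (hφ s).scomp (s : ℝ) ((hasDerivAt_id (s : ℝ)).const_mul T₀)
        simpa [Function.comp_def] using this
      have h2 := ((hX.differentiable one_ne_zero) (φ (T₀ * s))).hasFDerivAt.comp_hasDerivAt
        (s : ℝ) h1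
      have h3 := (hasDerivAt_id (s : ℝ)).smul h2
      refine h3.congr_deriv ?_
      change (s : ℝ) • (fderiv ℝ X (φ (T₀ * s))) (T₀ • X (φ (T₀ * s))) +
        (1 : ℝ) • X (φ (T₀ * s)) =
        X (φ (T₀ * s)) + T₀ • (fderiv ℝ X (φ (T₀ * s))) ((s : ℝ) • X (φ (T₀ * s)))
      rw [map_smul, map_smul, smul_comm, one_smul, add_comm]
    have h := fun s => primitive_eq_of_hasDerivAt hd s
    rw [hQapp]
    ext s
    have hs := h s
    rw [map_add, map_smul] at hs
    simp only [ContinuousMap.add_apply, ContinuousMap.smul_apply, zero_smul, sub_zero] at hs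
    simp only [ContinuousMap.sub_apply, ContinuousMap.smul_apply]
    rw [sub_eq_iff_eq_add, hs]
    rfl
  have hζ1 : τ (ζ 1) ≠ 0 := by simpa [ζ] using hτ
  have hDQ : ∀ η x T, D (η, x, T) = (Q (η - T • ζ) - constFun x, Ψ' x, τ (η 1)) := by
    intro η x T
    rw [hDapp, map_sub, map_smul, hζ, hQapp]
    congr 1
    abel
  have hinj : LinearMap.ker D.toLinearMap = ⊥ := by
    rw [LinearMap.ker_eq_bot']
    rintro ⟨η, x, T⟩ h
    replace h : D (η, x, T) = 0 := h
    rw [hDQ, Prod.mk_eq_zero, Prod.mk_eq_zero] at h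
    obtain ⟨h1, h2, h3⟩ := h
    have hx0 : x = 0 := by simpa using h2
    subst hx0
    rw [map_zero, sub_zero] at h1
    have h4 : η - T • ζ = 0 := hQ.1 (by rw [h1, map_zero])
    have h5 : η = T • ζ := sub_eq_zero.1 h4
    rw [h5] at h3
    simp only [ContinuousMap.smul_apply, map_smul, smul_eq_mul, mul_eq_zero] at h3
    have hT0 : T = 0 := h3.resolve_right hζ1
    rw [h5, hT0, zero_smul]
    rfl
  have hsurj : LinearMap.range D.toLinearMap = ⊤ := by
    rw [LinearMap.range_eq_top]
    rintro ⟨η₀, w, c⟩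
    obtain ⟨η, hη⟩ := hQ.2 (η₀ + constFun (Ψ'.symm w))
    -- Adding a multiple of `ζ` together with the same change of time leaves the first component
    -- fixed and moves `τ (η 1)` to `c`.
    refine ⟨(η + ((c - τ (η 1)) / τ (ζ 1)) • ζ, Ψ'.symm w, (c - τ (η 1)) / τ (ζ 1)), ?_⟩
    change D _ = _
    rw [hDQ, add_sub_cancel_right, hη, add_sub_cancel_right]
    simp only [ContinuousLinearEquiv.apply_symm_apply, ContinuousMap.add_apply,
      ContinuousMap.smul_apply, map_add, map_smul, smul_eq_mul]
    rw [div_mul_cancel₀ _ hζ1, add_sub_cancel]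
  let De := ContinuousLinearEquiv.ofBijective D hinj hsurj
  have hDe : HasStrictFDerivAt H (De : _ →L[ℝ] _) p₀ := hD
  have hH0 : H p₀ = (0, Ψ (φ 0), τ (φ T₀)) := by
    have h1 : y₀ - constFun (φ 0) - T₀ • primitive (N y₀) = 0 := by
      have hd : ∀ s : unitInterval, HasDerivAt (fun s : ℝ => φ (T₀ * s)) ((T₀ • N y₀) s) s := by
        intro s
        have := (hφ s).scomp (s : ℝ) ((hasDerivAt_id (s : ℝ)).const_mul T₀)
        simpa [Function.comp_def, N, y₀] using this
      ext s
      have h := primitive_eq_of_hasDerivAt hd s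
      rw [map_smul] at h
      simp only [ContinuousMap.sub_apply, h, constFun_apply, mul_zero, ContinuousMap.zero_apply]
      simp [y₀]
    have h2 : τ (y₀ 1) = τ (φ T₀) := by simp [y₀]
    change (_, _, _) = _
    rw [← h1, ← h2]
  let G := hDe.localInverse H De p₀
  let ι : F → C(unitInterval, E) × F × ℝ := fun w => (0, w, τ (φ T₀))
  have hid : HasStrictFDerivAt (fun w : F => w) (ContinuousLinearMap.id ℝ F) (Ψ (φ 0)) :=
    hasStrictFDerivAt_id _
  have hι := (hasStrictFDerivAt_const (𝕜 := ℝ) (0 : C(unitInterval, E)) (Ψ (φ 0))).prodMk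
    (hid.prodMk (hasStrictFDerivAt_const (𝕜 := ℝ) (τ (φ T₀)) (Ψ (φ 0))))
  change HasStrictFDerivAt ι _ _ at hι
  have hι0 : ι (Ψ (φ 0)) = H p₀ := hH0.symm
  have hG : HasStrictFDerivAt G (De.symm : _ →L[ℝ] _) (ι (Ψ (φ 0))) := by
    rw [hι0]; exact hDe.to_localInverse
  have hGι := hG.comp (Ψ (φ 0)) hι
  have hG0 : G (ι (Ψ (φ 0))) = p₀ := by
    rw [hι0]; exact hDe.localInverse_apply_image
  refine ⟨fun w => (G (ι w)).1, fun w => (G (ι w)).2.1, fun w => (G (ι w)).2.2,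
    ⟨_, hasStrictFDerivAt_fst.comp (Ψ (φ 0)) hGι⟩,
    (hGι.continuousAt.snd).fst, (hGι.continuousAt.snd).snd, ?_, ?_, ?_, ?_⟩
  · intro s; simp only [hG0]; rfl
  · simp only [hG0]; rfl
  · simp only [hG0]; rfl
  · have hr : ∀ᶠ q in 𝓝 (ι (Ψ (φ 0))), H (G q) = q := by
      rw [hι0]; exact hDe.eventually_right_inverse
    filter_upwards [hι.continuousAt.eventually hr] with w hw
    have hw1 : (G (ι w)).1 - constFun (G (ι w)).2.1 - (G (ι w)).2.2 • primitive (N (G (ι w)).1)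
      = 0 := congrArg Prod.fst hw
    refine ⟨congrArg (fun q => q.2.1) hw, congrArg (fun q => q.2.2) hw, fun s => ?_⟩
    have := DFunLike.congr_fun hw1 s
    simp only [ContinuousMap.sub_apply,
      ContinuousMap.zero_apply, sub_sub, sub_eq_zero] at this
    rw [this]
    rfl

end Continuation

end WS

/-! ### Single cross-ratios in terms of half-angle sines -/

namespace WS

variable {N : ℕ}

theorem cis_eq_of_coe_eq {a b : ℝ} (h : (a : Real.Angle) = b) : cis a = cis b := by
  obtain ⟨n, hn⟩ := Real.Angle.angle_eq_iff_two_pi_dvd_sub.1 h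
  have : (a : ℂ) = b + 2 * Real.pi * n := by
    have : a = b + 2 * Real.pi * n := by linarith
    rw [this]; push_cast; ring
  unfold cis
  rw [this, Complex.exp_eq_exp_iff_exists_int]
  exact ⟨n, by ring⟩

theorem cis_add (a b : ℝ) : cis (a + b) = cis a * cis b := by
  simp [cis, mul_add, Complex.exp_add]

theorem cis_ne_zero (a : ℝ) : cis a ≠ 0 := Complex.exp_ne_zero _

theorem norm_cis (a : ℝ) : ‖cis a‖ = 1 := by
  rw [cis, mul_comm, Complex.norm_exp_ofReal_mul_I]

theorem cis_re (a : ℝ) : (cis a).re = Real.cos a := by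
  rw [cis, mul_comm, Complex.exp_ofReal_mul_I_re]

theorem cis_im (a : ℝ) : (cis a).im = Real.sin a := by
  rw [cis, mul_comm, Complex.exp_ofReal_mul_I_im]

theorem contDiff_cis {n : WithTop ℕ∞} : ContDiff ℝ n cis := by
  unfold cis
  have : ContDiff ℝ n fun x : ℝ => (x : ℂ) := Complex.ofRealCLM.contDiff
  exact (contDiff_const.mul this).cexp

theorem cis_sub_cis (a b : ℝ) :
    cis a - cis b = 2 * Complex.I * (Real.sin ((a - b) / 2) : ℝ) * cis ((a + b) / 2) := by
  have ha : cis a = cis ((a + b) / 2) * cis ((a - b) / 2) := by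
    rw [← cis_add]; ring_nf
  have hb : cis b = cis ((a + b) / 2) * cis (-((a - b) / 2)) := by
    rw [← cis_add]; ring_nf
  rw [ha, hb]
  have : cis ((a - b) / 2) - cis (-((a - b) / 2)) =
      2 * Complex.I * (Real.sin ((a - b) / 2) : ℝ) := by
    generalize (a - b) / 2 = x
    apply Complex.ext
    · simp [cis_re, -Complex.ofReal_sin]
    · simp [cis_im, -Complex.ofReal_sin]; ring
  rw [← mul_sub, this]; ring

/-- `sin ((θ_a - θ_b) / 2)`. -/
noncomputable def halfSin (a b : Fin N) (θ : Lift N) : ℝ := Real.sin ((θ a - θ b) / 2)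

theorem halfSin_eq_zero_iff {a b : Fin N} {θ : Lift N} :
    halfSin a b θ = 0 ↔ toTorus θ a = toTorus θ b := by
  rw [halfSin, Real.sin_eq_zero_iff, toTorus, toTorus, Real.Angle.angle_eq_iff_two_pi_dvd_sub]
  refine exists_congr fun n => ?_
  constructor <;> intro h <;> linarith

theorem halfSin_ne_zero {a b : Fin N} {θ : Lift N} (hθ : Function.Injective (toTorus θ))
    (hab : a ≠ b) : halfSin a b θ ≠ 0 := fun h => hab (hθ (halfSin_eq_zero_iff.1 h))

theorem halfSin_swap (a b : Fin N) (θ : Lift N) : halfSin a b θ = -halfSin b a θ := by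
  rw [halfSin, halfSin, ← Real.sin_neg]; ring_nf

/-- Ptolemy's identity. -/
theorem halfSin_ptolemy (p q r s : Fin N) (θ : Lift N) :
    halfSin p s θ * halfSin q r θ + halfSin p q θ * halfSin r s θ =
      halfSin p r θ * halfSin q s θ := by
  simp only [halfSin, sub_div, Real.sin_sub]
  ring

/-- Each chord is `2i sin` of a half difference times `cis` of a half sum. The half sums have equal
totals in numerator and denominator, so the unimodular factors cancel and the quotient is real. -/
theorem crossRatio_eq (p q r s : Fin N) (θ : Lift N) :
    crossRatio p q r s θ =
      halfSin p s θ * halfSin q r θ / (halfSin q s θ * halfSin p r θ) := by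
  have hζ : cis ((θ p + θ s) / 2) * cis ((θ q + θ r) / 2) =
      cis ((θ q + θ s) / 2) * cis ((θ p + θ r) / 2) := by
    rw [← cis_add, ← cis_add]; ring_nf
  have hne : (2 * Complex.I) ^ 2 * (cis ((θ q + θ s) / 2) * cis ((θ p + θ r) / 2)) ≠ 0 :=
    mul_ne_zero (pow_ne_zero _ (mul_ne_zero two_ne_zero Complex.I_ne_zero))
      (mul_ne_zero (cis_ne_zero _) (cis_ne_zero _))
  have h1 : (cis (θ p) - cis (θ s)) * (cis (θ q) - cis (θ r)) =
      (2 * Complex.I) ^ 2 * (cis ((θ q + θ s) / 2) * cis ((θ p + θ r) / 2)) *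
        ((halfSin p s θ * halfSin q r θ : ℝ) : ℂ) := by
    rw [cis_sub_cis, cis_sub_cis, ← hζ]; simp only [halfSin]; push_cast; ring
  have h2 : (cis (θ q) - cis (θ s)) * (cis (θ p) - cis (θ r)) =
      (2 * Complex.I) ^ 2 * (cis ((θ q + θ s) / 2) * cis ((θ p + θ r) / 2)) *
        ((halfSin q s θ * halfSin p r θ : ℝ) : ℂ) := by
    rw [cis_sub_cis, cis_sub_cis]; simp only [halfSin]; push_cast; ring
  rw [crossRatio, h1, h2, mul_div_mul_left _ _ hne, ← Complex.ofReal_div, Complex.ofReal_re]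

theorem crossRatio_congr {θ θ' : Lift N} (h : toTorus θ = toTorus θ') (p q r s : Fin N) :
    crossRatio p q r s θ = crossRatio p q r s θ' := by
  have hc : ∀ j, cis (θ j) = cis (θ' j) := fun j => cis_eq_of_coe_eq (congrFun h j)
  simp only [crossRatio, hc]

/-- Cross-ratios are invariant under rotations of all phases. -/
theorem crossRatio_add {c : Lift N} {ζ : Real.Angle} (hc : ∀ j, (c j : Real.Angle) = ζ)
    (p q r s : Fin N) (θ : Lift N) :
    crossRatio p q r s (θ + c) = crossRatio p q r s θ := by
  have hc' : ∀ j, cis (c j) = cis (c p) := fun j => cis_eq_of_coe_eq ((hc j).trans (hc p).symm)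
  simp only [crossRatio, Pi.add_apply, cis_add, hc' q, hc' r, hc' s, ← sub_mul]
  rw [mul_mul_mul_comm, mul_mul_mul_comm (cis (θ q) - cis (θ s)),
    mul_div_mul_right _ _ (mul_ne_zero (cis_ne_zero _) (cis_ne_zero _))]

theorem contDiff_halfSin {n : WithTop ℕ∞} (a b : Fin N) : ContDiff ℝ n (halfSin a b) := by
  unfold halfSin
  fun_prop

theorem hasFDerivAt_halfSin (a b : Fin N) (θ : Lift N) :
    HasFDerivAt (halfSin a b) ((Real.cos ((θ a - θ b) / 2) / 2) •
      (ContinuousLinearMap.proj (R := ℝ) (φ := fun _ : Fin N => ℝ) a -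
        ContinuousLinearMap.proj (R := ℝ) (φ := fun _ : Fin N => ℝ) b)) θ := by
  have h := (((ContinuousLinearMap.proj (R := ℝ) (φ := fun _ : Fin N => ℝ) a -
    ContinuousLinearMap.proj (R := ℝ) (φ := fun _ : Fin N => ℝ) b).hasFDerivAt
      (x := θ)).mul_const (2⁻¹ : ℝ)).sin
  refine (h.congr_fderiv ?_)
  ext v
  simp [div_eq_mul_inv]
  ring

theorem contDiffAt_crossRatio {n : WithTop ℕ∞} {p q r s : Fin N} {θ : Lift N}
    (hqs : halfSin q s θ ≠ 0) (hpr : halfSin p r θ ≠ 0) :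
    ContDiffAt ℝ n (crossRatio p q r s) θ := by
  rw [funext (crossRatio_eq p q r s)]
  exact ((contDiff_halfSin p s).contDiffAt.mul (contDiff_halfSin q r).contDiffAt).div
    ((contDiff_halfSin q s).contDiffAt.mul (contDiff_halfSin p r).contDiffAt)
    (mul_ne_zero hqs hpr)

theorem fderiv_crossRatio_apply {p q r s : Fin N} {θ : Lift N}
    (hqs : halfSin q s θ ≠ 0) (hpr : halfSin p r θ ≠ 0) (v : Lift N) :
    fderiv ℝ (crossRatio p q r s) θ v =
      ((Real.cos ((θ p - θ s) / 2) / 2 * (v p - v s) * halfSin q r θ +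
          halfSin p s θ * (Real.cos ((θ q - θ r) / 2) / 2 * (v q - v r))) *
            (halfSin q s θ * halfSin p r θ) -
        halfSin p s θ * halfSin q r θ *
          (Real.cos ((θ q - θ s) / 2) / 2 * (v q - v s) * halfSin p r θ +
            halfSin q s θ * (Real.cos ((θ p - θ r) / 2) / 2 * (v p - v r)))) /
        (halfSin q s θ * halfSin p r θ) ^ 2 := by
  have hline : HasDerivAt (fun t : ℝ => θ + t • v) v 0 := by
    simpa using ((hasDerivAt_id (0 : ℝ)).smul_const v).const_add θ
  have hs : ∀ a b, HasDerivAt (fun t : ℝ => halfSin a b (θ + t • v))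
      (Real.cos ((θ a - θ b) / 2) / 2 * (v a - v b)) 0 := by
    intro a b
    have h0 : θ = θ + (0 : ℝ) • v := by simp
    have := (hasFDerivAt_halfSin a b θ)
    have h2 := HasFDerivAt.comp_hasDerivAt (0 : ℝ) (h0 ▸ this) hline
    refine h2.congr_deriv ?_
    simp
  have h1 := ((hs p s).mul (hs q r)).div ((hs q s).mul (hs p r)) (by simpa using ⟨hqs, hpr⟩)
  have h0 : θ = θ + (0 : ℝ) • v := by simp
  have hd : HasFDerivAt (crossRatio p q r s) (fderiv ℝ (crossRatio p q r s) θ)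
      (θ + (0 : ℝ) • v) := by
    rw [← h0]
    exact ((contDiffAt_crossRatio (n := 1) hqs hpr).differentiableAt one_ne_zero).hasFDerivAt
  have h2 := hd.comp_hasDerivAt (0 : ℝ) hline
  have h3 : (crossRatio p q r s ∘ fun t : ℝ => θ + t • v) =
    ((fun t : ℝ => halfSin p s (θ + t • v)) * fun t : ℝ => halfSin q r (θ + t • v)) /
      ((fun t : ℝ => halfSin q s (θ + t • v)) * fun t : ℝ => halfSin p r (θ + t • v)) := by
    funext t
    simp [crossRatio_eq]
  rw [h3] at h2
  have h4 := h2.unique h1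
  rw [h4]
  simp

/-- The derivative of a cross-ratio vanishes along infinitesimal Möbius transformations of the
circle. -/
theorem fderiv_crossRatio_moebius {p q r s : Fin N} {θ : Lift N}
    (hqs : halfSin q s θ ≠ 0) (hpr : halfSin p r θ ≠ 0) {v : Lift N} {α β γ : ℝ}
    (hv : ∀ j, v j = α * Real.cos (θ j) + β * Real.sin (θ j) + γ) :
    fderiv ℝ (crossRatio p q r s) θ v = 0 := by
  -- The logarithmic derivative of a chord along `v` splits as `v'(θ a)/2 + v'(θ b)/2`, with `v'`
  -- the derivative of `α cos + β sin + γ`. Each index occurs once in the numerator and once in the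
  -- denominator, so these terms cancel in the cross-ratio.
  have key : ∀ a b, Real.cos ((θ a - θ b) / 2) / 2 * (v a - v b) =
      halfSin a b θ * ((-α * Real.sin (θ a) + β * Real.cos (θ a)) / 2 +
        (-α * Real.sin (θ b) + β * Real.cos (θ b)) / 2) := by
    intro a b
    obtain ⟨x, hx⟩ : ∃ x, θ a = 2 * x := ⟨θ a / 2, by ring⟩
    obtain ⟨y, hy⟩ : ∃ y, θ b = 2 * y := ⟨θ b / 2, by ring⟩
    have h1 : (θ a - θ b) / 2 = x - y := by rw [hx, hy]; ring
    rw [halfSin, h1, hv, hv, hx, hy, Real.cos_sub, Real.sin_sub, Real.cos_two_mul,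
      Real.cos_two_mul, Real.sin_two_mul, Real.sin_two_mul]
    have hxx := Real.sin_sq_add_cos_sq x
    have hyy := Real.sin_sq_add_cos_sq y
    have e1 : Real.sin x ^ 2 = 1 - Real.cos x ^ 2 := by linarith
    have e2 : Real.sin y ^ 2 = 1 - Real.cos y ^ 2 := by linarith
    ring_nf
    simp only [e1, e2]
    ring
  rw [fderiv_crossRatio_apply hqs hpr, key, key, key, key, div_eq_zero_iff]
  left
  ring

/-- For distinct phases the rate is nonzero: the last phase alone controls the cross-ratio. The
addition formula for `(p - s) - (q - s)` collapses the quotient rule to one product. -/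
theorem fderiv_crossRatio_single {p q r s : Fin N} {θ : Lift N}
    (hps : p ≠ s) (hqs' : q ≠ s) (hrs : r ≠ s)
    (hqs : halfSin q s θ ≠ 0) (hpr : halfSin p r θ ≠ 0) (c : ℝ) :
    fderiv ℝ (crossRatio p q r s) θ (Pi.single s c) =
      c * (halfSin p q θ * halfSin q r θ * halfSin p r θ /
        (2 * (halfSin q s θ * halfSin p r θ) ^ 2)) := by
  have key : halfSin p q θ = halfSin p s θ * Real.cos ((θ q - θ s) / 2) -
      Real.cos ((θ p - θ s) / 2) * halfSin q s θ := by
    simp only [halfSin]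
    rw [← Real.sin_sub]; ring_nf
  rw [fderiv_crossRatio_apply hqs hpr, key]
  simp only [Pi.single_eq_same, Pi.single_eq_of_ne hps, Pi.single_eq_of_ne hqs',
    Pi.single_eq_of_ne hrs]
  field_simp
  ring

theorem one_sub_crossRatio {p q r s : Fin N} {θ : Lift N}
    (hqs : halfSin q s θ ≠ 0) (hpr : halfSin p r θ ≠ 0) :
    1 - crossRatio p q r s θ =
      halfSin p q θ * halfSin r s θ / (halfSin q s θ * halfSin p r θ) := by
  rw [crossRatio_eq, eq_div_iff (mul_ne_zero hqs hpr), sub_mul,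
    div_mul_cancel₀ _ (mul_ne_zero hqs hpr)]
  linarith [halfSin_ptolemy p q r s θ]

theorem crossRatio_shift_last {p q r t : Fin N} {θ : Lift N}
    (hqt : halfSin q t θ ≠ 0) (hpr : halfSin p r θ ≠ 0) :
    crossRatio q r t p θ = 1 - crossRatio p q r t θ := by
  rw [one_sub_crossRatio hqt hpr, crossRatio_eq, halfSin_swap q p, halfSin_swap r p]
  rw [show -halfSin p q θ * halfSin r t θ = -(halfSin p q θ * halfSin r t θ) by ring,
    show -halfSin p r θ * halfSin q t θ = -(halfSin q t θ * halfSin p r θ) by ring, neg_div_neg_eq]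

/-- By Ptolemy the complements `1 - Λ` are again quotients of chords, and the factors involving `p`
cancel. This expresses a cyclically shifted cross-ratio through those based at the first three
phases. -/
theorem crossRatio_shift {p q r s t : Fin N} {θ : Lift N} (hqt : halfSin q t θ ≠ 0)
    (hqs : halfSin q s θ ≠ 0) (hpr : halfSin p r θ ≠ 0) (hpq : halfSin p q θ ≠ 0)
    (hrs : halfSin r s θ ≠ 0) :
    crossRatio q r t s θ = (1 - crossRatio p q r t θ) / (1 - crossRatio p q r s θ) := by
  rw [one_sub_crossRatio hqt hpr, one_sub_crossRatio hqs hpr, crossRatio_eq]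
  field_simp

end WS

namespace WS

variable {N : ℕ}

theorem ofNat_ne_ofNat [NeZero N] {a b : ℕ} (ha : a < N) (hb : b < N) (hab : a ≠ b) :
    Fin.ofNat N a ≠ Fin.ofNat N b := by
  intro h
  have := congrArg Fin.val h
  simp only [Fin.val_ofNat, Nat.mod_eq_of_lt ha, Nat.mod_eq_of_lt hb] at this
  exact hab this

theorem zero_eq_ofNat [NeZero N] : (0 : Fin N) = Fin.ofNat N 0 := rfl
theorem one_eq_ofNat [NeZero N] : (1 : Fin N) = Fin.ofNat N 1 := rfl
theorem two_eq_ofNat [NeZero N] : (2 : Fin N) = Fin.ofNat N 2 := rfl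

/-! ### The cross-ratio map on configurations of distinct phases -/

section CrossRatios

variable [NeZero N] {θ : Lift N}

theorem halfSin_ofNat_ne_zero (hθ : Function.Injective (toTorus θ)) {a b : ℕ} (ha : a < N)
    (hb : b < N) (hab : a ≠ b) : halfSin (Fin.ofNat N a) (Fin.ofNat N b) θ ≠ 0 :=
  halfSin_ne_zero hθ (ofNat_ne_ofNat ha hb hab)

theorem contDiffAt_crossRatio_ofNat {n : WithTop ℕ∞} (hθ : Function.Injective (toTorus θ))
    {a b c d : ℕ} (ha : a < N) (hb : b < N) (hc : c < N) (hd : d < N) (hbd : b ≠ d)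
    (hac : a ≠ c) :
    ContDiffAt ℝ n (crossRatio (Fin.ofNat N a) (Fin.ofNat N b) (Fin.ofNat N c)
      (Fin.ofNat N d)) θ :=
  contDiffAt_crossRatio (halfSin_ofNat_ne_zero hθ hb hd hbd) (halfSin_ofNat_ne_zero hθ ha hc hac)

theorem contDiffAt_crossRatios {n : WithTop ℕ∞} (hθ : Function.Injective (toTorus θ)) :
    ContDiffAt ℝ n (crossRatios (N := N)) θ := by
  rw [contDiffAt_pi]
  intro k
  have hk := k.2
  exact contDiffAt_crossRatio_ofNat (a := 0) (b := 1) (c := 2) hθ (by omega) (by omega) (by omega)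
    (by omega) (by omega) (by omega)

theorem contDiffAt_consecutiveCrossRatios {n : WithTop ℕ∞}
    (hθ : Function.Injective (toTorus θ)) :
    ContDiffAt ℝ n (consecutiveCrossRatios (N := N)) θ := by
  rw [contDiffAt_pi]
  intro k
  have hk := k.2
  exact contDiffAt_crossRatio_ofNat hθ (by omega) (by omega) (by omega)
    (by omega) (by omega) (by omega)

theorem fderiv_crossRatios_apply (hθ : Function.Injective (toTorus θ)) (v : Lift N)
    (k : Fin (N - 3)) :
    fderiv ℝ (crossRatios (N := N)) θ v k =
      fderiv ℝ (crossRatio (N := N) 0 1 2 (Fin.ofNat N (k + 3))) θ v := by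
  have hd : HasFDerivAt (crossRatios (N := N)) (fderiv ℝ (crossRatios (N := N)) θ) θ :=
    ((contDiffAt_crossRatios (n := 1) hθ).differentiableAt one_ne_zero).hasFDerivAt
  have := hasFDerivAt_pi'.1 hd k
  rw [show fderiv ℝ (crossRatio (N := N) 0 1 2 (Fin.ofNat N (k + 3))) θ = _ from this.fderiv]
  rfl

theorem fderiv_crossRatios_moebius (hθ : Function.Injective (toTorus θ)) {v : Lift N}
    {α β γ : ℝ} (hv : ∀ j, v j = α * Real.cos (θ j) + β * Real.sin (θ j) + γ) :
    fderiv ℝ (crossRatios (N := N)) θ v = 0 := by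
  ext k
  have hk := k.2
  rw [fderiv_crossRatios_apply hθ]
  exact fderiv_crossRatio_moebius
    (halfSin_ofNat_ne_zero (a := 1) hθ (by omega) (by omega) (by omega))
    (halfSin_ofNat_ne_zero (a := 0) (b := 2) hθ (by omega) (by omega) (by omega)) hv

/-- Phase `k + 3` enters only the `k`-th cross-ratio, so the Jacobian in the last `N - 3` phases is
diagonal, with nonzero entries. -/
theorem surjective_fderiv_crossRatios (hθ : Function.Injective (toTorus θ)) :
    Function.Surjective (fderiv ℝ (crossRatios (N := N)) θ) := by
  intro w
  have h : ∀ k : Fin (N - 3), ∃ c : ℝ, c ≠ 0 ∧ ∀ x : ℝ,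
      fderiv ℝ (crossRatio (N := N) 0 1 2 (Fin.ofNat N (k + 3))) θ
        (Pi.single (Fin.ofNat N (k + 3)) x) = x * c := by
    intro k
    have hk := k.2
    have h01 : halfSin 0 1 θ ≠ 0 :=
      halfSin_ofNat_ne_zero (a := 0) (b := 1) hθ (by omega) (by omega) (by omega)
    have h12 : halfSin 1 2 θ ≠ 0 :=
      halfSin_ofNat_ne_zero (a := 1) (b := 2) hθ (by omega) (by omega) (by omega)
    have h02 : halfSin 0 2 θ ≠ 0 :=
      halfSin_ofNat_ne_zero (a := 0) (b := 2) hθ (by omega) (by omega) (by omega)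
    have h1k : halfSin 1 (Fin.ofNat N (k + 3)) θ ≠ 0 :=
      halfSin_ofNat_ne_zero (a := 1) hθ (by omega) (by omega) (by omega)
    refine ⟨_, ?_, fun x => fderiv_crossRatio_single
      (ofNat_ne_ofNat (a := 0) (by omega) (by omega) (by omega))
      (ofNat_ne_ofNat (a := 1) (by omega) (by omega) (by omega))
      (ofNat_ne_ofNat (a := 2) (by omega) (by omega) (by omega)) h1k h02 x⟩
    exact div_ne_zero (mul_ne_zero (mul_ne_zero h01 h12) h02)
      (mul_ne_zero two_ne_zero (pow_ne_zero _ (mul_ne_zero h1k h02)))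
  choose c hc hcx using h
  refine ⟨∑ k : Fin (N - 3), Pi.single (Fin.ofNat N (k + 3)) (w k / c k), ?_⟩
  ext k
  rw [fderiv_crossRatios_apply hθ, map_sum, Finset.sum_eq_single k]
  · rw [hcx, div_mul_cancel₀ _ (hc k)]
  · intro m _ hmk
    have hk := k.2
    have hm := m.2
    have hne : ∀ a, a < N → a ≠ m + 3 → (Pi.single (Fin.ofNat N (m + 3)) (w m / c m) : Lift N)
        (Fin.ofNat N a) = 0 := fun a ha ham =>
      Pi.single_eq_of_ne (ofNat_ne_ofNat ha (by omega) ham) _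
    have hmk' : (k : ℕ) ≠ m := fun h => hmk (Fin.ext h.symm)
    rw [zero_eq_ofNat, one_eq_ofNat, two_eq_ofNat, fderiv_crossRatio_apply
      (halfSin_ofNat_ne_zero (a := 1) hθ (by omega) (by omega) (by omega))
      (halfSin_ofNat_ne_zero (a := 0) (b := 2) hθ (by omega) (by omega) (by omega)),
      hne 0 (by omega) (by omega),
      hne 1 (by omega) (by omega), hne 2 (by omega) (by omega),
      hne (k + 3) (by omega) (by omega)]
    simp
  · simp

theorem crossRatios_congr {θ θ' : Lift N} (h : toTorus θ = toTorus θ') :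
    crossRatios θ = crossRatios θ' := funext fun _ => crossRatio_congr h _ _ _ _

theorem crossRatios_add {c : Lift N} {ζ : Real.Angle} (hc : ∀ j, (c j : Real.Angle) = ζ)
    (θ : Lift N) : crossRatios (θ + c) = crossRatios θ :=
  funext fun _ => crossRatio_add hc _ _ _ _ _

theorem fderiv_crossRatios_add {c : Lift N} {ζ : Real.Angle}
    (hc : ∀ j, (c j : Real.Angle) = ζ) (θ : Lift N) :
    fderiv ℝ (crossRatios (N := N)) (θ + c) = fderiv ℝ (crossRatios (N := N)) θ := by
  rw [← fderiv_comp_add_right]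
  exact congrArg (fun F => fderiv ℝ F θ) (funext fun x => crossRatios_add hc x)

theorem toTorus_injective_of_mem_orderedLift (hθ : θ ∈ orderedLift N) :
    Function.Injective (toTorus θ) := by
  have key : ∀ i j, i < j → toTorus θ i ≠ toTorus θ j := by
    intro i j hij h
    have h1 := hθ.1 hij
    have h2 := hθ.2 j
    have h3 : θ 0 ≤ θ i := hθ.1.monotone (Fin.zero_le _)
    have h0 := halfSin_eq_zero_iff.2 h.symm
    have : 0 < halfSin j i θ := Real.sin_pos_of_pos_of_lt_pi (by linarith) (by linarith)
    exact this.ne' h0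
  intro i j h
  rcases lt_trichotomy i j with hij | hij | hij
  · exact absurd h (key i j hij)
  · exact hij
  · exact absurd h.symm (key j i hij)

theorem crossRatios_of_mem_levelSet {l : Param N} (h : toTorus θ ∈ levelSet l) :
    crossRatios θ = l := by
  obtain ⟨θ', ⟨-, h1⟩, h2⟩ := h
  rw [← h1]
  exact crossRatios_congr h2.symm

theorem injective_of_mem_levelSet {l : Param N} {x : Torus N} (h : x ∈ levelSet l) :
    Function.Injective x := by
  obtain ⟨θ', ⟨h1, -⟩, h2⟩ := h
  rw [← h2]
  exact toTorus_injective_of_mem_orderedLift h1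

end CrossRatios

/-! ### The vector field -/

section VectorField

variable {f : ℂ → ℂ} {g : ℂ → ℝ}

theorem toTorus_add (θ c : Lift N) : toTorus (θ + c) = toTorus θ + toTorus c := by
  funext j; simp [toTorus]

theorem toTorus_sub (θ c : Lift N) : toTorus (θ - c) = toTorus θ - toTorus c := by
  funext j; simp [toTorus]

theorem continuous_toTorus : Continuous (toTorus (N := N)) :=
  continuous_pi fun j => Real.Angle.continuous_coe.comp (continuous_apply j)

theorem orderParameter_congr {θ θ' : Lift N} (h : toTorus θ = toTorus θ') :
    orderParameter θ = orderParameter θ' := by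
  have hc : ∀ j, cis (θ j) = cis (θ' j) := fun j => cis_eq_of_coe_eq (congrFun h j)
  simp only [orderParameter, hc]

theorem field_congr {θ θ' : Lift N} (h : toTorus θ = toTorus θ') : field f g θ = field f g θ' := by
  have hc : ∀ j, cis (θ j) = cis (θ' j) := fun j => cis_eq_of_coe_eq (congrFun h j)
  have hc' : ∀ j, cis (-θ j) = cis (-θ' j) := fun j => cis_eq_of_coe_eq (by
    have := congrFun h j
    simp only [toTorus] at this
    rw [Real.Angle.coe_neg, Real.Angle.coe_neg, this])
  funext j
  simp only [field, hc, hc', orderParameter_congr h]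

theorem field_add {c : Lift N} (hc : toTorus c = 0) (θ : Lift N) :
    field f g (θ + c) = field f g θ := field_congr (by rw [toTorus_add, hc, add_zero])

/-- This is the Möbius form of the field: the coefficients of `cos`, `sin` and `1` depend on `θ` but
not on `j`. -/
theorem field_apply (θ : Lift N) (j : Fin N) :
    field f g θ j = 2 * (f (orderParameter θ)).re * Real.cos (θ j) +
      (-2 * (f (orderParameter θ)).im) * Real.sin (θ j) + g (orderParameter θ) := by
  simp only [field, Complex.add_re, Complex.mul_re, Complex.ofReal_re, Complex.conj_re,
    Complex.conj_im, cis_re, cis_im, Real.cos_neg, Real.sin_neg]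
  ring

theorem contDiff_orderParameter {n : WithTop ℕ∞} :
    ContDiff ℝ n (orderParameter (N := N)) := by
  unfold orderParameter
  exact contDiff_const.mul (ContDiff.sum fun j _ => contDiff_cis.comp (contDiff_apply ℝ ℝ j))

/-- The phases whose order parameter lies in the open unit disk. -/
def diskPhases (N : ℕ) : Set (Lift N) := {θ | ‖orderParameter θ‖ < 1}

theorem isOpen_diskPhases : IsOpen (diskPhases N) :=
  isOpen_lt (contDiff_orderParameter (n := 0)).continuous.norm continuous_const

theorem contDiffOn_field (hf : ContDiffOn ℝ ∞ f (Metric.ball 0 1))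
    (hg : ContDiffOn ℝ ∞ g (Metric.ball 0 1)) :
    ContDiffOn ℝ ∞ (field (N := N) f g) (diskPhases N) := by
  have hm : MapsTo (orderParameter (N := N)) (diskPhases N) (Metric.ball 0 1) := by
    intro θ hθ
    exact mem_ball_zero_iff.2 hθ
  have hf' := hf.comp (contDiff_orderParameter (N := N)).contDiffOn hm
  have hg' := hg.comp (contDiff_orderParameter (N := N)).contDiffOn hm
  rw [contDiffOn_pi]
  intro j
  have hre : ContDiffOn ℝ ∞ (fun θ : Lift N => (f (orderParameter θ)).re) (diskPhases N) :=
    Complex.reCLM.contDiff.comp_contDiffOn hf'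
  have him : ContDiffOn ℝ ∞ (fun θ : Lift N => (f (orderParameter θ)).im) (diskPhases N) :=
    Complex.imCLM.contDiff.comp_contDiffOn hf'
  have hcos : ContDiffOn ℝ ∞ (fun θ : Lift N => Real.cos (θ j)) (diskPhases N) :=
    (Real.contDiff_cos.comp (contDiff_apply ℝ ℝ j)).contDiffOn
  have hsin : ContDiffOn ℝ ∞ (fun θ : Lift N => Real.sin (θ j)) (diskPhases N) :=
    (Real.contDiff_sin.comp (contDiff_apply ℝ ℝ j)).contDiffOn
  rw [funext fun θ : Lift N => field_apply (f := f) (g := g) θ j]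
  exact (((contDiffOn_const.mul hre).mul hcos).add
    ((contDiffOn_const.mul him).mul hsin)).add hg'

/-- Two distinct unit vectors have a sum shorter than `2` by the parallelogram law, and the others
contribute at most `N - 2`. Hence smoothness of `f` and `g` on the open disk suffices along orbits
with distinct phases. -/
theorem mem_diskPhases (hN : 2 ≤ N) {θ : Lift N} (hθ : Function.Injective (toTorus θ)) :
    θ ∈ diskPhases N := by
  let a : Fin N := ⟨0, by omega⟩
  let b : Fin N := ⟨1, by omega⟩
  have hab : a ≠ b := by simp [a, b]
  have hN0 : (0 : ℝ) < N := by
    have : 0 < N := by omega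
    exact_mod_cast this
  have hne : cis (θ a) - cis (θ b) ≠ 0 := by
    rw [cis_sub_cis]
    exact mul_ne_zero (mul_ne_zero (mul_ne_zero two_ne_zero Complex.I_ne_zero)
      (Complex.ofReal_ne_zero.2 (halfSin_ne_zero hθ hab))) (cis_ne_zero _)
  have hlt : ‖cis (θ a) + cis (θ b)‖ < 2 := by
    have h1 := parallelogram_law_with_norm ℝ (cis (θ a)) (cis (θ b))
    rw [norm_cis, norm_cis] at h1
    have h2 := norm_pos_iff.2 hne
    nlinarith [norm_nonneg (cis (θ a) + cis (θ b))]
  have hsum : ∑ j, cis (θ j) = (cis (θ a) + cis (θ b)) +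
      ∑ j ∈ (Finset.univ.erase a).erase b, cis (θ j) := by
    rw [← Finset.add_sum_erase _ _ (Finset.mem_univ a),
      ← Finset.add_sum_erase _ _ (Finset.mem_erase.2 ⟨hab.symm, Finset.mem_univ b⟩), add_assoc]
  have hrest : ‖∑ j ∈ (Finset.univ.erase a).erase b, cis (θ j)‖ ≤ N - 2 := by
    refine (norm_sum_le _ _).trans ?_
    simp only [norm_cis, Finset.sum_const, nsmul_eq_mul, mul_one]
    rw [Finset.card_erase_of_mem (Finset.mem_erase.2 ⟨hab.symm, Finset.mem_univ b⟩),
      Finset.card_erase_of_mem (Finset.mem_univ a), Finset.card_univ, Fintype.card_fin,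
      Nat.sub_sub, Nat.cast_sub hN]
    norm_num
  have : ‖∑ j, cis (θ j)‖ < N := by
    rw [hsum]
    exact (norm_add_le _ _).trans_lt (by linarith)
  change ‖orderParameter θ‖ < 1
  rw [orderParameter, norm_mul, norm_div, norm_one, Complex.norm_natCast, one_div,
    inv_mul_lt_iff₀ hN0, mul_one]
  exact this

theorem fderiv_crossRatios_field [NeZero N] {θ : Lift N} (hθ : Function.Injective (toTorus θ)) :
    fderiv ℝ (crossRatios (N := N)) θ (field f g θ) = 0 :=
  fderiv_crossRatios_moebius hθ (field_apply θ)

end VectorField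

theorem isOpen_injective_toTorus : IsOpen {θ : Lift N | Function.Injective (toTorus θ)} := by
  have : {θ : Lift N | Function.Injective (toTorus θ)} =
      ⋂ (i : Fin N) (j : Fin N) (_ : i ≠ j), {θ | halfSin i j θ ≠ 0} := by
    ext θ
    simp only [mem_ofPred_eq, mem_iInter, Function.Injective]
    refine ⟨fun h i j hij => halfSin_ne_zero h hij, fun h i j hij => ?_⟩
    by_contra hne
    exact h i j hne (halfSin_eq_zero_iff.2 hij)
  rw [this]
  exact isOpen_iInter_of_finite fun i => isOpen_iInter_of_finite fun j =>
    isOpen_iInter_of_finite fun _ =>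
      isOpen_ne_fun (contDiff_halfSin (n := 0) i j).continuous continuous_const

end WS

namespace WS

/-! ### Uniqueness of solutions -/

/-- The coincidence set is closed, and open by local Lipschitz uniqueness. Only one solution must
stay in `Ω`, since the other is in `Ω` wherever the two agree. -/
theorem ode_eq_of_mem_open {E : Type*} [NormedAddCommGroup E] [NormedSpace ℝ E] {X : E → E}
    {Ω : Set E} (hΩ : IsOpen Ω) (hX : ContDiffOn ℝ 1 X Ω) {φ ψ : ℝ → E}
    (hφ : ∀ t, HasDerivAt φ (X (φ t)) t) (hψ : ∀ t, HasDerivAt ψ (X (ψ t)) t)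
    (hφΩ : ∀ t, φ t ∈ Ω) {t₀ : ℝ} (h : φ t₀ = ψ t₀) : φ = ψ := by
  have hφc : Continuous φ := continuous_iff_continuousAt.2 fun t => (hφ t).continuousAt
  have hψc : Continuous ψ := continuous_iff_continuousAt.2 fun t => (hψ t).continuousAt
  have hclopen : IsClopen {t | φ t = ψ t} := by
    refine ⟨isClosed_eq hφc hψc, isOpen_iff_mem_nhds.2 fun t ht => ?_⟩
    obtain ⟨K, s, hs, hK⟩ := (hX.contDiffAt (hΩ.mem_nhds (hφΩ t))).exists_lipschitzOnWith
    have ht' : φ t = ψ t := ht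
    refine ODE_solution_unique_of_eventually (v := fun _ => X) (s := fun _ => s) (K := K)
      (Eventually.of_forall fun _ => hK) ?_ ?_ ht'
    · filter_upwards [hφc.continuousAt.preimage_mem_nhds hs] with u hu using ⟨hφ u, hu⟩
    · rw [ht'] at hs
      filter_upwards [hψc.continuousAt.preimage_mem_nhds hs] with u hu using ⟨hψ u, hu⟩
  have := hclopen.eq_univ ⟨t₀, h⟩
  exact funext fun t => (this ▸ mem_univ t : t ∈ {t | φ t = ψ t})

/-- A solution of a rescaled integral equation on the unit interval agrees with the rescaled
global solution. -/
theorem integral_solution_eq {E : Type*} [NormedAddCommGroup E] [NormedSpace ℝ E]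
    [FiniteDimensional ℝ E] {X Y : E → E} {Ω : Set E} (hΩ : IsOpen Ω) (hX : ContDiffOn ℝ 1 X Ω)
    (hY : Continuous Y) {ψ : ℝ → E} (hψ : ∀ t, HasDerivAt ψ (X (ψ t)) t) (hψΩ : ∀ t, ψ t ∈ Ω)
    {y : C(unitInterval, E)} {T : ℝ}
    (hy : ∀ s : unitInterval, y s = ψ 0 + T • ∫ r in (0 : ℝ)..s, Y (IccExtend zero_le_one y r))
    (hyΩ : ∀ s, y s ∈ Ω) (hyX : ∀ s, Y (y s) = X (y s)) (s : unitInterval) :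
    y s = ψ (T * s) := by
  have hψc : Continuous ψ := continuous_iff_continuousAt.2 fun t => (hψ t).continuousAt
  have hψs : Continuous fun s : unitInterval => ψ (T * s) := by fun_prop
  -- `Z` agrees with `X` on both curves and is globally Lipschitz, so one Lipschitz bound serves for
  -- both.
  obtain ⟨Z, hZ, hZc, hZX⟩ := exists_contDiff_hasCompactSupport_eq (n := 1) hΩ hX
    ((isCompact_range y.continuous).union (isCompact_range hψs))
    (union_subset (range_subset_iff.2 hyΩ) (range_subset_iff.2 fun s => hψΩ _))
  obtain ⟨L, hL⟩ := hZ.lipschitzWith_of_hasCompactSupport hZc one_ne_zero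
  have hZX' := hZX.self_of_nhdsSet
  set g : ℝ → E := fun t => ψ 0 + T • ∫ r in (0 : ℝ)..t, Y (IccExtend zero_le_one y r) with hg
  have hYy : Continuous fun r => Y (IccExtend zero_le_one y r) :=
    hY.comp (continuous_IccExtend_unitInterval y)
  have hgd : ∀ t, HasDerivAt g (T • Y (IccExtend zero_le_one y t)) t := fun t =>
    ((intervalIntegral.integral_hasDerivAt_right (hYy.intervalIntegrable _ _)
      (hYy.stronglyMeasurableAtFilter _ _) hYy.continuousAt).const_smul T).const_add _
  have hgy : ∀ t (ht : t ∈ Icc (0 : ℝ) 1), g t = y ⟨t, ht⟩ := fun t ht => (hy ⟨t, ht⟩).symm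
  have hψd : ∀ t, HasDerivAt (fun s : ℝ => ψ (T * s)) (T • X (ψ (T * t))) t := by
    intro t
    have := (hψ (T * t)).scomp t ((hasDerivAt_id t).const_mul T)
    simpa [Function.comp_def] using this
  have hlip : LipschitzWith (‖T‖₊ * L) fun x => T • Z x :=
    (lipschitzWith_smul T).comp hL
  have := ODE_solution_unique (f := g) (g := fun s => ψ (T * s)) (a := 0) (b := 1)
    (v := fun _ x => T • Z x) (K := ‖T‖₊ * L) (fun _ => hlip)
    (fun t _ => (hgd t).continuousAt.continuousWithinAt)
    (fun t ht => by
      have hI : t ∈ Icc (0 : ℝ) 1 := ⟨ht.1, ht.2.le⟩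
      have h1 := (hgd t).hasDerivWithinAt (s := Ici t)
      rw [IccExtend_of_mem _ _ hI, hyX] at h1
      rw [hgy t hI, hZX' _ (Or.inl (mem_range_self _))]
      exact h1)
    (fun t _ => (hψd t).continuousAt.continuousWithinAt)
    (fun t ht => by
      have hI : t ∈ Icc (0 : ℝ) 1 := ⟨ht.1, ht.2.le⟩
      have h1 := (hψd t).hasDerivWithinAt (s := Ici t)
      rw [hZX' _ (Or.inr ⟨⟨t, hI⟩, rfl⟩)]
      exact h1)
    (by simp [hg])
  rw [hy s]
  exact this s.2

/-! ### Averages of periodic functions -/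

/-- A positive period is a multiple of the least positive period. -/
theorem exists_nat_mul_of_isLeast_period {α : Type*} {u : ℝ → α} {T S : ℝ}
    (hT : IsLeast {S : ℝ | 0 < S ∧ Function.Periodic u S} T) (hS : 0 < S)
    (hSp : Function.Periodic u S) : ∃ n : ℤ, 0 < n ∧ S = n * T := by
  have hT0 : 0 < T := hT.1.1
  -- The remainder of `S` modulo `T` is a period in `[0, T)`, hence zero by minimality.
  have hp : Function.Periodic u (S - ⌊S / T⌋ * T) := by
    have := hSp.sub_period (hT.1.2.int_mul ⌊S / T⌋)
    simpa using this
  have h1 : (⌊S / T⌋ : ℝ) * T ≤ S := (le_div_iff₀ hT0).1 (Int.floor_le _)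
  have h2 : S < (⌊S / T⌋ + 1) * T := (div_lt_iff₀ hT0).1 (Int.lt_floor_add_one _)
  have h3 : S = ⌊S / T⌋ * T := by
    by_contra hne
    have : T ≤ S - ⌊S / T⌋ * T :=
      hT.2 ⟨sub_pos.2 (lt_of_le_of_ne h1 (Ne.symm hne)), hp⟩
    linarith
  refine ⟨⌊S / T⌋, ?_, h3⟩
  by_contra hn
  have : (⌊S / T⌋ : ℝ) ≤ 0 := by exact_mod_cast not_lt.1 hn
  nlinarith

theorem average_eq_average_of_multiple {E : Type*} [NormedAddCommGroup E] [NormedSpace ℝ E]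
    {u : ℝ → E} (hu : Continuous u) {T : ℝ} (hp : Function.Periodic u T) {n : ℤ} (hn : 0 < n) :
    (1 / (n * T)) • ∫ t in (0 : ℝ)..n * T, u t = (1 / T) • ∫ t in (0 : ℝ)..T, u t := by
  have h := hp.intervalIntegral_add_zsmul_eq n 0 fun a b => hu.intervalIntegrable a b
  simp only [zero_add, zsmul_eq_mul] at h
  rw [h, ← Int.cast_smul_eq_zsmul ℝ, smul_smul]
  congr 1
  have : (n : ℝ) ≠ 0 := by exact_mod_cast hn.ne'
  field_simp

variable {N : ℕ}

/-! ### Solutions on the torus -/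

theorem exists_eq_add_of_toTorus_eq {θ θ' : Lift N} (h : toTorus θ = toTorus θ') :
    ∃ c, toTorus c = 0 ∧ θ = θ' + c :=
  ⟨θ - θ', by rw [toTorus_sub, h, sub_self], by abel⟩

theorem IsSolution.continuous {X : Lift N → Lift N} {φ : ℝ → Lift N} (hφ : IsSolution X φ) :
    Continuous φ :=
  continuous_iff_continuousAt.2 fun t => (hφ t).continuousAt

theorem IsSolution.comp_add {X : Lift N → Lift N} {φ : ℝ → Lift N} (hφ : IsSolution X φ) (s : ℝ) :
    IsSolution X fun t => φ (t + s) := fun t => (hφ (t + s)).comp_add_const t s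

theorem IsSolution.add_const {f : ℂ → ℂ} {g : ℂ → ℝ} {φ : ℝ → Lift N}
    (hφ : IsSolution (field f g) φ) {c : Lift N} (hc : toTorus c = 0) :
    IsSolution (field f g) fun t => φ t + c := fun t => by
  rw [field_add hc]
  exact (hφ t).add_const c

theorem IsPeriodOf.comp_add {φ : ℝ → Lift N} {T : ℝ} (hT : IsPeriodOf φ T) (s : ℝ) {c : Lift N}
    (hc : toTorus c = 0) : IsPeriodOf (fun t => φ (t + s) + c) T := by
  have : ∀ S, Function.Periodic (fun t => toTorus (φ (t + s) + c)) S ↔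
      Function.Periodic (fun t => toTorus (φ t)) S := by
    intro S
    simp only [toTorus_add, hc, add_zero, Function.Periodic]
    refine ⟨fun h t => ?_, fun h t => ?_⟩
    · have := h (t - s)
      rwa [sub_add_cancel, show t - s + S + s = t + S by ring] at this
    · rw [← h (t + s), show t + S + s = t + s + S by ring]
  simpa only [IsPeriodOf, this] using hT

section Field

variable {f : ℂ → ℂ} {g : ℂ → ℝ}

theorem field_solution_unique (hN : 2 ≤ N) (hf : ContDiffOn ℝ ∞ f (Metric.ball 0 1))
    (hg : ContDiffOn ℝ ∞ g (Metric.ball 0 1)) {φ ψ : ℝ → Lift N}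
    (hφ : IsSolution (field f g) φ) (hψ : IsSolution (field f g) ψ)
    (hinj : ∀ t, Function.Injective (toTorus (φ t))) {t₀ : ℝ} (h : φ t₀ = ψ t₀) : φ = ψ :=
  ode_eq_of_mem_open isOpen_diskPhases ((contDiffOn_field hf hg).of_le (by simp)) hφ hψ
    (fun t => mem_diskPhases hN (hinj t)) h

/-- Lifts of the same torus point differ by a deck translation, under which the field is invariant;
uniqueness of lifted solutions then applies. -/
theorem field_solution_translate (hN : 2 ≤ N) (hf : ContDiffOn ℝ ∞ f (Metric.ball 0 1))
    (hg : ContDiffOn ℝ ∞ g (Metric.ball 0 1)) {φ ψ : ℝ → Lift N}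
    (hφ : IsSolution (field f g) φ) (hψ : IsSolution (field f g) ψ)
    (hinj : ∀ t, Function.Injective (toTorus (φ t))) {a b : ℝ}
    (h : toTorus (φ a) = toTorus (ψ b)) (t : ℝ) :
    toTorus (φ (t + a)) = toTorus (ψ (t + b)) := by
  obtain ⟨c, hc, hφψ⟩ := exists_eq_add_of_toTorus_eq h
  have := field_solution_unique hN hf hg (hφ.comp_add a) ((hψ.comp_add b).add_const hc)
    (fun t => hinj _) (t₀ := 0) (by simpa using hφψ)
  rw [congrFun this t, toTorus_add, hc, add_zero]

/-- Every point of a periodic orbit lies on a periodic solution that parametrizes the orbit. -/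
theorem IsPeriodicOrbit.exists_solution {C : Set (Torus N)}
    (hC : IsPeriodicOrbit (field f g) C) {θ : Lift N} (hθ : toTorus θ ∈ C) :
    ∃ φ T, IsSolution (field f g) φ ∧ φ 0 = θ ∧ IsPeriodOf φ T ∧
      C = range fun t => toTorus (φ t) := by
  obtain ⟨ψ, T, hψ, hT, rfl⟩ := hC
  obtain ⟨s, hs⟩ := hθ
  obtain ⟨c, hc, hθc⟩ := exists_eq_add_of_toTorus_eq (Eq.symm hs)
  refine ⟨fun t => ψ (t + s) + c, T, (hψ.comp_add s).add_const hc, by simpa using hθc.symm,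
    hT.comp_add s hc, ?_⟩
  simp only [toTorus_add, hc, add_zero]
  exact ((Equiv.addRight s).surjective.range_comp fun t => toTorus (ψ t)).symm

theorem IsPeriodicOrbit.nonempty {X : Lift N → Lift N} {C : Set (Torus N)}
    (hC : IsPeriodicOrbit X C) : C.Nonempty := by
  obtain ⟨ψ, T, hψ, hT, rfl⟩ := hC
  exact range_nonempty _

theorem surjective_toTorus : Function.Surjective (toTorus (N := N)) := fun x => by
  choose θ hθ using fun j => Real.Angle.induction_on (p := fun y => ∃ t : ℝ, (t : Real.Angle) = y)
    (x j) fun t => ⟨t, rfl⟩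
  exact ⟨θ, funext hθ⟩

theorem contDiffAt_field (hN : 2 ≤ N) (hf : ContDiffOn ℝ ∞ f (Metric.ball 0 1))
    (hg : ContDiffOn ℝ ∞ g (Metric.ball 0 1)) {θ : Lift N}
    (hθ : Function.Injective (toTorus θ)) : ContDiffAt ℝ ∞ (field (N := N) f g) θ :=
  (contDiffOn_field hf hg).contDiffAt (isOpen_diskPhases.mem_nhds (mem_diskPhases hN hθ))

theorem fderiv_field_congr {θ θ' : Lift N} (h : toTorus θ = toTorus θ') :
    fderiv ℝ (field (N := N) f g) θ = fderiv ℝ (field (N := N) f g) θ' := by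
  obtain ⟨c, hc, rfl⟩ := exists_eq_add_of_toTorus_eq h
  rw [← fderiv_comp_add_right]
  exact congrArg (fun F => fderiv ℝ F θ') (funext fun x => field_add hc x)

theorem fderiv_crossRatios_congr [NeZero N] {θ θ' : Lift N} (h : toTorus θ = toTorus θ') :
    fderiv ℝ (crossRatios (N := N)) θ = fderiv ℝ (crossRatios (N := N)) θ' := by
  obtain ⟨c, hc, rfl⟩ := exists_eq_add_of_toTorus_eq h
  exact fderiv_crossRatios_add (ζ := 0) (fun j => congrFun hc j) θ'

/-- Existence of variations along periodic solutions. -/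
theorem exists_isVariation (hN : 2 ≤ N) (hf : ContDiffOn ℝ ∞ f (Metric.ball 0 1))
    (hg : ContDiffOn ℝ ∞ g (Metric.ball 0 1)) {φ : ℝ → Lift N}
    (hφ : IsSolution (field f g) φ) (hinj : ∀ t, Function.Injective (toTorus (φ t))) {T : ℝ}
    (hT : T ≠ 0) (hp : Function.Periodic (fun t => toTorus (φ t)) T) (v₀ : Lift N) :
    ∃ v, IsVariation (field f g) φ v ∧ v 0 = v₀ := by
  have hA : Continuous fun t => fderiv ℝ (field (N := N) f g) (φ t) :=
    continuous_iff_continuousAt.2 fun t =>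
      ((contDiffAt_field hN hf hg (hinj t)).continuousAt_fderiv (by simp)).comp
        hφ.continuous.continuousAt
  have hper : Function.Periodic (fun t => fderiv ℝ (field (N := N) f g) (φ t)) T :=
    fun t => fderiv_field_congr (hp t)
  obtain ⟨M, hM⟩ := (hper.isBounded_of_continuous hT hA).exists_norm_le
  obtain ⟨v, hv0, hv⟩ := exists_linear_ode_solution hA
    (fun t => hM _ (mem_range_self t)) v₀
  exact ⟨v, hv, hv0⟩

/-- The derivative of the cross-ratios is constant along variations. -/
theorem fderiv_crossRatios_variation [NeZero N] (hN : 2 ≤ N)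
    (hf : ContDiffOn ℝ ∞ f (Metric.ball 0 1)) (hg : ContDiffOn ℝ ∞ g (Metric.ball 0 1))
    {φ v : ℝ → Lift N} (hφ : IsSolution (field f g) φ)
    (hinj : ∀ t, Function.Injective (toTorus (φ t))) (hv : IsVariation (field f g) φ v) (t : ℝ) :
    fderiv ℝ (crossRatios (N := N)) (φ t) (v t) = fderiv ℝ (crossRatios (N := N)) (φ 0) (v 0) := by
  have hd : ∀ t, HasDerivAt (fun t => fderiv ℝ (crossRatios (N := N)) (φ t) (v t)) 0 t := by
    intro t
    have hΛ : ContDiffAt ℝ 2 (crossRatios (N := N)) (φ t) := contDiffAt_crossRatios (hinj t)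
    have hΛ' : HasFDerivAt (fderiv ℝ (crossRatios (N := N)))
        (fderiv ℝ (fderiv ℝ (crossRatios (N := N))) (φ t)) (φ t) :=
      ((hΛ.fderiv_right (m := 1) le_rfl).differentiableAt one_ne_zero).hasFDerivAt
    have hX : HasFDerivAt (field (N := N) f g) (fderiv ℝ (field (N := N) f g) (φ t)) (φ t) :=
      ((contDiffAt_field hN hf hg (hinj t)).differentiableAt (by simp)).hasFDerivAt
    have h0 : HasFDerivAt (fun θ => fderiv ℝ (crossRatios (N := N)) θ (field f g θ))
          (0 : Lift N →L[ℝ] Param N) (φ t) := by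
      refine (hasFDerivAt_const (0 : Param N) (φ t)).congr_of_eventuallyEq ?_
      filter_upwards [isOpen_injective_toTorus.mem_nhds (hinj t)] with θ hθ
      exact fderiv_crossRatios_field hθ
    -- Differentiating `DΛ(θ) X(θ) = 0` in direction `v` gives `D²Λ(v, X) + DΛ(DX v) = 0`. By
    -- symmetry of `D²Λ` the left side is the time derivative of `DΛ(φ) v`.
    have h1 := DFunLike.congr_fun ((hΛ'.clm_apply hX).unique h0) (v t)
    have h2 := (hΛ'.comp_hasDerivAt t (hφ t)).clm_apply (hv t)
    refine h2.congr_deriv ?_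
    have hsymm := (hΛ.isSymmSndFDerivAt (by simp)) (field f g (φ t)) (v t)
    rw [hsymm]
    simpa [add_comm] using h1
  exact is_const_of_deriv_eq_zero (fun t => (hd t).differentiableAt) (fun t => (hd t).deriv) t 0

/-- Exponentially decaying variations are tangent to the level sets of the cross-ratios. -/
theorem fderiv_crossRatios_eq_zero_of_decay [NeZero N] (hN : 2 ≤ N)
    (hf : ContDiffOn ℝ ∞ f (Metric.ball 0 1)) (hg : ContDiffOn ℝ ∞ g (Metric.ball 0 1))
    {φ v : ℝ → Lift N} (hφ : IsSolution (field f g) φ)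
    (hinj : ∀ t, Function.Injective (toTorus (φ t))) {T : ℝ}
    (hT : T ≠ 0) (hp : Function.Periodic (fun t => toTorus (φ t)) T)
    (hv : IsVariation (field f g) φ v) {a A B : ℝ} (ha : a < 0)
    (hdecay : ∀ t ≥ 0, ‖v t‖ ≤ A * Real.exp (a * t) * B) :
    fderiv ℝ (crossRatios (N := N)) (φ 0) (v 0) = 0 := by
  have hΛ : Continuous fun t => fderiv ℝ (crossRatios (N := N)) (φ t) :=
    continuous_iff_continuousAt.2 fun t =>
      ((contDiffAt_crossRatios (n := 1) (hinj t)).continuousAt_fderiv one_ne_zero).comp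
        hφ.continuous.continuousAt
  have hper : Function.Periodic (fun t => fderiv ℝ (crossRatios (N := N)) (φ t)) T :=
    fun t => fderiv_crossRatios_congr (hp t)
  obtain ⟨M, hM⟩ := (hper.isBounded_of_continuous hT hΛ).exists_norm_le
  have hbound : ∀ t ≥ 0, ‖fderiv ℝ (crossRatios (N := N)) (φ 0) (v 0)‖ ≤
      M * (A * Real.exp (a * t) * B) := by
    intro t ht
    rw [← fderiv_crossRatios_variation hN hf hg hφ hinj hv t]
    refine (ContinuousLinearMap.le_opNorm _ _).trans ?_
    exact mul_le_mul (hM _ (mem_range_self t)) (hdecay t ht) (norm_nonneg _)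
      ((norm_nonneg _).trans (hM _ (mem_range_self t)))
  have hlim : Tendsto (fun t => M * (A * Real.exp (a * t) * B)) atTop (𝓝 0) := by
    have h1 : Tendsto (fun t : ℝ => Real.exp (a * t)) atTop (𝓝 0) :=
      Real.tendsto_exp_atBot.comp (tendsto_id.const_mul_atTop_of_neg ha)
    simpa using ((h1.const_mul A).mul_const B).const_mul M
  have h2 := le_of_tendsto_of_tendsto
    (tendsto_const_nhds (x := ‖fderiv ℝ (crossRatios (N := N)) (φ 0) (v 0)‖)) hlim
    ((eventually_ge_atTop 0).mono hbound)
  exact norm_le_zero_iff.1 h2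

end Field

end WS

namespace WS

variable {N : ℕ}

/-! ### The drift -/

theorem IsNormalizedPerturbation.periodic {h : ℝ → ℝ} (hh : IsNormalizedPerturbation h) :
    Function.Periodic h (2 * Real.pi) := by
  obtain ⟨-, a, b, hab, -, -⟩ := hh
  intro x
  refine (hab (x + 2 * Real.pi)).unique ?_
  convert hab x using 2 with n
  have h1 : ((n + 2 : ℕ) : ℝ) * (x + 2 * Real.pi) =
      ((n + 2 : ℕ) : ℝ) * x + ((n + 2 : ℕ) : ℝ) * (2 * Real.pi) := by ring
  rw [h1, Real.sin_add_nat_mul_two_pi, Real.cos_add_nat_mul_two_pi]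

theorem IsNormalizedPerturbation.eq_of_coe_eq {h : ℝ → ℝ} (hh : IsNormalizedPerturbation h)
    {a b : ℝ} (hab : (a : Real.Angle) = b) : h a = h b := by
  obtain ⟨n, hn⟩ := Real.Angle.angle_eq_iff_two_pi_dvd_sub.1 hab
  have : a = b + n * (2 * Real.pi) := by linarith
  rw [this, hh.periodic.int_mul n b]

theorem drift_crossRatios_congr [NeZero N] {h : ℝ → ℝ} (hh : IsNormalizedPerturbation h)
    {θ θ' : Lift N} (hθ : toTorus θ = toTorus θ') :
    drift crossRatios h θ = drift crossRatios h θ' := by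
  rw [drift, drift, fderiv_crossRatios_congr hθ]
  congr 1
  exact funext fun j => hh.eq_of_coe_eq (congrFun hθ j)

theorem contDiffAt_drift [NeZero N] {h : ℝ → ℝ} (hh : IsNormalizedPerturbation h) {θ : Lift N}
    (hθ : Function.Injective (toTorus θ)) : ContDiffAt ℝ 1 (drift (N := N) crossRatios h) θ := by
  have h1 : ContDiffAt ℝ 1 (fderiv ℝ (crossRatios (N := N))) θ :=
    (contDiffAt_crossRatios (n := 2) hθ).fderiv_right (m := 1) le_rfl
  have h2 : ContDiff ℝ 1 fun θ : Lift N => fun j => h (θ j) :=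
    contDiff_pi.2 fun j => (hh.1.of_le (by simp)).comp (contDiff_apply ℝ ℝ j)
  exact h1.clm_apply h2.contDiffAt

theorem continuous_drift {h : ℝ → ℝ} (hh : IsNormalizedPerturbation h) {Λ : Lift N → Param N}
    (hΛ : ∀ θ, Function.Injective (toTorus θ) → ContDiffAt ℝ 1 Λ θ) {φ : ℝ → Lift N}
    (hφ : Continuous φ) (hinj : ∀ t, Function.Injective (toTorus (φ t))) :
    Continuous fun t => drift Λ h (φ t) := by
  have h1 : Continuous fun t => fderiv ℝ Λ (φ t) := continuous_iff_continuousAt.2 fun t =>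
    ((hΛ _ (hinj t)).continuousAt_fderiv one_ne_zero).comp hφ.continuousAt
  exact h1.clm_apply (continuous_pi fun j => hh.1.continuous.comp ((continuous_apply j).comp hφ))

theorem averagedDrift_apply {h : ℝ → ℝ} (hh : IsNormalizedPerturbation h) {Λ : Lift N → Param N}
    (hΛ : ∀ θ, Function.Injective (toTorus θ) → ContDiffAt ℝ 1 Λ θ) {φ : ℝ → Lift N}
    (hφ : Continuous φ) (hinj : ∀ t, Function.Injective (toTorus (φ t))) (T : ℝ)
    (k : Fin (N - 3)) :
    averagedDrift Λ h φ T k = (1 / T) * ∫ t in (0 : ℝ)..T, drift Λ h (φ t) k := by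
  rw [averagedDrift, Pi.smul_apply, smul_eq_mul]
  congr 1
  exact (ContinuousLinearMap.intervalIntegral_comp_comm
    (ContinuousLinearMap.proj (R := ℝ) (φ := fun _ : Fin (N - 3) => ℝ) k)
    ((continuous_drift hh hΛ hφ hinj).intervalIntegrable 0 T)).symm

/-! ### Periodic orbits and transversality on the invariant manifold -/

section Orbits

variable {f : ℂ → ℂ} {g : ℂ → ℝ}

theorem IsPeriodOf.periodic {φ : ℝ → Lift N} {T : ℝ} (hT : IsPeriodOf φ T) :
    Function.Periodic (fun t => toTorus (φ t)) T := hT.1.2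

theorem IsPeriodicOrbit.eq_range (hN : 2 ≤ N) (hf : ContDiffOn ℝ ∞ f (Metric.ball 0 1))
    (hg : ContDiffOn ℝ ∞ g (Metric.ball 0 1)) {C : Set (Torus N)}
    (hC : IsPeriodicOrbit (field f g) C) (hinj : ∀ x ∈ C, Function.Injective x) {φ : ℝ → Lift N}
    (hφ : IsSolution (field f g) φ) (h0 : toTorus (φ 0) ∈ C) :
    (∃ T, IsPeriodOf φ T) ∧ C = range fun t => toTorus (φ t) := by
  obtain ⟨ψ, T, hψ, hψ0, hT, hCψ⟩ := hC.exists_solution h0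
  have hmem : ∀ t, toTorus (ψ t) ∈ C := fun t => hCψ ▸ mem_range_self t
  have : ψ = φ := field_solution_unique hN hf hg hψ hφ (fun t => hinj _ (hmem t)) hψ0
  subst this
  exact ⟨⟨T, hT⟩, hCψ⟩

theorem IsPeriodicOrbit.mem (hN : 2 ≤ N) (hf : ContDiffOn ℝ ∞ f (Metric.ball 0 1))
    (hg : ContDiffOn ℝ ∞ g (Metric.ball 0 1)) {C : Set (Torus N)}
    (hC : IsPeriodicOrbit (field f g) C) (hinj : ∀ x ∈ C, Function.Injective x) {φ : ℝ → Lift N}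
    (hφ : IsSolution (field f g) φ) (h0 : toTorus (φ 0) ∈ C) (t : ℝ) : toTorus (φ t) ∈ C := by
  have := (hC.eq_range hN hf hg hinj hφ h0).2
  rw [this]
  exact mem_range_self t

/-- Averages over a periodic orbit depend neither on the base point nor on the choice of a
period. -/
theorem IsPeriodicOrbit.average_eq (hN : 2 ≤ N) (hf : ContDiffOn ℝ ∞ f (Metric.ball 0 1))
    (hg : ContDiffOn ℝ ∞ g (Metric.ball 0 1)) {C : Set (Torus N)}
    (hC : IsPeriodicOrbit (field f g) C) (hinj : ∀ x ∈ C, Function.Injective x) {E : Type*}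
    [NormedAddCommGroup E] [NormedSpace ℝ E] {D : Lift N → E}
    (hD : ∀ θ θ', toTorus θ = toTorus θ' → D θ = D θ')
    (hDc : ∀ θ, Function.Injective (toTorus θ) → ContinuousAt D θ)
    {φ ψ : ℝ → Lift N} (hφ : IsSolution (field f g) φ) (hφC : toTorus (φ 0) ∈ C)
    (hψ : IsSolution (field f g) ψ) (hψC : toTorus (ψ 0) ∈ C) {T S : ℝ} (hT : IsPeriodOf φ T)
    (hS0 : 0 < S) (hS : Function.Periodic (fun t => toTorus (ψ t)) S) :
    (1 / S) • ∫ t in (0 : ℝ)..S, D (ψ t) = (1 / T) • ∫ t in (0 : ℝ)..T, D (φ t) := by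
  have hφm := hC.mem hN hf hg hinj hφ hφC
  obtain ⟨a, ha⟩ : ∃ a, toTorus (φ a) = toTorus (ψ 0) := by
    rw [(hC.eq_range hN hf hg hinj hφ hφC).2] at hψC
    exact hψC
  have htr : ∀ t, toTorus (φ (t + a)) = toTorus (ψ t) := fun t => by
    have := field_solution_translate hN hf hg hφ hψ (fun t => hinj _ (hφm t)) ha t
    rwa [add_zero] at this
  have hSφ : Function.Periodic (fun t => toTorus (φ t)) S := fun t => by
    have h1 := htr (t - a + S)
    have h2 := htr (t - a)
    rw [show t - a + S + a = t + S by ring] at h1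
    rw [sub_add_cancel] at h2
    simp only [h1, h2]
    exact hS (t - a)
  have hc : Continuous fun t => D (φ t) := continuous_iff_continuousAt.2 fun t =>
    (hDc _ (hinj _ (hφm t))).comp hφ.continuous.continuousAt
  obtain ⟨n, hn, rfl⟩ := exists_nat_mul_of_isLeast_period hT hS0 hSφ
  have hDp : ∀ {R}, Function.Periodic (fun t => toTorus (φ t)) R →
      Function.Periodic (fun t => D (φ t)) R := fun hR t => hD _ _ (hR t)
  rw [← average_eq_average_of_multiple hc (hDp hT.periodic) hn]
  congr 1
  have h1 : ∀ t, D (ψ t) = D (φ (t + a)) := fun t => hD _ _ (htr t).symm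
  simp only [h1]
  rw [intervalIntegral.integral_comp_add_right (fun t => D (φ t)), zero_add, add_comm _ a,
    (hDp hSφ).intervalIntegral_add_eq a 0, zero_add]

/-- At a zero of the field the solution is constant, every positive number is a period, and there is
no least one. -/
theorem field_ne_zero_of_isPeriodOf (hN : 2 ≤ N) (hf : ContDiffOn ℝ ∞ f (Metric.ball 0 1))
    (hg : ContDiffOn ℝ ∞ g (Metric.ball 0 1)) {φ : ℝ → Lift N} (hφ : IsSolution (field f g) φ)
    (hinj : ∀ t, Function.Injective (toTorus (φ t))) {T : ℝ} (hT : IsPeriodOf φ T) :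
    field f g (φ 0) ≠ 0 := by
  intro h0
  have hc : IsSolution (field f g) fun _ => φ 0 := fun t => by
    rw [h0]; exact hasDerivAt_const _ _
  have : φ = fun _ => φ 0 := field_solution_unique hN hf hg hφ hc hinj (t₀ := 0) rfl
  have hT0 : 0 < T := hT.1.1
  have h2 : T ≤ T / 2 := hT.2 ⟨by positivity, fun t => by
    simp only [congrFun this (t + T / 2), congrFun this t]⟩
  linarith

/-- On a normally attracting invariant manifold that consists of periodic orbits, the cross-ratios
have a surjective derivative in the tangent directions. -/
theorem IsNAIM.exists_tangent_fderiv_crossRatios_eq [NeZero N] (hN : 2 ≤ N)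
    (hf : ContDiffOn ℝ ∞ f (Metric.ball 0 1))
    (hg : ContDiffOn ℝ ∞ g (Metric.ball 0 1)) {r : ℕ} {M : Set (Torus N)}
    (hM : IsNAIM r (field f g) M) {φ : ℝ → Lift N} (hφ : IsSolution (field f g) φ)
    (hφM : ∀ t, toTorus (φ t) ∈ M) (hinj : ∀ t, Function.Injective (toTorus (φ t))) {T : ℝ}
    (hT : 0 < T) (hp : Function.Periodic (fun t => toTorus (φ t)) T) (w : Param N) :
    ∃ u ∈ tangentAt (toTorus ⁻¹' M) (φ 0), fderiv ℝ (crossRatios (N := N)) (φ 0) u = w := by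
  obtain ⟨P, -, hP, -, hrate⟩ := hM.splitting
  obtain ⟨hidem, hrange⟩ := hP _ (hφM 0)
  have hK : IsCompact (range fun t => toTorus (φ t)) :=
    hp.compact_of_continuous hT.ne' (continuous_toTorus.comp hφ.continuous)
  obtain ⟨a, b, A, hab, hb, -, hA⟩ := hrate _ (range_subset_iff.2 hφM) hK
  have ha : a < 0 := hab.trans_le (mul_nonpos_of_nonneg_of_nonpos (Nat.cast_nonneg r) hb)
  obtain ⟨u, hu⟩ := surjective_fderiv_crossRatios (hinj 0) w
  refine ⟨P (toTorus (φ 0)) u, ?_, ?_⟩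
  · rw [← SetLike.mem_coe, ← hrange]
    exact mem_range_self u
  -- The normal component `u - P u` generates a decaying variation, because `a < r b ≤ 0`. So `DΛ`
  -- annihilates it and `DΛ (P u) = DΛ u = w`.
  · obtain ⟨v, hv, hv0⟩ := exists_isVariation hN hf hg hφ hinj hT.ne' hp
      (u - P (toTorus (φ 0)) u)
    have hPv : P (toTorus (φ 0)) (v 0) = 0 := by rw [hv0, map_sub, hidem, sub_self]
    have hdecay := (hA φ v hφ (mem_range_self 0) hv).2 hPv
    have h0 := fderiv_crossRatios_eq_zero_of_decay hN hf hg hφ hinj hT.ne' hp hv ha hdecay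
    rw [hv0, map_sub, hu, sub_eq_zero] at h0
    exact h0.symm

/-- Tangent vectors of a set on which `G` vanishes are annihilated by the derivative of `G`. -/
theorem fderiv_eq_zero_of_mem_tangentAt {F : Type*} [NormedAddCommGroup F] [NormedSpace ℝ F]
    {S U : Set (Lift N)} {G : Lift N → F} {p u : Lift N} (hU : IsOpen U) (hpU : p ∈ U)
    (hpS : p ∈ S) (hG : DifferentiableAt ℝ G p) (hSG : ∀ x ∈ S ∩ U, G x = 0)
    (hu : u ∈ tangentAt S p) : fderiv ℝ G p u = 0 := by
  have h0 : HasFDerivWithinAt G (0 : Lift N →L[ℝ] F) S p := by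
    refine (hasFDerivWithinAt_const (0 : F) p S).congr_of_eventuallyEq ?_ (hSG p ⟨hpS, hpU⟩)
    filter_upwards [self_mem_nhdsWithin, mem_nhdsWithin_of_mem_nhds (hU.mem_nhds hpU)] with x hx hxU
    exact hSG x ⟨hx, hxU⟩
  have h1 := hG.hasFDerivAt.hasFDerivWithinAt (s := S)
  have heq := h1.unique_on h0
  have : tangentAt S p ≤ LinearMap.ker (fderiv ℝ G p).toLinearMap :=
    Submodule.span_le.2 fun v hv => heq hv
  exact this hu

/-- Near a point of an orbit of the manifold, local equations of the manifold, the cross-ratios and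
one of the phases form a coordinate system. -/
theorem exists_coordinates_equiv [NeZero N] (hN : 4 ≤ N) {X : Lift N}
    {G : Lift N →L[ℝ] (Fin 2 → ℝ)} {L : Lift N →L[ℝ] Param N} (hG : Function.Surjective G)
    (hL : ∀ w, ∃ u, G u = 0 ∧ L u = w) (hGX : G X = 0) (hLX : L X = 0) {j : Fin N}
    (hj : X j ≠ 0) :
    ∃ Ψ' : Lift N ≃L[ℝ] (Fin 2 → ℝ) × Param N × ℝ, (Ψ' : Lift N →L[ℝ] _) =
      G.prod (L.prod (ContinuousLinearMap.proj (R := ℝ) (φ := fun _ : Fin N => ℝ) j)) := by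
  set D := G.prod (L.prod (ContinuousLinearMap.proj (R := ℝ) (φ := fun _ : Fin N => ℝ) j)) with hD
  have hsurj : Function.Surjective D := by
    rintro ⟨a, w, s⟩
    obtain ⟨u₀, hu₀⟩ := hG a
    obtain ⟨u₁, hu₁, hu₁'⟩ := hL (w - L u₀)
    -- `u₀` attains the value of `G`, `u₁ ∈ ker G` corrects `L`, and a multiple of `X`, which lies
    -- in both kernels, corrects the `j`-th phase.
    refine ⟨u₀ + u₁ + ((s - (u₀ j + u₁ j)) / X j) • X, ?_⟩
    refine Prod.ext ?_ (Prod.ext ?_ ?_)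
    · simp [hD, hu₀, hu₁, hGX]
    · simp [hD, hu₁', hLX]
    · simp [hD, hj]
  have hrank : Module.finrank ℝ (Lift N) = Module.finrank ℝ ((Fin 2 → ℝ) × Param N × ℝ) := by
    simp only [Module.finrank_prod, Module.finrank_fin_fun, Module.finrank_self]
    omega
  have hinj : Function.Injective D :=
    (LinearMap.injective_iff_surjective_of_finrank_eq_finrank (f := D.toLinearMap) hrank).2 hsurj
  exact ⟨ContinuousLinearEquiv.ofBijective D (LinearMap.ker_eq_bot.2 hinj)
    (LinearMap.range_eq_top.2 hsurj), rfl⟩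

end Orbits

end WS

/-! ### Differentiability of orbit averages in the parameter -/

namespace WS

variable {N : ℕ} {f : ℂ → ℂ} {g : ℂ → ℝ}

theorem IsContinuum.injective [NeZero N] {r : ℕ} {X : Lift N → Lift N} {W : Set (Param N)}
    {C : Param N → Set (Torus N)} (hM : IsContinuum r X W C) {l : Param N} (hl : l ∈ W)
    {x : Torus N} (hx : x ∈ C l) : Function.Injective x :=
  injective_of_mem_levelSet ((hM.orbit l hl).2.1 hx)

theorem IsContinuum.mem_of_mem_iUnion [NeZero N] {r : ℕ} {X : Lift N → Lift N}
    {W : Set (Param N)} {C : Param N → Set (Torus N)} (hM : IsContinuum r X W C) {θ : Lift N}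
    (h : toTorus θ ∈ ⋃ l ∈ W, C l) : toTorus θ ∈ C (crossRatios θ) := by
  obtain ⟨l, hl, hθ⟩ := mem_iUnion₂.1 h
  rwa [crossRatios_of_mem_levelSet ((hM.orbit l hl).2.1 hθ)]

set_option maxHeartbeats 1000000 in
/-- The averages of a smooth function over the orbits of a continuum are strictly differentiable in
the parameter. -/
theorem IsContinuum.exists_hasStrictFDerivAt_average [NeZero N] (hN : 4 ≤ N) {r : ℕ} (hr : 1 ≤ r)
    (hf : ContDiffOn ℝ ∞ f (Metric.ball 0 1)) (hg : ContDiffOn ℝ ∞ g (Metric.ball 0 1))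
    {W : Set (Param N)} {C : Param N → Set (Torus N)} (hM : IsContinuum r (field f g) W C)
    {E : Type*} [NormedAddCommGroup E] [NormedSpace ℝ E] [CompleteSpace E] {D : Lift N → E}
    (hD : ContDiffOn ℝ 1 D {θ | Function.Injective (toTorus θ)}) {l₀ : Param N} (hl₀ : l₀ ∈ W) :
    ∃ (F : Param N → E) (F' : Param N →L[ℝ] E), HasStrictFDerivAt F F' l₀ ∧
      ∀ᶠ l in 𝓝 l₀, ∃ (ψ : ℝ → Lift N) (S : ℝ), IsSolution (field f g) ψ ∧ toTorus (ψ 0) ∈ C l ∧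
        0 < S ∧ Function.Periodic (fun t => toTorus (ψ t)) S ∧
        F l = (1 / S) • ∫ t in (0 : ℝ)..S, D (ψ t) := by
  have hN2 : 2 ≤ N := by omega
  have horb := (hM.orbit l₀ hl₀).1
  obtain ⟨x₀, hx₀⟩ := horb.nonempty
  obtain ⟨p, rfl⟩ := surjective_toTorus x₀
  obtain ⟨φ, T₀, hφ, hφ0, hT₀, hCφ⟩ := horb.exists_solution hx₀
  subst hφ0
  have hφC : ∀ t, toTorus (φ t) ∈ C l₀ := fun t => hCφ ▸ mem_range_self t
  have hφM : ∀ t, toTorus (φ t) ∈ ⋃ l ∈ W, C l := fun t => mem_biUnion hl₀ (hφC t)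
  have hinj : ∀ t, Function.Injective (toTorus (φ t)) := fun t => hM.injective hl₀ (hφC t)
  have hT₀0 : 0 < T₀ := hT₀.1.1
  have hφl : crossRatios (φ 0) = l₀ := crossRatios_of_mem_levelSet ((hM.orbit l₀ hl₀).2.1 hx₀)
  -- local coordinates
  obtain ⟨U, hU, hpU, G, hG, hGs, hGU⟩ := hM.naim.submanifold (φ 0) (hφM 0)
  have hGp : ContDiffAt ℝ 1 G (φ 0) :=
    (hG.contDiffAt (hU.mem_nhds hpU)).of_le (by exact_mod_cast hr)
  have hG0 : ∀ x ∈ (toTorus ⁻¹' ⋃ l ∈ W, C l) ∩ U, G x = 0 := fun x hx => by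
    rw [hGU] at hx
    exact hx.2
  have hX0 := field_ne_zero_of_isPeriodOf hN2 hf hg hφ hinj hT₀
  obtain ⟨j, hj⟩ : ∃ j, field f g (φ 0) j ≠ 0 := by
    by_contra! hall
    exact hX0 (funext hall)
  have hGX : fderiv ℝ G (φ 0) (field f g (φ 0)) = 0 := by
    have h1 : HasDerivAt (G ∘ φ) (fderiv ℝ G (φ 0) (field f g (φ 0))) 0 :=
      (hGp.differentiableAt one_ne_zero).hasFDerivAt.comp_hasDerivAt 0 (hφ 0)
    have h2 : HasDerivAt (G ∘ φ) 0 0 := by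
      refine (hasDerivAt_const (0 : ℝ) (0 : Fin 2 → ℝ)).congr_of_eventuallyEq ?_
      filter_upwards [hφ.continuous.continuousAt.preimage_mem_nhds (hU.mem_nhds hpU)] with t ht
      exact hG0 _ ⟨hφM t, ht⟩
    exact h1.unique h2
  obtain ⟨Ψ', hΨ'⟩ := exists_coordinates_equiv hN (hGs _ hpU)
    (fun w => by
      obtain ⟨u, hu, huw⟩ := hM.naim.exists_tangent_fderiv_crossRatios_eq hN2 hf hg hφ hφM hinj
        hT₀0 hT₀.periodic w
      exact ⟨u, fderiv_eq_zero_of_mem_tangentAt hU hpU (hφM 0) (hGp.differentiableAt one_ne_zero)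
        hG0 hu, huw⟩)
    hGX (fderiv_crossRatios_field (hinj 0)) hj
  let τ : Lift N →L[ℝ] ℝ := ContinuousLinearMap.proj (R := ℝ) (φ := fun _ : Fin N => ℝ) j
  let Ψ : Lift N → (Fin 2 → ℝ) × Param N × ℝ := fun x => (G x, crossRatios x, τ x)
  have hΨ : HasStrictFDerivAt Ψ (Ψ' : Lift N →L[ℝ] (Fin 2 → ℝ) × Param N × ℝ) (φ 0) := by
    rw [hΨ']
    exact (hGp.hasStrictFDerivAt one_ne_zero).prodMk
      (((contDiffAt_crossRatios (n := 1) (hinj 0)).hasStrictFDerivAt one_ne_zero).prodMk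
        τ.hasStrictFDerivAt)
  -- globally defined vector field and observable
  let Ω : Set (Lift N) := {θ | Function.Injective (toTorus θ)}
  have hΩ : IsOpen Ω := isOpen_injective_toTorus
  have hΩd : Ω ⊆ diskPhases N := fun θ hθ => mem_diskPhases hN2 hθ
  let K : Set (Lift N) := φ '' Icc 0 T₀
  have hK : IsCompact K := isCompact_Icc.image hφ.continuous
  have hKΩ : K ⊆ Ω := by
    rintro _ ⟨t, -, rfl⟩
    exact hinj t
  have hXΩ : ContDiffOn ℝ 1 (field (N := N) f g) Ω :=
    ((contDiffOn_field hf hg).mono hΩd).of_le (by simp)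
  obtain ⟨Y, hY, -, hYX⟩ := exists_contDiff_hasCompactSupport_eq (n := 1) hΩ hXΩ hK hKΩ
  obtain ⟨B, hB, -, hBD⟩ := exists_contDiff_hasCompactSupport_eq (n := 1) hΩ hD hK hKΩ
  obtain ⟨V, hV, hKV, hVsub⟩ := mem_nhdsSet_iff_exists.1
    ((hYX.and hBD).and (hΩ.mem_nhdsSet.2 hKΩ))
  have hTI : ∀ s : unitInterval, T₀ * s ∈ Icc 0 T₀ := fun s =>
    ⟨mul_nonneg hT₀0.le s.2.1, mul_le_of_le_one_right hT₀0.le s.2.2⟩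
  have hφV : ∀ s : unitInterval, φ (T₀ * s) ∈ V := fun s => hKV (mem_image_of_mem _ (hTI s))
  have hφT : field f g (φ T₀) = field f g (φ 0) := field_congr (by simpa using hT₀.periodic 0)
  have hYφ : ∀ s : unitInterval, HasDerivAt φ (Y (φ (T₀ * s))) (T₀ * s) := fun s => by
    rw [(hVsub (hφV s)).1.1]; exact hφ _
  have hτX : τ (Y (φ T₀)) ≠ 0 := by
    have := (hVsub (hφV 1)).1.1
    rw [Icc.coe_one, mul_one] at this
    rw [this, hφT]
    exact hj
  obtain ⟨y, x, T, ⟨y', hy'⟩, hxc, hTc, hy0, hx0, hT0, hev⟩ :=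
    exists_strict_continuation hY hφ.continuous T₀ hYφ hΨ τ hτX
  -- restriction to the manifold
  let w : Param N → (Fin 2 → ℝ) × Param N × ℝ := fun l => (0, l, τ (φ 0))
  have hid : HasStrictFDerivAt (fun l : Param N => l) (ContinuousLinearMap.id ℝ (Param N)) l₀ :=
    hasStrictFDerivAt_id _
  have hw := (hasStrictFDerivAt_const (𝕜 := ℝ) (0 : Fin 2 → ℝ) l₀).prodMk
    (hid.prodMk (hasStrictFDerivAt_const (𝕜 := ℝ) (τ (φ 0)) l₀))
  change HasStrictFDerivAt w _ _ at hw
  have hw0 : w l₀ = Ψ (φ 0) := by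
    simp only [w, Ψ, hφl, hG0 _ ⟨hφM 0, hpU⟩]
  have hyw : HasStrictFDerivAt y y' (w l₀) := hw0 ▸ hy'
  have hcomp := hyw.comp l₀ hw
  have hyc : ContinuousAt (fun l => y (w l)) l₀ := hcomp.continuousAt
  have hxw : ContinuousAt (fun l => x (w l)) l₀ :=
    ContinuousAt.comp (f := w) (by rw [hw0]; exact hxc) hw.continuousAt
  have hTw : ContinuousAt (fun l => T (w l)) l₀ :=
    ContinuousAt.comp (f := w) (by rw [hw0]; exact hTc) hw.continuousAt
  let N' : C(unitInterval, Lift N) → C(unitInterval, E) :=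
    fun y => (⟨B, hB.continuous⟩ : C(Lift N, E)).comp y
  -- With time rescaled to the unit interval the average is `∫₀¹ D(y)`, so the differentiability of
  -- the travel time in `l` is not needed. The first slot `0` of `w l` places the initial point on
  -- the manifold.
  let F : Param N → E := fun l => primitive (N' (y (w l))) 1
  have hF : ∃ F' : Param N →L[ℝ] E, HasStrictFDerivAt F F' l₀ :=
    ⟨_, ((ContinuousMap.evalCLM ℝ (1 : unitInterval)).comp primitive).hasStrictFDerivAt.comp l₀
      ((hasStrictFDerivAt_comp_continuousMap hB (y (w l₀))).comp l₀ hcomp)⟩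
  obtain ⟨F', hF'⟩ := hF
  refine ⟨F, F', hF', ?_⟩
  -- A periodic orbit on the torus may wind, so its lift returns only up to the deck translation
  -- `c`.
  set c : Lift N := φ T₀ - φ 0 with hc
  have hc0 : toTorus c = 0 := by
    rw [hc, toTorus_sub, sub_eq_zero]
    simpa using hT₀.periodic 0
  have e1 : ∀ᶠ l in 𝓝 l₀, l ∈ W := hM.isOpen.mem_nhds hl₀
  have e2 : ∀ᶠ l in 𝓝 l₀, ∀ s, y (w l) s ∈ V := by
    have : {z : C(unitInterval, Lift N) | MapsTo z univ V} ∈ 𝓝 (y (w l₀)) := by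
      refine (ContinuousMap.isOpen_setOfPred_mapsTo isCompact_univ hV).mem_nhds fun s _ => ?_
      rw [hw0, hy0]
      exact hφV s
    filter_upwards [hyc.preimage_mem_nhds this] with l hl s using hl (mem_univ s)
  have hleft := hΨ.eventually_left_inverse
  -- Where `Q` holds, `G = 0` describes the manifold and `Ψ` separates points; both ends of the
  -- segment must lie there.
  let Q : Lift N → Prop := fun z => z ∈ U ∧ hΨ.localInverse Ψ Ψ' (φ 0) (Ψ z) = z
  have hO : ∀ᶠ z in 𝓝 (φ 0), Q z := Filter.Eventually.and (hU.mem_nhds hpU) hleft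
  have e3 : ∀ᶠ l in 𝓝 l₀, Q (x (w l)) := by
    have hxt : Tendsto (fun l => x (w l)) (𝓝 l₀) (𝓝 (φ 0)) := by
      have := hxw.tendsto
      rwa [hw0, hx0] at this
    exact hxt.eventually hO
  have e4 : ∀ᶠ l in 𝓝 l₀, Q (y (w l) 1 - c) := by
    have hcont : Tendsto (fun l => y (w l) 1 - c) (𝓝 l₀) (𝓝 (φ 0)) := by
      have : ContinuousAt (fun l => y (w l) 1) l₀ :=
        (ContinuousMap.evalCLM ℝ (1 : unitInterval)).continuous.continuousAt.comp hyc
      have := this.tendsto.sub_const c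
      simp only [hw0, hy0, Icc.coe_one, mul_one] at this
      rwa [hc, sub_sub_cancel] at this
    exact hcont.eventually hO
  have e5 : ∀ᶠ l in 𝓝 l₀, 0 < T (w l) := by
    have hTt : Tendsto (fun l => T (w l)) (𝓝 l₀) (𝓝 T₀) := by
      have := hTw.tendsto
      rwa [hw0, hT0] at this
    exact hTt.eventually (lt_mem_nhds hT₀0)
  have e6 := hw.continuousAt.eventually (hw0 ▸ hev)
  filter_upwards [e1, e2, e3, e4, e5, e6] with l hlW hyV hx hyc hT hsol
  obtain ⟨hΨx, hτy, hint⟩ := hsol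
  have hGx : G (x (w l)) = 0 := congrArg Prod.fst hΨx
  have hΛx : crossRatios (x (w l)) = l := congrArg (fun q => q.2.1) hΨx
  have hxM : toTorus (x (w l)) ∈ ⋃ l ∈ W, C l := by
    have : x (w l) ∈ (toTorus ⁻¹' ⋃ l ∈ W, C l) ∩ U := by
      rw [hGU]; exact ⟨hx.1, hGx⟩
    exact this.1
  have hxC : toTorus (x (w l)) ∈ C l := by
    have := hM.mem_of_mem_iUnion hxM
    rwa [hΛx] at this
  have horbl := (hM.orbit l hlW).1
  obtain ⟨ψ, Tl, hψ, hψ0, hTl, hCψ⟩ := horbl.exists_solution hxC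
  have hψC : ∀ t, toTorus (ψ t) ∈ C l := fun t => hCψ ▸ mem_range_self t
  have hψinj : ∀ t, Function.Injective (toTorus (ψ t)) := fun t => hM.injective hlW (hψC t)
  have hyψ : ∀ s : unitInterval, y (w l) s = ψ (T (w l) * s) :=
    integral_solution_eq hΩ hXΩ hY.continuous hψ hψinj (by rw [hψ0]; exact hint)
      (fun s => (hVsub (hyV s)).2) (fun s => (hVsub (hyV s)).1.1)
  have hy1 : y (w l) 1 = ψ (T (w l)) := by simpa using hyψ 1
  have hy1C : toTorus (y (w l) 1 - c) = toTorus (ψ (T (w l))) := by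
    rw [toTorus_sub, hc0, sub_zero, hy1]
  -- The endpoint is on the same orbit, so `G` and `Λ` agree with their initial values; the section
  -- condition matches the last coordinate. Hence the segment closes, and its travel time is a
  -- period, not necessarily the least one.
  have hΨy : Ψ (y (w l) 1 - c) = Ψ (x (w l)) := by
    rw [hΨx]
    refine Prod.ext ?_ (Prod.ext ?_ ?_)
    · exact hG0 _ ⟨mem_biUnion hlW (hy1C ▸ hψC _ : toTorus (y (w l) 1 - c) ∈ C l), hyc.1⟩
    · exact (crossRatios_congr hy1C).trans
        (crossRatios_of_mem_levelSet ((hM.orbit l hlW).2.1 (hψC _)))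
    · change τ (y (w l) 1 - c) = τ (φ 0)
      rw [map_sub, hτy, hc, map_sub, sub_sub_cancel]
  have hyx : y (w l) 1 - c = x (w l) := by
    rw [← hyc.2, hΨy, hx.2]
  have hper : Function.Periodic (fun t => toTorus (ψ t)) (T (w l)) := by
    intro t
    have := field_solution_translate hN2 hf hg hψ hψ hψinj (a := T (w l)) (b := 0)
      (by rw [← hy1C, hyx, hψ0]) t
    simpa using this
  refine ⟨ψ, T (w l), hψ, hψC 0, hT, hper, ?_⟩
  change (∫ r in (0 : ℝ)..((1 : unitInterval) : ℝ), IccExtend zero_le_one (N' (y (w l))) r) = _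
  have hI : ∫ r in (0 : ℝ)..((1 : unitInterval) : ℝ), IccExtend zero_le_one (N' (y (w l))) r =
      ∫ r in (0 : ℝ)..1, D (ψ (T (w l) * r)) := by
    refine intervalIntegral.integral_congr fun t ht => ?_
    rw [Icc.coe_one, uIcc_of_le zero_le_one] at ht
    rw [IccExtend_of_mem _ _ ht]
    change B (y (w l) ⟨t, ht⟩) = _
    rw [(hVsub (hyV _)).1.2, hyψ]
  rw [hI, intervalIntegral.integral_comp_mul_left (fun t => D (ψ t)) hT.ne']
  simp

end WS

namespace WS

variable {N : ℕ}

/-! ### Permutations of the phases -/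

theorem isometry_comp_perm {α : Type*} [PseudoMetricSpace α] (σ : Equiv.Perm (Fin N)) :
    Isometry fun x : Fin N → α => x ∘ σ := by
  refine Isometry.of_dist_eq fun x y => le_antisymm ?_ ?_
  · exact (dist_pi_le_iff dist_nonneg).2 fun j => dist_le_pi_dist x y (σ j)
  · refine (dist_pi_le_iff dist_nonneg).2 fun j => ?_
    have := dist_le_pi_dist (x ∘ σ) (y ∘ σ) (σ.symm j)
    simpa using this

/-- Permutation of coordinates. -/
noncomputable def permLift (σ : Equiv.Perm (Fin N)) : Lift N ≃L[ℝ] Lift N :=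
  (LinearEquiv.funCongrLeft ℝ ℝ σ).toContinuousLinearEquiv

@[simp]
theorem permLift_apply (σ : Equiv.Perm (Fin N)) (θ : Lift N) : permLift σ θ = θ ∘ σ := rfl

theorem norm_permLift (σ : Equiv.Perm (Fin N)) (θ : Lift N) : ‖permLift σ θ‖ = ‖θ‖ := by
  simpa using (isometry_comp_perm (α := ℝ) σ).dist_eq θ 0

theorem comp_perm_symm {α : Type*} (σ : Equiv.Perm (Fin N)) (x : Fin N → α) :
    (x ∘ σ.symm) ∘ σ = x := by ext; simp

theorem comp_symm_perm {α : Type*} (σ : Equiv.Perm (Fin N)) (x : Fin N → α) :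
    (x ∘ σ) ∘ σ.symm = x := by ext; simp

/-- Equivariance of a vector field under permutations of the phases. -/
def IsPermEquivariant (X : Lift N → Lift N) : Prop :=
  ∀ (σ : Equiv.Perm (Fin N)) (θ : Lift N), X (θ ∘ σ) = X θ ∘ σ

theorem isPermEquivariant_field (f : ℂ → ℂ) (g : ℂ → ℝ) :
    IsPermEquivariant (field (N := N) f g) := by
  intro σ θ
  have : orderParameter (θ ∘ σ) = orderParameter θ := by
    simp only [orderParameter, Function.comp_apply]
    rw [Equiv.sum_comp σ fun j => cis (θ j)]
  funext j
  simp only [field, this, Function.comp_apply]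

/-- The set of points whose permutation by `σ` lies in `C`. -/
def reindex (σ : Equiv.Perm (Fin N)) (C : Set (Torus N)) : Set (Torus N) := {x | x ∘ σ ∈ C}

theorem mem_reindex {σ : Equiv.Perm (Fin N)} {C : Set (Torus N)} {x : Torus N} :
    x ∈ reindex σ C ↔ x ∘ σ ∈ C := Iff.rfl

theorem reindex_symm_reindex (σ : Equiv.Perm (Fin N)) (C : Set (Torus N)) :
    reindex σ (reindex σ.symm C) = C := by
  ext x
  rw [mem_reindex, mem_reindex, comp_symm_perm]

theorem infDist_reindex (σ : Equiv.Perm (Fin N)) (C : Set (Torus N)) (x : Torus N) :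
    Metric.infDist x (reindex σ C) = Metric.infDist (x ∘ σ) C := by
  have : C = (fun x : Torus N => x ∘ σ) '' reindex σ C := by
    ext y
    refine ⟨fun hy => ⟨y ∘ σ.symm, ?_, comp_perm_symm σ y⟩, ?_⟩
    · rwa [mem_reindex, comp_perm_symm]
    · rintro ⟨z, hz, rfl⟩
      exact hz
  conv_rhs => rw [this]
  exact (Metric.infDist_image (isometry_comp_perm σ)).symm

theorem IsPermEquivariant.isSolution {X : Lift N → Lift N} (hX : IsPermEquivariant X)
    (σ : Equiv.Perm (Fin N)) {φ : ℝ → Lift N} (hφ : IsSolution X φ) :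
    IsSolution X fun t => φ t ∘ σ := fun t => by
  rw [hX]
  exact (permLift σ).hasFDerivAt.comp_hasDerivAt t (hφ t)

theorem IsPermEquivariant.isVariation {X : Lift N → Lift N} (hX : IsPermEquivariant X)
    (σ : Equiv.Perm (Fin N)) {φ v : ℝ → Lift N} (hv : IsVariation X φ v) :
    IsVariation X (fun t => φ t ∘ σ) fun t => v t ∘ σ := fun t => by
  have h1 : fderiv ℝ X (φ t ∘ σ) (v t ∘ σ) = fderiv ℝ X (φ t) (v t) ∘ σ := by
    have h2 : X ∘ permLift σ = permLift σ ∘ X := funext fun θ => hX σ θ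
    have h3 := (permLift σ).comp_right_fderiv (f := X) (x := φ t)
    rw [h2, (permLift σ).comp_fderiv] at h3
    exact (DFunLike.congr_fun h3 (v t)).symm
  rw [h1]
  exact (permLift σ).hasFDerivAt.comp_hasDerivAt t (hv t)

theorem isPeriodOf_comp_perm (σ : Equiv.Perm (Fin N)) {φ : ℝ → Lift N} {T : ℝ} (hT : IsPeriodOf φ T) :
    IsPeriodOf (fun t => φ t ∘ σ) T := by
  have : ∀ S, Function.Periodic (fun t => toTorus (φ t ∘ σ)) S ↔
      Function.Periodic (fun t => toTorus (φ t)) S := by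
    intro S
    refine forall_congr' fun t => ?_
    change toTorus (φ (t + S)) ∘ σ = toTorus (φ t) ∘ σ ↔ _
    exact σ.surjective.injective_comp_right.eq_iff
  simpa only [IsPeriodOf, this] using hT

theorem IsPermEquivariant.isPeriodicOrbit {X : Lift N → Lift N} (hX : IsPermEquivariant X)
    (σ : Equiv.Perm (Fin N)) {C : Set (Torus N)} (hC : IsPeriodicOrbit X C) :
    IsPeriodicOrbit X (reindex σ C) := by
  obtain ⟨φ, T, hφ, hT, rfl⟩ := hC
  refine ⟨fun t => φ t ∘ σ.symm, T, hX.isSolution σ.symm hφ, isPeriodOf_comp_perm σ.symm hT, ?_⟩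
  ext x
  rw [mem_reindex]
  refine exists_congr fun t => ?_
  change toTorus (φ t) = x ∘ σ ↔ toTorus (φ t) ∘ σ.symm = x
  constructor
  · intro h; rw [h, comp_symm_perm]
  · rintro rfl; rw [comp_perm_symm]

theorem IsPermEquivariant.isExpStableIn {X : Lift N → Lift N} (hX : IsPermEquivariant X)
    (σ : Equiv.Perm (Fin N)) {L L' C : Set (Torus N)}
    (hL : ∀ x, x ∈ L' ↔ x ∘ σ ∈ L) (hC : IsExpStableIn X L C) :
    IsExpStableIn X L' (reindex σ C) := by
  obtain ⟨η, K, γ, hη, hK, hγ, H⟩ := hC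
  refine ⟨η, K, γ, hη, hK, hγ, fun θ hθ hd => ?_⟩
  rw [infDist_reindex] at hd
  obtain ⟨φ, h0, hφ, hdec⟩ := H (θ ∘ σ) ((hL _).1 hθ) hd
  refine ⟨fun t => φ t ∘ σ.symm, by simp only [h0, comp_symm_perm], fun t ht => ?_,
    fun t ht => ?_⟩
  · rw [hX]
    exact (permLift σ.symm).hasFDerivAt.comp_hasDerivWithinAt t (hφ t ht)
  · rw [infDist_reindex, infDist_reindex]
    have : toTorus (φ t ∘ σ.symm) ∘ σ = toTorus (φ t) := comp_perm_symm σ (toTorus (φ t))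
    rw [this]
    exact hdec t ht

theorem IsPermEquivariant.isStableOrbit {X : Lift N → Lift N} (hX : IsPermEquivariant X)
    (σ : Equiv.Perm (Fin N)) [NeZero N] {l l' : Param N} {C : Set (Torus N)}
    (hL : ∀ x : Torus N, x ∈ levelSet l' ↔ x ∘ σ ∈ levelSet l) (hC : IsStableOrbit X l C) :
    IsStableOrbit X l' (reindex σ C) :=
  ⟨hX.isPeriodicOrbit σ hC.1, fun x hx => (hL x).2 (hC.2.1 hx),
    hX.isExpStableIn σ hL hC.2.2⟩

theorem tangentConeAt_preimage_subset {E : Type*} [NormedAddCommGroup E] [NormedSpace ℝ E]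
    (L : E ≃L[ℝ] E) {S : Set E} {p v : E} (hv : v ∈ tangentConeAt ℝ (L ⁻¹' S) p) :
    L v ∈ tangentConeAt ℝ S (L p) :=
  tangentConeAt_mono (image_preimage_subset L S)
    (L.hasFDerivAt.hasFDerivWithinAt.mapsTo_tangent_cone hv)

theorem tangentConeAt_preimage {E : Type*} [NormedAddCommGroup E] [NormedSpace ℝ E]
    (L : E ≃L[ℝ] E) (S : Set E) (p : E) :
    tangentConeAt ℝ (L ⁻¹' S) p = L ⁻¹' tangentConeAt ℝ S (L p) := by
  refine Subset.antisymm (fun v hv => tangentConeAt_preimage_subset L hv) fun v hv => ?_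
  have h1 : S = L.symm ⁻¹' (L ⁻¹' S) := by
    rw [← preimage_comp]; simp
  have hv' : L v ∈ tangentConeAt ℝ S (L p) := hv
  rw [h1] at hv'
  simpa using tangentConeAt_preimage_subset L.symm hv'

theorem mem_tangentAt_preimage (L : Lift N ≃L[ℝ] Lift N) (S : Set (Lift N)) (p v : Lift N) :
    v ∈ tangentAt (L ⁻¹' S) p ↔ L v ∈ tangentAt S (L p) := by
  have h1 : tangentConeAt ℝ S (L p) = L.toLinearEquiv.toLinearMap ''
      tangentConeAt ℝ (L ⁻¹' S) p := by
    rw [tangentConeAt_preimage]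
    exact (image_preimage_eq _ L.surjective).symm
  rw [tangentAt, tangentAt, h1, Submodule.span_image]
  refine ⟨fun hv => Submodule.mem_map_of_mem hv, ?_⟩
  rintro ⟨w, hw, hwv⟩
  rwa [← L.injective hwv]

/-- All data are transported by the linear permutation: equations are composed with it and the
projection is conjugated by it. It preserves the sup norm, so the rates and constants are unchanged.
-/
theorem IsPermEquivariant.isNAIM {X : Lift N → Lift N} (hX : IsPermEquivariant X)
    (σ : Equiv.Perm (Fin N)) {r : ℕ} {M : Set (Torus N)} (hM : IsNAIM r X M) :
    IsNAIM r X (reindex σ M) := by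
  have hpre : toTorus ⁻¹' reindex σ M = permLift σ ⁻¹' (toTorus ⁻¹' M) := rfl
  refine ⟨?_, ?_, ?_⟩
  · intro p hp
    obtain ⟨U, hU, hpU, G, hG, hGs, hGU⟩ := hM.submanifold (p ∘ σ) hp
    refine ⟨permLift σ ⁻¹' U, hU.preimage (permLift σ).continuous, hpU, G ∘ permLift σ,
      hG.comp (permLift σ).contDiff.contDiffOn (mapsTo_preimage _ _), fun x hx => ?_, ?_⟩
    · rw [(permLift σ).comp_right_fderiv]
      exact (hGs _ hx).comp (permLift σ).surjective
    · rw [hpre, ← preimage_inter, hGU]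
      rfl
  · intro θ hθ
    obtain ⟨φ, hφ, h0, hm⟩ := hM.invariant (θ ∘ σ) hθ
    refine ⟨fun t => φ t ∘ σ.symm, hX.isSolution σ.symm hφ, by simp only [h0, comp_symm_perm],
      fun t => ?_⟩
    rw [mem_reindex]
    have : toTorus (φ t ∘ σ.symm) ∘ σ = toTorus (φ t) := comp_perm_symm σ (toTorus (φ t))
    rw [this]
    exact hm t
  · obtain ⟨P, hPc, hP, hinv, hrate⟩ := hM.splitting
    have hmap : MapsTo (fun x : Torus N => x ∘ σ) (reindex σ M) M := fun x hx => hx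
    have hcont : Continuous fun x : Torus N => x ∘ σ := (isometry_comp_perm σ).continuous
    let P' : Torus N → Lift N →L[ℝ] Lift N := fun x =>
      ((permLift σ).symm : Lift N →L[ℝ] Lift N).comp
        ((P (x ∘ σ)).comp (permLift σ : Lift N →L[ℝ] Lift N))
    have hP'app : ∀ x v, P' x v = P (x ∘ σ) (v ∘ σ) ∘ σ.symm := fun _ _ => rfl
    have hiff : ∀ (x : Torus N) (v w : Lift N), P' x v = w ↔ P (x ∘ σ) (v ∘ σ) = w ∘ σ := by
      intro x v w
      rw [hP'app]
      constructor
      · rintro rfl; rw [comp_perm_symm]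
      · intro h; rw [h, comp_symm_perm]
    refine ⟨P', ?_, fun θ hθ => ⟨fun v => ?_, ?_⟩, fun φ v hφ h0 hv => ?_, fun K hK hKc => ?_⟩
    · exact continuousOn_const.clm_comp
        ((hPc.comp hcont.continuousOn hmap).clm_comp continuousOn_const)
    · rw [hiff, hP'app, comp_perm_symm]
      exact (hP (θ ∘ σ) hθ).1 _
    · ext v
      rw [SetLike.mem_coe, hpre, mem_tangentAt_preimage, ← SetLike.mem_coe, permLift_apply,
        permLift_apply, ← (hP (θ ∘ σ) hθ).2]
      constructor
      · rintro ⟨w, hw⟩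
        exact ⟨w ∘ σ, (hiff _ _ _).1 hw⟩
      · rintro ⟨w, hw⟩
        refine ⟨w ∘ σ.symm, (hiff _ _ _).2 ?_⟩
        rw [comp_perm_symm]
        exact hw
    · have := hinv _ _ (hX.isSolution σ hφ) h0 (hX.isVariation σ hv)
      refine ⟨fun h t => (hiff _ _ _).2 (this.1 ((hiff _ _ _).1 h) t),
        fun h t => (hiff _ _ _).2 (this.2 ((hiff _ _ _).1 h) t)⟩
    · obtain ⟨a, b, A, hab, hb, hA, H⟩ := hrate ((fun x : Torus N => x ∘ σ) '' K)
        (image_subset_iff.2 hK) (hKc.image hcont)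
      refine ⟨a, b, A, hab, hb, hA, fun φ v hφ h0 hv => ?_⟩
      have := H _ _ (hX.isSolution σ hφ) (mem_image_of_mem _ h0) (hX.isVariation σ hv)
      have hn : ∀ t, ‖v t ∘ σ‖ = ‖v t‖ := fun t => norm_permLift σ (v t)
      simp only [hn] at this
      exact ⟨fun h => this.1 ((hiff _ _ _).1 h), fun h => this.2 ((hiff _ _ _).1 h)⟩

end WS

namespace WS

variable {N : ℕ} [NeZero N]

/-! ### Cyclic shifts of the phases -/

/-- The cyclic shift of the index set by `a`. -/
def rotation (a : Fin N) : Equiv.Perm (Fin N) := Equiv.addRight a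

@[simp]
theorem rotation_apply (a j : Fin N) : rotation a j = j + a := rfl

theorem comp_rotation_rotation {α : Type*} (a b : Fin N) (x : Fin N → α) :
    (x ∘ rotation a) ∘ rotation b = x ∘ rotation (b + a) := by
  ext j; simp [add_assoc]

theorem comp_rotation_zero {α : Type*} (x : Fin N → α) : x ∘ rotation (0 : Fin N) = x := by
  ext j; simp

theorem ofNat_add_ofNat (a b : ℕ) : Fin.ofNat N a + Fin.ofNat N b = Fin.ofNat N (a + b) := by
  ext; simp [Fin.val_add]

theorem ofNat_self_eq_zero : Fin.ofNat N N = 0 := by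
  ext; simp

/-- The action of the cyclic shift on the cross-ratios. -/
noncomputable def shiftParam (l : Param N) : Param N := fun k =>
  if h : (k : ℕ) + 1 < N - 3 then
    (1 - l ⟨0, Nat.zero_lt_of_lt k.2⟩) / (1 - l ⟨k + 1, h⟩)
  else 1 - l ⟨0, Nat.zero_lt_of_lt k.2⟩

/-- The shifted quadruple is `(1, 2, 3, k + 4)`. For `k + 4 < N` it is compared with quadruples
starting at phase `0`; for the last `k` the index wraps to `0`, and the complement formula applies.
-/
theorem crossRatios_comp_rotation_one {θ : Lift N} (hθ : Function.Injective (toTorus θ)) :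
    crossRatios (θ ∘ rotation 1) = shiftParam (crossRatios θ) := by
  funext k
  have hk := k.2
  have h1 : crossRatios (θ ∘ rotation 1) k = crossRatio (Fin.ofNat N 1) (Fin.ofNat N 2)
      (Fin.ofNat N 3) (Fin.ofNat N (k + 4)) θ := by
    change crossRatio (Fin.ofNat N 0 + Fin.ofNat N 1) (Fin.ofNat N 1 + Fin.ofNat N 1)
      (Fin.ofNat N 2 + Fin.ofNat N 1) (Fin.ofNat N (k + 3) + Fin.ofNat N 1) θ = _
    simp only [ofNat_add_ofNat]
  have hne : ∀ a b : ℕ, a < N → b < N → a ≠ b →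
      halfSin (Fin.ofNat N a) (Fin.ofNat N b) θ ≠ 0 :=
    fun a b ha hb hab => halfSin_ofNat_ne_zero hθ ha hb hab
  rw [h1, shiftParam]
  split_ifs with h
  · rw [crossRatio_shift (p := Fin.ofNat N 0) (hne 1 3 (by omega) (by omega) (by omega))
      (hne 1 (k + 4) (by omega) (by omega) (by omega))
      (hne 0 2 (by omega) (by omega) (by omega)) (hne 0 1 (by omega) (by omega) (by omega))
      (hne 2 (k + 4) (by omega) (by omega) (by omega))]
    rfl
  · have hkN : (k : ℕ) + 4 = N := by omega
    rw [hkN, ofNat_self_eq_zero, zero_eq_ofNat,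
      crossRatio_shift_last (hne 1 3 (by omega) (by omega) (by omega))
      (hne 0 2 (by omega) (by omega) (by omega))]
    rfl

theorem differentiableAt_shiftParam {θ : Lift N} (hθ : Function.Injective (toTorus θ)) :
    DifferentiableAt ℝ (shiftParam (N := N)) (crossRatios θ) := by
  rw [differentiableAt_pi]
  intro k
  have hd : ∀ m : Fin (N - 3), DifferentiableAt ℝ (fun l : Param N => 1 - l m) (crossRatios θ) :=
    fun m => (differentiableAt_const _).sub (differentiableAt_apply m _)
  simp only [shiftParam]
  split_ifs with h
  · simp only [div_eq_mul_inv]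
    refine (hd _).mul ((hd _).inv ?_)
    have hk := k.2
    have h1 : halfSin (Fin.ofNat N 1) (Fin.ofNat N (k + 4)) θ ≠ 0 :=
      halfSin_ofNat_ne_zero hθ (by omega) (by omega) (by omega)
    have h2 : halfSin (Fin.ofNat N 0) (Fin.ofNat N 2) θ ≠ 0 :=
      halfSin_ofNat_ne_zero hθ (by omega) (by omega) (by omega)
    change 1 - crossRatio (Fin.ofNat N 0) (Fin.ofNat N 1) (Fin.ofNat N 2)
      (Fin.ofNat N (k + 4)) θ ≠ 0
    rw [one_sub_crossRatio h1 h2]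
    exact div_ne_zero (mul_ne_zero
      (halfSin_ofNat_ne_zero hθ (by omega) (by omega) (by omega))
      (halfSin_ofNat_ne_zero hθ (by omega) (by omega) (by omega))) (mul_ne_zero h1 h2)
  · exact hd _

/-- The cyclic shift maps ordered phases to ordered phases. -/
theorem exists_mem_orderedLift_comp_rotation_one (hN : 2 ≤ N) {θ : Lift N}
    (hθ : θ ∈ orderedLift N) :
    ∃ θ' ∈ orderedLift N, toTorus θ' = toTorus (θ ∘ rotation 1) := by
  have hval : ∀ j : Fin N, j + 1 ≠ 0 → ((j + 1 : Fin N) : ℕ) = j + 1 := by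
    intro j hj
    have h1 : ((1 : Fin N) : ℕ) = 1 := by
      rw [one_eq_ofNat, Fin.val_ofNat, Nat.mod_eq_of_lt (by omega)]
    rw [Fin.val_add, h1]
    refine Nat.mod_eq_of_lt ?_
    by_contra hlt
    have hj' := j.2
    have hjN : (j : ℕ) + 1 = N := by omega
    exact hj (Fin.ext (by rw [Fin.val_add, h1, hjN]; simp))
  have hval0 : ∀ j : Fin N, j + 1 = 0 → (j : ℕ) + 1 = N := by
    intro j hj
    by_contra hlt
    have hj' := j.2
    have h1 : ((1 : Fin N) : ℕ) = 1 := by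
      rw [one_eq_ofNat, Fin.val_ofNat, Nat.mod_eq_of_lt (by omega)]
    have := congrArg Fin.val hj
    rw [Fin.val_add, h1, Nat.mod_eq_of_lt (by omega)] at this
    simp at this
  have hlt0 : ∀ j : Fin N, j ≠ 0 → θ 0 < θ j := fun j hj => hθ.1 (lt_of_le_of_ne (Fin.zero_le j) hj.symm)
  have h10 : (0 : Fin N) + 1 ≠ 0 := by
    rw [zero_add]
    exact ofNat_ne_ofNat (a := 1) (b := 0) (by omega) (by omega) (by omega)
  -- The phase with index `0` becomes the last one and needs `2π` to stay in cyclic order.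
  refine ⟨fun j => θ (j + 1) + if j + 1 = 0 then 2 * Real.pi else 0, ⟨?_, ?_⟩, ?_⟩
  · intro i j hij
    have hij' : (i : ℕ) < j := hij
    have hi : i + 1 ≠ 0 := fun h => by
      have := hval0 i h
      have := j.2
      omega
    by_cases hj : j + 1 = 0
    · simp only [hi, hj, if_true, if_false, add_zero]
      exact hθ.2 _
    · simp only [hi, hj, if_false, add_zero]
      exact hθ.1 (by
        rw [Fin.lt_def, hval i hi, hval j hj]
        omega)
  · intro j
    have h1 := hlt0 _ h10
    simp only [h10, if_false, add_zero]
    by_cases hj : j + 1 = 0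
    · simp only [hj, if_true]
      linarith
    · simp only [hj, if_false, add_zero]
      linarith [hθ.2 (j + 1)]
  · funext j
    simp only [toTorus, Function.comp_apply, rotation_apply]
    split_ifs
    · simp
    · simp

theorem comp_rotation_one_mem_levelSet (hN : 2 ≤ N) {l : Param N} {x : Torus N}
    (hx : x ∈ levelSet l) : x ∘ rotation 1 ∈ levelSet (shiftParam l) := by
  obtain ⟨θ, ⟨hθ, rfl⟩, rfl⟩ := hx
  obtain ⟨θ', hθ', h⟩ := exists_mem_orderedLift_comp_rotation_one hN hθ
  refine ⟨θ', ⟨hθ', ?_⟩, h⟩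
  rw [crossRatios_congr h, crossRatios_comp_rotation_one (toTorus_injective_of_mem_orderedLift hθ)]

/-! ### The splay configuration -/

theorem uniformPhases_mem_orderedLift : uniformPhases N ∈ orderedLift N := by
  have hN0 : (0 : ℝ) < N := Nat.cast_pos.2 (Nat.pos_of_ne_zero (NeZero.ne N))
  have hpos : 0 < 2 * Real.pi / N := by positivity
  refine ⟨fun i j hij => ?_, fun j => ?_⟩
  · have : ((i : ℕ) : ℝ) < (j : ℕ) := by exact_mod_cast hij
    have := mul_lt_mul_of_pos_left this hpos
    simp only [uniformPhases]
    linarith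
  · have : ((j : ℕ) : ℝ) < N := by exact_mod_cast j.2
    have h1 := mul_lt_mul_of_pos_left this hpos
    rw [div_mul_cancel₀ _ hN0.ne'] at h1
    simp only [uniformPhases, Fin.val_zero, Nat.cast_zero, mul_zero]
    linarith

theorem injective_uniformPhases : Function.Injective (toTorus (uniformPhases N)) :=
  toTorus_injective_of_mem_orderedLift uniformPhases_mem_orderedLift

/-- The cyclic shift rotates the uniform phases. -/
theorem uniformPhases_comp_rotation_one :
    ∃ (c : Lift N) (ζ : Real.Angle), (∀ j, (c j : Real.Angle) = ζ) ∧
      uniformPhases N ∘ rotation 1 = uniformPhases N + c := by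
  have hN0 : (N : ℝ) ≠ 0 := Nat.cast_ne_zero.2 (NeZero.ne N)
  refine ⟨uniformPhases N ∘ rotation 1 - uniformPhases N, ((2 * Real.pi / N : ℝ) : Real.Angle),
    fun j => ?_, by abel⟩
  rw [Real.Angle.angle_eq_iff_two_pi_dvd_sub]
  have hval : ((j + 1 : Fin N) : ℕ) = (j + 1) % N := by
    rw [Fin.val_add, one_eq_ofNat, Fin.val_ofNat, Nat.add_mod_mod]
  have hj := j.2
  rcases Nat.lt_or_ge ((j : ℕ) + 1) N with h | h
  · refine ⟨0, ?_⟩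
    simp only [Pi.sub_apply, Function.comp_apply, rotation_apply, uniformPhases, hval,
      Nat.mod_eq_of_lt h]
    push_cast
    ring
  · have hjN : (j : ℕ) + 1 = N := by omega
    refine ⟨-1, ?_⟩
    have hjr : ((j : ℕ) : ℝ) = N - 1 := by
      rw [eq_sub_iff_add_eq]; exact_mod_cast hjN
    simp only [Pi.sub_apply, Function.comp_apply, rotation_apply, uniformPhases, hval,
      hjN, Nat.mod_self, hjr]
    push_cast
    field_simp
    ring

/-- The shift merely rotates the uniform phases, and cross-ratios are rotation invariant. -/
theorem shiftParam_splayParam : shiftParam (splayParam N) = splayParam N := by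
  obtain ⟨c, ζ, hc, h⟩ := uniformPhases_comp_rotation_one (N := N)
  rw [splayParam, ← crossRatios_comp_rotation_one injective_uniformPhases, h, crossRatios_add hc]

theorem comp_rotation_mem_levelSet_splayParam (hN : 2 ≤ N) {x : Torus N}
    (hx : x ∈ levelSet (splayParam N)) (a : Fin N) :
    x ∘ rotation a ∈ levelSet (splayParam N) := by
  have key : ∀ n : ℕ, x ∘ rotation (Fin.ofNat N n) ∈ levelSet (splayParam N) := by
    intro n
    induction n with
    | zero =>
      rw [← zero_eq_ofNat, comp_rotation_zero]
      exact hx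
    | succ n ih =>
      have := comp_rotation_one_mem_levelSet hN ih
      rwa [shiftParam_splayParam, comp_rotation_rotation, one_eq_ofNat, ofNat_add_ofNat,
        add_comm] at this
  simpa using key a

theorem mem_levelSet_splayParam_iff (hN : 2 ≤ N) (x : Torus N) (a : Fin N) :
    x ∈ levelSet (splayParam N) ↔ x ∘ rotation a ∈ levelSet (splayParam N) := by
  refine ⟨fun hx => comp_rotation_mem_levelSet_splayParam hN hx a, fun hx => ?_⟩
  have := comp_rotation_mem_levelSet_splayParam hN hx (-a)
  rwa [comp_rotation_rotation, neg_add_cancel, comp_rotation_zero] at this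

theorem fderiv_crossRatios_comp_rotation_one {θ : Lift N}
    (hθ : Function.Injective (toTorus θ)) (v : Lift N) :
    fderiv ℝ (crossRatios (N := N)) (θ ∘ rotation 1) (v ∘ rotation 1) =
      fderiv ℝ (shiftParam (N := N)) (crossRatios θ) (fderiv ℝ (crossRatios (N := N)) θ v) := by
  have hθ' : Function.Injective (toTorus (θ ∘ rotation 1)) :=
    hθ.comp (rotation (1 : Fin N)).injective
  have h1 : HasFDerivAt (fun x : Lift N => crossRatios (permLift (rotation 1) x))
      ((fderiv ℝ (crossRatios (N := N)) (θ ∘ rotation 1)).comp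
        (permLift (rotation (1 : Fin N)) : Lift N →L[ℝ] Lift N)) θ :=
    HasFDerivAt.comp (g := crossRatios) (f := permLift (rotation (1 : Fin N))) θ
      ((contDiffAt_crossRatios (n := 1) hθ').differentiableAt one_ne_zero).hasFDerivAt
      (permLift (rotation (1 : Fin N))).hasFDerivAt
  have h2 := (differentiableAt_shiftParam hθ).hasFDerivAt.comp θ
    ((contDiffAt_crossRatios (n := 1) hθ).differentiableAt one_ne_zero).hasFDerivAt
  have h3 : (fun x : Lift N => crossRatios (permLift (rotation 1) x)) =ᶠ[𝓝 θ]
      shiftParam ∘ crossRatios := by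
    filter_upwards [isOpen_injective_toTorus.mem_nhds hθ] with x hx
    exact crossRatios_comp_rotation_one hx
  exact DFunLike.congr_fun (h1.unique (h2.congr_of_eventuallyEq h3)) v

/-- The derivative of the cyclic shift at the splay state has no nonzero fixed vector. -/
theorem eq_zero_of_fderiv_shiftParam_eq {d : Param N}
    (hd : fderiv ℝ (shiftParam (N := N)) (splayParam N) d = d) : d = 0 := by
  obtain ⟨v, hv⟩ := surjective_fderiv_crossRatios (injective_uniformPhases (N := N)) d
  obtain ⟨c, ζ, hc, h⟩ := uniformPhases_comp_rotation_one (N := N)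
  set L := fderiv ℝ (crossRatios (N := N)) (uniformPhases N) with hL
  have hstep : ∀ u, L u = d → L (u ∘ rotation 1) = d := by
    intro u hu
    have := fderiv_crossRatios_comp_rotation_one injective_uniformPhases u
    rw [h, fderiv_crossRatios_add hc, ← hL, hu] at this
    exact this.trans hd
  have hall : ∀ n : ℕ, L (v ∘ rotation (Fin.ofNat N n)) = d := by
    intro n
    induction n with
    | zero => rwa [← zero_eq_ofNat, comp_rotation_zero]
    | succ n ih =>
      have := hstep _ ih
      rwa [comp_rotation_rotation, one_eq_ofNat, ofNat_add_ofNat, add_comm] at this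
  have hall' : ∀ a : Fin N, L (v ∘ rotation a) = d := fun a => by simpa using hall a
  have hsum : L (∑ a, v ∘ rotation a) = (N : ℝ) • d := by
    rw [map_sum, Finset.sum_congr rfl fun a _ => hall' a]
    simp [Nat.cast_smul_eq_nsmul]
  -- The sum over all shifts is constant in `j`, an infinitesimal rotation, so `DΛ` annihilates it.
  have hconst : ∀ j, (∑ a, v ∘ rotation a) j = 0 * Real.cos (uniformPhases N j) +
      0 * Real.sin (uniformPhases N j) + ∑ a, v a := by
    intro j
    rw [Finset.sum_apply]
    simp only [Function.comp_apply, rotation_apply, zero_mul, zero_add]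
    exact Equiv.sum_comp (Equiv.addLeft j) v
  rw [fderiv_crossRatios_moebius injective_uniformPhases hconst] at hsum
  exact (smul_eq_zero.1 hsum.symm).resolve_left (Nat.cast_ne_zero.2 (NeZero.ne N))

end WS

namespace WS

variable {N : ℕ} [NeZero N] {f : ℂ → ℂ} {g : ℂ → ℝ} {h : ℝ → ℝ} {r : ℕ}
  {W : Set (Param N)} {C : Param N → Set (Torus N)}

/-! ### Averages over the orbits of a continuum -/

theorem IsContinuum.averagedDrift_eq (hN : 2 ≤ N) (hf : ContDiffOn ℝ ∞ f (Metric.ball 0 1))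
    (hg : ContDiffOn ℝ ∞ g (Metric.ball 0 1)) (hh : IsNormalizedPerturbation h)
    (hM : IsContinuum r (field f g) W C) {l : Param N} (hl : l ∈ W) {φ ψ : ℝ → Lift N} {T S : ℝ}
    (hφ : IsSolution (field f g) φ) (hφC : toTorus (φ 0) ∈ C l) (hT : IsPeriodOf φ T)
    (hψ : IsSolution (field f g) ψ) (hψC : toTorus (ψ 0) ∈ C l) (hS0 : 0 < S)
    (hS : Function.Periodic (fun t => toTorus (ψ t)) S) :
    averagedDrift crossRatios h ψ S = averagedDrift crossRatios h φ T :=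
  (hM.orbit l hl).1.average_eq hN hf hg (fun _ hx => hM.injective hl hx)
    (fun _ _ hθ => drift_crossRatios_congr hh hθ) (fun _ hθ => (contDiffAt_drift hh hθ).continuousAt)
    hφ hφC hψ hψC hT hS0 hS

theorem IsContinuum.solution_mem (hN : 2 ≤ N) (hf : ContDiffOn ℝ ∞ f (Metric.ball 0 1))
    (hg : ContDiffOn ℝ ∞ g (Metric.ball 0 1)) (hM : IsContinuum r (field f g) W C) {l : Param N}
    (hl : l ∈ W) {φ : ℝ → Lift N} (hφ : IsSolution (field f g) φ) (hφC : toTorus (φ 0) ∈ C l)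
    (t : ℝ) : toTorus (φ t) ∈ C l :=
  (hM.orbit l hl).1.mem hN hf hg (fun _ hx => hM.injective hl hx) hφ hφC t

theorem IsContinuum.splayParam_mem {X : Lift N → Lift N} (hM : IsContinuum r X W C) :
    splayParam N ∈ W := by
  obtain ⟨δ, hδ, hb, -⟩ := hM.base
  exact hb (Metric.mem_closedBall_self hδ.le)

/-- The orbit over the splay parameter is invariant under cyclic shifts. -/
theorem IsContinuum.comp_rotation_mem_iff {X : Lift N → Lift N} (hN : 2 ≤ N)
    (hX : IsPermEquivariant X) (hM : IsContinuum r X W C) (a : Fin N) (x : Torus N) :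
    x ∘ rotation a ∈ C (splayParam N) ↔ x ∈ C (splayParam N) := by
  obtain ⟨δ, hδ, -, huniq⟩ := hM.base
  have := huniq _ (Metric.mem_closedBall_self hδ.le) _
    (hX.isStableOrbit (rotation a) (fun x => mem_levelSet_splayParam_iff hN x a)
      (hM.orbit _ hM.splayParam_mem))
  rw [← mem_reindex, this]

/-- The same `h` acts on every phase, so the perturbation commutes with relabelling, and the chain
rule for the shift applies to it. -/
theorem drift_comp_rotation_one {θ : Lift N} (hθ : Function.Injective (toTorus θ)) :
    drift crossRatios h (θ ∘ rotation 1) =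
      fderiv ℝ (shiftParam (N := N)) (crossRatios θ) (drift crossRatios h θ) :=
  fderiv_crossRatios_comp_rotation_one hθ fun j => h (θ j)

/-- The averaged drift along a cyclically shifted solution. -/
theorem averagedDrift_comp_rotation_one (hh : IsNormalizedPerturbation h) {φ : ℝ → Lift N}
    (hφ : Continuous φ) (hinj : ∀ t, Function.Injective (toTorus (φ t))) {l : Param N}
    (hl : ∀ t, crossRatios (φ t) = l) (T : ℝ) :
    averagedDrift crossRatios h (fun t => φ t ∘ rotation 1) T =
      fderiv ℝ (shiftParam (N := N)) l (averagedDrift crossRatios h φ T) := by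
  have hc := continuous_drift hh (fun θ hθ => contDiffAt_crossRatios hθ) hφ hinj
  simp only [averagedDrift, drift_comp_rotation_one (hinj _), hl, map_smul]
  rw [ContinuousLinearMap.intervalIntegral_comp_comm _ (hc.intervalIntegrable _ _)]

/-- The shifted solution runs through the same orbit, so the average is fixed by the derivative of
the shift at `λ*`, which has no nonzero fixed vector. -/
theorem IsContinuum.averagedDrift_splayParam (hN : 2 ≤ N)
    (hf : ContDiffOn ℝ ∞ f (Metric.ball 0 1)) (hg : ContDiffOn ℝ ∞ g (Metric.ball 0 1))
    (hh : IsNormalizedPerturbation h) (hM : IsContinuum r (field f g) W C) {φ : ℝ → Lift N} {T : ℝ}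
    (hφ : IsSolution (field f g) φ) (hφC : toTorus (φ 0) ∈ C (splayParam N))
    (hT : IsPeriodOf φ T) : averagedDrift crossRatios h φ T = 0 := by
  have hl := hM.splayParam_mem
  have hX := isPermEquivariant_field (N := N) f g
  have hmem := hM.solution_mem hN hf hg hl hφ hφC
  have hT' := isPeriodOf_comp_perm (rotation 1) hT
  have h1 := hM.averagedDrift_eq hN hf hg hh hl hφ hφC hT (hX.isSolution (rotation 1) hφ)
    ((hM.comp_rotation_mem_iff hN hX 1 _).2 hφC) hT'.1.1 hT'.1.2
  rw [averagedDrift_comp_rotation_one hh hφ.continuous (fun t => hM.injective hl (hmem t))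
    (fun t => crossRatios_of_mem_levelSet ((hM.orbit _ hl).2.1 (hmem t)))] at h1
  exact eq_zero_of_fderiv_shiftParam_eq h1

/-! ### Consecutive cross-ratios -/

theorem consecutiveCrossRatios_apply (θ : Lift N) (k : Fin (N - 3)) :
    consecutiveCrossRatios θ k =
      crossRatios (θ ∘ rotation (Fin.ofNat N k)) ⟨0, Nat.zero_lt_of_lt k.2⟩ := by
  change _ = crossRatio (Fin.ofNat N 0 + Fin.ofNat N k) (Fin.ofNat N 1 + Fin.ofNat N k)
    (Fin.ofNat N 2 + Fin.ofNat N k) (Fin.ofNat N (0 + 3) + Fin.ofNat N k) θ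
  simp only [ofNat_add_ofNat, consecutiveCrossRatios, zero_add, add_comm _ (k : ℕ), add_zero]

theorem drift_consecutiveCrossRatios_apply {θ : Lift N} (hθ : Function.Injective (toTorus θ))
    (k : Fin (N - 3)) :
    drift consecutiveCrossRatios h θ k =
      drift crossRatios h (θ ∘ rotation (Fin.ofNat N k)) ⟨0, Nat.zero_lt_of_lt k.2⟩ := by
  set σ := rotation (Fin.ofNat N k) with hσ
  have hθ' : Function.Injective (toTorus (θ ∘ σ)) := hθ.comp σ.injective
  have h1 : HasFDerivAt (consecutiveCrossRatios (N := N))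
      (fderiv ℝ (consecutiveCrossRatios (N := N)) θ) θ :=
    ((contDiffAt_consecutiveCrossRatios (n := 1) hθ).differentiableAt one_ne_zero).hasFDerivAt
  have h2 : HasFDerivAt (fun x : Lift N => crossRatios (permLift σ x))
      ((fderiv ℝ (crossRatios (N := N)) (θ ∘ σ)).comp
        (permLift σ : Lift N →L[ℝ] Lift N)) θ :=
    HasFDerivAt.comp (g := crossRatios) (f := permLift σ) θ
      ((contDiffAt_crossRatios (n := 1) hθ').differentiableAt one_ne_zero).hasFDerivAt
      (permLift σ).hasFDerivAt
  have h3 := hasFDerivAt_pi'.1 h1 k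
  have h4 := hasFDerivAt_pi'.1 h2 ⟨0, Nat.zero_lt_of_lt k.2⟩
  have h5 : (fun x : Lift N => crossRatios (permLift σ x) ⟨0, Nat.zero_lt_of_lt k.2⟩) =
      fun x => consecutiveCrossRatios x k :=
    funext fun x => (consecutiveCrossRatios_apply x k).symm
  rw [h5] at h4
  exact DFunLike.congr_fun (h3.unique h4) fun j => h (θ j)

theorem IsContinuum.averagedDrift_consecutive_splayParam (hN : 2 ≤ N)
    (hf : ContDiffOn ℝ ∞ f (Metric.ball 0 1)) (hg : ContDiffOn ℝ ∞ g (Metric.ball 0 1))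
    (hh : IsNormalizedPerturbation h) (hM : IsContinuum r (field f g) W C) {φ : ℝ → Lift N} {T : ℝ}
    (hφ : IsSolution (field f g) φ) (hφC : toTorus (φ 0) ∈ C (splayParam N))
    (hT : IsPeriodOf φ T) : averagedDrift consecutiveCrossRatios h φ T = 0 := by
  have hl := hM.splayParam_mem
  have hX := isPermEquivariant_field (N := N) f g
  have hmem := hM.solution_mem hN hf hg hl hφ hφC
  have hinj := fun t => hM.injective hl (hmem t)
  ext k
  set σ := rotation (Fin.ofNat N k) with hσ
  have hφσ := hX.isSolution σ hφ
  have h0 := hM.averagedDrift_splayParam hN hf hg hh hφσ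
    ((hM.comp_rotation_mem_iff hN hX _ _).2 hφC) (isPeriodOf_comp_perm σ hT)
  have h1 := congrFun h0 ⟨0, Nat.zero_lt_of_lt k.2⟩
  rw [averagedDrift_apply hh (fun θ hθ => contDiffAt_crossRatios hθ) hφσ.continuous
    fun t => (hinj t).comp σ.injective] at h1
  rw [averagedDrift_apply hh (fun θ hθ => contDiffAt_consecutiveCrossRatios hθ) hφ.continuous hinj]
  simp only [drift_consecutiveCrossRatios_apply (hinj _)]
  exact h1

/-! ### Four phases -/

theorem shiftParam_eq_one_sub {n : ℕ} (hn : n = 4) (l : Param n) : shiftParam l = 1 - l := by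
  funext k
  have hk := k.2
  rw [shiftParam, dif_neg (by omega), Pi.sub_apply, Pi.one_apply]
  congr 2
  exact Fin.ext (by simp only; omega)

theorem one_sub_splayParam (hN : N = 4) : 1 - splayParam N = splayParam N := by
  rw [← shiftParam_eq_one_sub hN, shiftParam_splayParam]

theorem splayParam_eq_half (hN : N = 4) : splayParam N = fun _ => 1 / 2 := by
  funext k
  have := congrFun (one_sub_splayParam hN) k
  simp only [Pi.sub_apply, Pi.one_apply] at this
  linarith

/-- Four shifts are the identity, so three further forward steps give the converse. -/
theorem mem_levelSet_iff_of_eq_four (hN : N = 4) (l : Param N) (x : Torus N) :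
    x ∈ levelSet l ↔ x ∘ rotation 1 ∈ levelSet (1 - l) := by
  have hstep : ∀ {l : Param N} {x : Torus N}, x ∈ levelSet l →
      x ∘ rotation 1 ∈ levelSet (1 - l) := fun {l x} hx => by
    rw [← shiftParam_eq_one_sub hN]
    exact comp_rotation_one_mem_levelSet (by omega) hx
  refine ⟨hstep, fun hx => ?_⟩
  have h4 := hstep (hstep (hstep hx))
  have h0 : (1 + (1 + (1 + 1)) : Fin N) = 0 := by
    rw [one_eq_ofNat, ofNat_add_ofNat, ofNat_add_ofNat, ofNat_add_ofNat]
    subst hN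
    exact ofNat_self_eq_zero
  simpa [comp_rotation_rotation, h0, comp_rotation_zero] using h4

/-- For four phases, the cyclic shift reflects every continuum. -/
theorem IsContinuum.reflect {X : Lift N → Lift N} (hN : N = 4) (hX : IsPermEquivariant X)
    (hM : IsContinuum r X W C) :
    IsContinuum r X {l | 1 - l ∈ W} fun l => reindex (rotation 1) (C (1 - l)) := by
  have hcont : Continuous fun l : Param N => 1 - l := continuous_const.sub continuous_id
  have hstable : ∀ {l C'}, IsStableOrbit X l C' →
      IsStableOrbit X (1 - l) (reindex (rotation 1) C') := fun {l C'} hC' =>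
    hX.isStableOrbit (rotation 1) (fun x => by
      rw [mem_levelSet_iff_of_eq_four hN, sub_sub_cancel]) hC'
  refine ⟨hM.isOpen.preimage hcont, fun l hl => ⟨fun k => ?_, ?_⟩, fun l hl => ?_, ?_, ?_⟩
  · have := (hM.subset hl).1 k
    simp only [Pi.sub_apply, Pi.one_apply, mem_Ioo] at this
    exact ⟨by linarith, by linarith⟩
  · intro i j hij
    have hi := i.2
    have hj := j.2
    have hij' : (i : ℕ) < j := hij
    omega
  · have := hstable (hM.orbit _ hl)
    rwa [sub_sub_cancel] at this
  · have : (⋃ l ∈ {l | 1 - l ∈ W}, reindex (rotation 1) (C (1 - l))) =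
        reindex (rotation 1) (⋃ l ∈ W, C l) := by
      ext x
      simp only [mem_iUnion, mem_reindex, exists_prop]
      constructor
      · rintro ⟨l, hl, hx⟩
        exact ⟨1 - l, hl, hx⟩
      · rintro ⟨l, hl, hx⟩
        refine ⟨1 - l, ?_, by rwa [sub_sub_cancel]⟩
        change 1 - (1 - l) ∈ W
        rwa [sub_sub_cancel]
    rw [this]
    exact hX.isNAIM (rotation 1) hM.naim
  · obtain ⟨δ, hδ, hb, huniq⟩ := hM.base
    -- The reflection `l ↦ 1 - l` is an isometry that fixes `λ*`, so it preserves the ball on which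
    -- uniqueness is known.
    have hball : ∀ l ∈ Metric.closedBall (splayParam N) δ,
        1 - l ∈ Metric.closedBall (splayParam N) δ := by
      intro l hl
      rw [Metric.mem_closedBall, ← one_sub_splayParam hN, dist_sub_left]
      exact hl
    refine ⟨δ, hδ, fun l hl => hb (hball l hl), fun l hl C' hC' => ?_⟩
    have hC'' : IsStableOrbit X (1 - l) (reindex (rotation 1).symm C') :=
      hX.isStableOrbit (rotation 1).symm (fun x => by
        rw [mem_levelSet_iff_of_eq_four hN l, comp_perm_symm]) hC'
    rw [← huniq _ (hball l hl) _ hC'', reindex_symm_reindex]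

theorem averagedDrift_comp_rotation_one_of_eq_four (hN : N = 4) (hh : IsNormalizedPerturbation h)
    {φ : ℝ → Lift N} (hφ : Continuous φ) (hinj : ∀ t, Function.Injective (toTorus (φ t)))
    {l : Param N} (hl : ∀ t, crossRatios (φ t) = l) (T : ℝ) :
    averagedDrift crossRatios h (fun t => φ t ∘ rotation 1) T =
      -averagedDrift crossRatios h φ T := by
  rw [averagedDrift_comp_rotation_one hh hφ hinj hl,
    show shiftParam (N := N) = fun l => 1 - l from funext (shiftParam_eq_one_sub hN),
    fderiv_const_sub]
  simp

/-- The symmetry of the averaged drift of a maximal continuum for four phases. -/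
theorem one_sub_mem_and_averagedDrift_eq_neg (hN : N = 4)
    (hf : ContDiffOn ℝ ∞ f (Metric.ball 0 1))
    (hg : ContDiffOn ℝ ∞ g (Metric.ball 0 1)) (hh : IsNormalizedPerturbation h)
    (hmax : IsLargestContinuum r (field f g) W C ∨ IsLargestConnectedContinuum r (field f g) W C)
    {F : Param N → Param N}
    (hF : ∀ l ∈ W, ∀ (φ : ℝ → Lift N) (T : ℝ), IsSolution (field f g) φ → toTorus (φ 0) ∈ C l →
      IsPeriodOf φ T → F l = averagedDrift crossRatios h φ T) {l : Param N} (hl : l ∈ W) :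
    1 - l ∈ W ∧ F l = -F (1 - l) := by
  have hN2 : 2 ≤ N := by omega
  have hX := isPermEquivariant_field (N := N) f g
  have hM : IsContinuum r (field f g) W C := hmax.elim (fun h => h.1) fun h => h.1
  have hM' := hM.reflect hN hX
  -- Maximality applied to the reflected continuum gives both the symmetry of `W` and the equality
  -- of the orbits; in the connected case the reflected parameter set is a continuous image of `W`.
  have hsub : {l | 1 - l ∈ W} ⊆ W ∧
      ∀ l ∈ {l | 1 - l ∈ W}, reindex (rotation 1) (C (1 - l)) = C l := by
    rcases hmax with hmax | hmax
    · exact hmax.2 _ _ hM'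
    · refine hmax.2.2 _ _ hM' ?_
      have : {l | 1 - l ∈ W} = (fun l => 1 - l) '' W := by
        ext l
        refine ⟨fun hl => ⟨1 - l, hl, sub_sub_cancel _ _⟩, ?_⟩
        rintro ⟨l', hl', rfl⟩
        change 1 - (1 - l') ∈ W
        rwa [sub_sub_cancel]
      rw [this]
      exact hmax.2.1.image _ (continuous_const.sub continuous_id).continuousOn
  have hl' : 1 - l ∈ {l | 1 - l ∈ W} := by
    change 1 - (1 - l) ∈ W
    rwa [sub_sub_cancel]
  have hlW := hsub.1 hl'
  have hC := hsub.2 _ hl'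
  rw [sub_sub_cancel] at hC
  refine ⟨hlW, ?_⟩
  obtain ⟨x, hx⟩ := (hM.orbit _ hlW).1.nonempty
  obtain ⟨θ, rfl⟩ := surjective_toTorus x
  obtain ⟨φ, T, hφ, rfl, hT, -⟩ := (hM.orbit _ hlW).1.exists_solution hx
  have hmem := hM.solution_mem hN2 hf hg hlW hφ hx
  have hxC : toTorus (φ 0 ∘ rotation 1) ∈ C l := by
    rw [← hC] at hx
    exact hx
  rw [hF _ hlW φ T hφ hx hT, hF l hl _ T (hX.isSolution (rotation 1) hφ) hxC
    (isPeriodOf_comp_perm _ hT)]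
  exact averagedDrift_comp_rotation_one_of_eq_four hN hh hφ.continuous
    (fun t => hM.injective hlW (hmem t))
    (fun t => crossRatios_of_mem_levelSet ((hM.orbit _ hlW).2.1 (hmem t))) T

/-- The averaged drift is continuously differentiable in the cross-ratios. -/
theorem IsContinuum.contDiffOn_averagedDrift (hN : 4 ≤ N) (hr : 1 ≤ r)
    (hf : ContDiffOn ℝ ∞ f (Metric.ball 0 1)) (hg : ContDiffOn ℝ ∞ g (Metric.ball 0 1))
    (hh : IsNormalizedPerturbation h) (hM : IsContinuum r (field f g) W C)
    {F : Param N → Param N}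
    (hF : ∀ l ∈ W, ∀ (φ : ℝ → Lift N) (T : ℝ), IsSolution (field f g) φ → toTorus (φ 0) ∈ C l →
      IsPeriodOf φ T → F l = averagedDrift crossRatios h φ T) : ContDiffOn ℝ 1 F W := by
  refine contDiffOn_one_of_hasStrictFDerivAt hM.isOpen fun l₀ hl₀ => ?_
  have hD : ContDiffOn ℝ 1 (drift (N := N) crossRatios h) {θ | Function.Injective (toTorus θ)} :=
    fun θ hθ => (contDiffAt_drift hh hθ).contDiffWithinAt
  obtain ⟨G, G', hG, hev⟩ := hM.exists_hasStrictFDerivAt_average hN hr hf hg hD hl₀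
  refine ⟨G', hG.congr_of_eventuallyEq ?_⟩
  filter_upwards [hev, hM.isOpen.mem_nhds hl₀] with l ⟨ψ, S, hψ, hψC, hS0, hS, hGl⟩ hl
  obtain ⟨φ, T, hφ, hφ0, hT, -⟩ := (hM.orbit l hl).1.exists_solution hψC
  rw [hGl, hF l hl φ T hφ (hφ0 ▸ hψC) hT]
  exact hM.averagedDrift_eq (by omega) hf hg hh hl hφ (hφ0 ▸ hψC) hT hψ hψC hS0 hS

end WS

/-! ### Assembly of the statements -/

theorem theorem5p1 (N : ℕ) [NeZero N] (hN : 4 ≤ N) (r : ℕ) (hr : 1 ≤ r)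
    (f : ℂ → ℂ) (g : ℂ → ℝ)
    (hf : ContDiffOn ℝ ∞ f (Metric.ball 0 1)) (hg : ContDiffOn ℝ ∞ g (Metric.ball 0 1))
    (h : ℝ → ℝ) (hh : IsNormalizedPerturbation h)
    (W : Set (Param N)) (C : Param N → Set (Torus N))
    (hM : IsContinuum r (field f g) W C) :
    -- every base point determines its solution and its period
    (∀ l ∈ W, (C l).Nonempty ∧ ∀ θ : Lift N, toTorus θ ∈ C l →
      (∃! φ : ℝ → Lift N, IsSolution (field f g) φ ∧ φ 0 = θ) ∧
      ∀ φ : ℝ → Lift N, IsSolution (field f g) φ → φ 0 = θ → ∃ T, IsPeriodOf φ T) ∧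
    ∃ F : Param N → Param N,
      -- `F` is the orbit average, whatever the base point
      (∀ l ∈ W, ∀ (φ : ℝ → Lift N) (T : ℝ), IsSolution (field f g) φ → toTorus (φ 0) ∈ C l →
        IsPeriodOf φ T →
          (∀ t, DifferentiableAt ℝ (crossRatios (N := N)) (φ t)) ∧
          IntervalIntegrable (fun t => drift crossRatios h (φ t)) MeasureTheory.volume 0 T ∧
          F l = averagedDrift crossRatios h φ T) ∧
      ContDiffOn ℝ 1 F W ∧
      -- the symmetry for four phases
      (N = 4 →
        IsLargestContinuum r (field f g) W C ∨ IsLargestConnectedContinuum r (field f g) W C →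
          (∀ l ∈ W, 1 - l ∈ W ∧ F l = -F (1 - l)) ∧
          splayParam N = (fun _ => 1 / 2) ∧ F (fun _ => 1 / 2) = 0) ∧
      -- the drift vanishes at the splay state, in both systems of coordinates
      F (splayParam N) = 0 ∧
      ∀ (φ : ℝ → Lift N) (T : ℝ), IsSolution (field f g) φ →
        toTorus (φ 0) ∈ C (splayParam N) → IsPeriodOf φ T →
          (∀ t, DifferentiableAt ℝ (consecutiveCrossRatios (N := N)) (φ t)) ∧
          averagedDrift consecutiveCrossRatios h φ T = 0 := by
  have hN2 : 2 ≤ N := by omega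
  -- One representative solution per orbit defines the average; off `W` the value is arbitrary.
  have hrep : ∀ l : Param N, ∃ d : Param N, l ∈ W → ∀ (φ : ℝ → Lift N) (T : ℝ),
      IsSolution (field f g) φ → toTorus (φ 0) ∈ C l → IsPeriodOf φ T →
        d = averagedDrift crossRatios h φ T := by
    intro l
    by_cases hl : l ∈ W
    · obtain ⟨x, hx⟩ := (hM.orbit l hl).1.nonempty
      obtain ⟨θ, rfl⟩ := surjective_toTorus x
      obtain ⟨ψ, S, hψ, rfl, hS, -⟩ := (hM.orbit l hl).1.exists_solution hx
      exact ⟨averagedDrift crossRatios h ψ S, fun _ φ T hφ hφC hT =>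
        hM.averagedDrift_eq hN2 hf hg hh hl hφ hφC hT hψ hx hS.1.1 hS.1.2⟩
    · exact ⟨0, fun h => absurd h hl⟩
  choose F hF' using hrep
  have hF : ∀ l ∈ W, ∀ (φ : ℝ → Lift N) (T : ℝ), IsSolution (field f g) φ →
      toTorus (φ 0) ∈ C l → IsPeriodOf φ T → F l = averagedDrift crossRatios h φ T :=
    fun l hl => hF' l hl
  have hF0 : F (splayParam N) = 0 := by
    obtain ⟨x, hx⟩ := (hM.orbit _ hM.splayParam_mem).1.nonempty
    obtain ⟨θ, rfl⟩ := surjective_toTorus x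
    obtain ⟨φ, T, hφ, rfl, hT, -⟩ := (hM.orbit _ hM.splayParam_mem).1.exists_solution hx
    rw [hF _ hM.splayParam_mem φ T hφ hx hT]
    exact hM.averagedDrift_splayParam hN2 hf hg hh hφ hx hT
  refine ⟨fun l hl => ⟨(hM.orbit l hl).1.nonempty, fun θ hθ => ⟨?_, fun φ hφ h0 => ?_⟩⟩, F,
    fun l hl φ T hφ hφC hT => ?_, hM.contDiffOn_averagedDrift hN hr hf hg hh hF,
    fun hN4 hmax => ⟨fun l hl => one_sub_mem_and_averagedDrift_eq_neg hN4 hf hg hh hmax hF hl,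
      splayParam_eq_half hN4, splayParam_eq_half hN4 ▸ hF0⟩, hF0, fun φ T hφ hφC hT => ?_⟩
  · obtain ⟨φ, T, hφ, h0, hT, -⟩ := (hM.orbit l hl).1.exists_solution hθ
    have hmem := hM.solution_mem hN2 hf hg hl hφ (h0 ▸ hθ)
    exact ⟨φ, ⟨hφ, h0⟩, fun ψ hψ => (field_solution_unique hN2 hf hg hφ hψ.1
      (fun t => hM.injective hl (hmem t)) (h0.trans hψ.2.symm)).symm⟩
  · exact ((hM.orbit l hl).1.eq_range hN2 hf hg (fun _ hx => hM.injective hl hx) hφ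
      (h0 ▸ hθ)).1
  · have hinj := fun t => hM.injective hl (hM.solution_mem hN2 hf hg hl hφ hφC t)
    exact ⟨fun t => (contDiffAt_crossRatios (n := 1) (hinj t)).differentiableAt one_ne_zero,
      (continuous_drift hh (fun θ hθ => contDiffAt_crossRatios hθ) hφ.continuous
        hinj).intervalIntegrable _ _, hF l hl φ T hφ hφC hT⟩
  · have hl := hM.splayParam_mem
    have hinj := fun t => hM.injective hl (hM.solution_mem hN2 hf hg hl hφ hφC t)
    exact ⟨fun t => (contDiffAt_consecutiveCrossRatios (n := 1) (hinj t)).differentiableAt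
      one_ne_zero, hM.averagedDrift_consecutive_splayParam hN2 hf hg hh hφ hφC hT⟩
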